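/- **Setting.** Let $U\subset\mathbb R^4$ be an open coordinate domain with coordinates $(\tau,\rho,x^3,x^4)$ and let $g_{ab}$ be a smooth Lorentzian metric on $U$ (signature $-+++$) for which $\tau$ is a time function with spacelike level surfaces $\Sigma_\tau$ (in particular $\Sigma_0$). The surfaces $\mathcal S_{\tau,\rho}$ of constant $\tau,\rho$ foliate $\Sigma_\tau$. Let $n^a$ be the future unit normal of $\Sigma_\tau$, $N$ and $N^a$ the lapse and shift of $\partial_\tau$, $h_{ij}$ the induced metric, $D_i$ and ${}^{(3)}R$ its covariant derivative and scalar curvature, and $K_{ij}=\tfrac12\mathcal L_nh_{ij}$. Let $\hat n^i=\hat N^{-1}[(\partial_\rho)^i-\hat N^i]$ be the unit normal of $\mathcal S_{\tau,\rho}$ in $\Sigma_\tau$, with 2-lapse $\hat N>0$ and 2-shift $\hat N^i$; let $\hat\gamma_{ij}=h_{ij}-\hat n_i\hat n_j$, with covariant derivative $\hat D_i$, $\hat K_{ij}=\tfrac12\mathcal L_{\hat n}\hat\gamma_{ij}$ and $\dot{\hat n}_i=\hat n^lD_l\hat n_i$ (projected to the surfaces). Put $\boldsymbol\kappa=\hat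 n^k\hat n^lK_{kl}$, $\mathbf k_i=\hat\gamma^k{}_i\hat n^lK_{kl}$, $\mathbf K_{ij}=\hat\gamma^k{}_i\hat\gamma^l{}_jK_{kl}$. A ring over $\mathbf K$ or $\hat K$ denotes the $\hat\gamma$-trace-free part. Assume the gauge: (i) $N^a=0$; (ii) $N=\nu\hat N$ with $\nu$ smooth and non-vanishing; (iii) $\hat\gamma_{ij}=\Omega^2\gamma_{ij}$ with $\Omega$ smooth and non-vanishing on $U$ (origins of the foliation excluded) and $\gamma^{ij}\mathcal L_\eta\gamma_{ij}=0$ for $\eta=\partial_\tau,\partial_\rho$. Let $\mathbb D_i$ and ${}^{(\gamma)}R$ be the covariant derivative and the scalar curvature of $\gamma_{ij}$ on the surfaces; indices in expressions with $\mathbb D$ are moved with $\gamma$, all other surface indices with $\hat\gamma$. For a tensor field $\mathcal G_{ab}$ put $\mathfrak e=n^en^f\mathcal G_{ef}$ and $\mathfrak p_a=-h^e{}_an^f\mathcal G_{ef}$. **Theorem.** (1) At every point of $U$ (thus on $\Sigma_0$) the Hamiltonian constraint ${}^{(3)}R+(K^i{}_i)^2-K_{ij}K^{ij}-2\mathfrak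 e=0$ is equivalent to $$\Omega^{-2}\big[{}^{(\gamma)}R-\mathbb D^k\mathbb D_k\ln\Omega^2\big]-2\mathcal L_{\hat n}\big[\mathcal L_{\hat n}\ln\Omega^2-\hat N^{-1}\mathbb D_k\hat N^k\big]-\tfrac32(\hat K^l{}_l)^2-\mathring{\hat K}_{kl}\mathring{\hat K}{}^{kl}-2\hat N^{-1}\hat D^l\hat D_l\hat N+2\boldsymbol\kappa\,\mathbf K^l{}_l+\tfrac12(\mathbf K^l{}_l)^2-2\mathbf k^l\mathbf k_l-\mathring{\mathbf K}_{kl}\mathring{\mathbf K}^{kl}-2\mathfrak e=0,\tag{H}$$ and the momentum constraint $D_iK^i{}_j-D_jK^i{}_i+\mathfrak p_j=0$ is equivalent to the pair $$\hat K^l{}_l\mathbf k_i+\hat D^l\mathring{\mathbf K}_{li}+\boldsymbol\kappa\dot{\hat n}_i+(2\hat N)^{-1}\hat\gamma_{ij}\mathcal L_{\hat n}(\mathcal L_n\hat N^j)+2\hat K_{ij}\mathbf k^j-\mathcal L_{\hat n}(\ln\hat N)\mathbf k_i-\dot{\hat n}^l\mathbf K_{li}-\hat D_i\boldsymbol\kappa-\tfrac12\hat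 D_i(\mathcal L_n\ln\Omega^2)+\mathfrak p_l\hat\gamma^l{}_i=0,\tag{P}$$ $$\boldsymbol\kappa\hat K^l{}_l-\mathbf K_{kl}\hat K^{kl}+(2\hat N)^{-1}\hat D_l(\mathcal L_n\hat N^l)-\mathcal L_{\hat n}[\mathcal L_n\ln\Omega^2]+\mathbf k^l\hat D_l\ln\hat N+\mathfrak p_l\hat n^l=0.\tag{O}$$ (2) *(hyperbolic part)* For $u=(\mathcal L_n\hat N^B,\mathcal L_n\ln\Omega^2)^T$, the left sides of $2\cdot$(P) and $-2\hat N\cdot$(O) together equal $\mathcal A^{(\rho)}\partial_\rho u+\mathcal A^{(K)}\partial_Ku+\mathcal B$ (sum over $K=3,4$), where $$\mathcal A^{(\rho)}=\begin{pmatrix}\hat N^{-2}\hat\gamma_{AB}&0\\0&2\end{pmatrix},\qquad \mathcal A^{(K)}=\begin{pmatrix}-\hat N^K\hat N^{-2}\hat\gamma_{AB}&-\delta_A{}^K\\-\delta_B{}^K&-2\hat N^K\end{pmatrix}.$$ $\mathcal A^{(\rho)}$ is symmetric positive definite and the $\mathcal A^{(K)}$ are symmetric, so the system is symmetric hyperbolic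 with $\rho$ as time. $\mathcal A^{(\rho)}$ and $\mathcal A^{(K)}$ are smooth functions of $(\Omega,\gamma_{AB},\hat N,\hat N^A)$. $\mathcal B$ is a universal smooth function of these variables and their first derivatives in $\Sigma_\tau$, of $(\mathcal L_n\hat N,\mathcal L_n\gamma_{AB})$ and their first derivatives along the surfaces, and of $u$ and $\mathfrak p_i$. (3) *(elliptic reading)* The left side of (H) equals $a^{ij}\partial_i\partial_j\Omega+F$ with $a^{ij}=-\tfrac2\Omega(\hat\gamma^{ij}+2\hat n^i\hat n^j)$, which is elliptic: $a^{ij}\xi_i\xi_j\ne0$ for real $\xi\neq0$. Here $a^{ij}$ is a smooth function of $(\Omega,\gamma_{AB},\hat N,\hat N^A)$, and $F$ is a universal smooth function of $\Omega$ and its first derivatives, of $\gamma_{AB},\hat N,\hat N^A$ and their first and second derivatives in $\Sigma_\tau$, of $\mathcal L_n\hat N,\mathcal L_n\gamma_{AB},u$, and of $\mathfrak e$. (4) *(parabolic reading)* The left side of (H) also equals $-\tfrac2{\hat N}\hat\gamma^{AB}\partial_A\partial_B\hat N+b^i\partial_i\hat N+F'$ with $b^\rho=2\hat K^l{}_l/\hat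 N^2$. At every point where the mean curvature $\hat K^l{}_l$ does not vanish this is parabolic: the second order part is semidefinite and degenerate exactly in the covector direction $d\rho$, and $b^\rho\ne0$. The coefficient of $\partial_A\partial_B\hat N$ is a smooth function of $(\Omega,\gamma_{AB},\hat N)$, and $b^i$ and $F'$ are universal smooth functions of $\hat N$ (no derivatives), of $\Omega,\gamma_{AB},\hat N^A$ and their first and second derivatives in $\Sigma_\tau$, of $\mathcal L_n\hat N,\mathcal L_n\gamma_{AB},u$, and of $\mathfrak e$. The universal functions do not depend on $U$, $g$, $\mathcal G$; all smoothness statements hold on the set $\Omega\ne0$, $\det\gamma_{AB}\neq0$, $\hat N\ne0$. Hence the constraints form an elliptic–hyperbolic system (with $\Omega$ as unknown of (H)), or, where $\hat K^l{}_l\ne0$, a parabolic–hyperbolic system (with $\hat N$ as unknown of (H)). -/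

import Mathlib

open scoped ContDiff BigOperators

noncomputable section

namespace TwoSurf

/-! ## Coordinates

A point of the coordinate domain has coordinates `(τ, ρ, x³, x⁴)`, numbered `0, 1, 2, 3`.
Indices in `Fin 3` are spatial (`ρ, x³, x⁴`), indices in `Fin 2` are surface indices (`x³, x⁴`).
Along an embedding `e : ι → Fin 4` of indices, the calculus below is the tensor calculus of the
coordinate leaves obtained by freezing the remaining coordinates: `e = id` is space-time,
`e = sp` is the hypersurface `Σ_τ`, `e = lf` is the two-surface `S_{τ,ρ}`. -/

/-- A coordinate point `(τ, ρ, x³, x⁴)`. -/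
abbrev Pt : Type := Fin 4 → ℝ

/-- Spatial indices among the space-time indices. -/
abbrev sp : Fin 3 → Fin 4 := Fin.succ

/-- Surface indices among the space-time indices. -/
abbrev lf : Fin 2 → Fin 4 := fun A => A.succ.succ

/-- The partial derivative `∂_a f` at `x`. -/
def pd {V : Type} [NormedAddCommGroup V] [NormedSpace ℝ V] (a : Fin 4) (f : Pt → V) (x : Pt) : V :=
  fderiv ℝ f x (Pi.single a 1)

section LeafCalculus

variable {ι : Type} [Fintype ι] [DecidableEq ι]

/-- Christoffel symbols `Γ^k_{ij}` of the leaf metric `q`. -/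
def christoffel (e : ι → Fin 4) (q : Pt → Matrix ι ι ℝ) (x : Pt) (k i j : ι) : ℝ :=
  (1 / 2) * ∑ l, (q x)⁻¹ k l *
    (pd (e i) (fun y => q y j l) x + pd (e j) (fun y => q y i l) x - pd (e l) (fun y => q y i j) x)

/-- Ricci tensor of the leaf metric `q` (positive on round spheres). -/
def ricci (e : ι → Fin 4) (q : Pt → Matrix ι ι ℝ) (x : Pt) (i j : ι) : ℝ :=
  ∑ k, (pd (e k) (fun y => christoffel e q y k i j) x
      - pd (e j) (fun y => christoffel e q y k i k) x)
    + ∑ k, ∑ l, (christoffel e q x k k l * christoffel e q x l i j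
      - christoffel e q x k j l * christoffel e q x l i k)

/-- Scalar curvature of the leaf metric `q`. -/
def scalarCurv (e : ι → Fin 4) (q : Pt → Matrix ι ι ℝ) (x : Pt) : ℝ :=
  ∑ i, ∑ j, (q x)⁻¹ i j * ricci e q x i j

/-- Covariant derivative `D_k w_i` of a one-form. -/
def cov1 (e : ι → Fin 4) (q : Pt → Matrix ι ι ℝ) (w : Pt → ι → ℝ) (x : Pt) (k i : ι) : ℝ :=
  pd (e k) (fun y => w y i) x - ∑ l, christoffel e q x l k i * w x l

/-- Covariant derivative `D_k T_{ij}` of a covariant 2-tensor. -/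
def cov2 (e : ι → Fin 4) (q : Pt → Matrix ι ι ℝ) (T : Pt → Matrix ι ι ℝ) (x : Pt) (k i j : ι) : ℝ :=
  pd (e k) (fun y => T y i j) x - ∑ l, christoffel e q x l k i * T x l j
    - ∑ l, christoffel e q x l k j * T x i l

/-- Divergence `D^i T_{ij}` of a covariant 2-tensor. -/
def div2 (e : ι → Fin 4) (q : Pt → Matrix ι ι ℝ) (T : Pt → Matrix ι ι ℝ) (x : Pt) (j : ι) : ℝ :=
  ∑ k, ∑ i, (q x)⁻¹ k i * cov2 e q T x k i j

/-- Divergence `D_k X^k` of a vector field. -/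
def divVec (e : ι → Fin 4) (q : Pt → Matrix ι ι ℝ) (X : Pt → ι → ℝ) (x : Pt) : ℝ :=
  ∑ k, pd (e k) (fun y => X y k) x + ∑ k, ∑ l, christoffel e q x k k l * X x l

/-- Laplacian `D^k D_k f`. -/
def laplacian (e : ι → Fin 4) (q : Pt → Matrix ι ι ℝ) (f : Pt → ℝ) (x : Pt) : ℝ :=
  ∑ i, ∑ j, (q x)⁻¹ i j * cov1 e q (fun y k => pd (e k) f y) x i j

/-- Trace `q^{ij} T_{ij}`. -/
def tr (q T : Matrix ι ι ℝ) : ℝ := ∑ i, ∑ j, q⁻¹ i j * T i j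

/-- Full contraction `S_{ij} T^{ij}`, indices raised with `q`. -/
def dot2 (q S T : Matrix ι ι ℝ) : ℝ :=
  ∑ i, ∑ j, ∑ k, ∑ l, q⁻¹ i k * q⁻¹ j l * S i j * T k l

/-- Contraction `v_i w^i` of one-forms, the index raised with `q`. -/
def dot1 (q : Matrix ι ι ℝ) (v w : ι → ℝ) : ℝ := ∑ i, ∑ j, q⁻¹ i j * v i * w j

/-- Lie derivative of a function. -/
def lieFun (e : ι → Fin 4) (X : Pt → ι → ℝ) (f : Pt → ℝ) (x : Pt) : ℝ :=
  ∑ k, X x k * pd (e k) f x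

/-- Lie derivative of a vector field, `(L_X Y)^i`. -/
def lieVec (e : ι → Fin 4) (X Y : Pt → ι → ℝ) (x : Pt) (i : ι) : ℝ :=
  ∑ k, (X x k * pd (e k) (fun y => Y y i) x - Y x k * pd (e k) (fun y => X y i) x)

/-- Lie derivative of a covariant 2-tensor, `(L_X T)_{ij}`. -/
def lieTen (e : ι → Fin 4) (X : Pt → ι → ℝ) (T : Pt → Matrix ι ι ℝ) (x : Pt) : Matrix ι ι ℝ :=
  Matrix.of fun i j => ∑ k, (X x k * pd (e k) (fun y => T y i j) x
    + T x k j * pd (e i) (fun y => X y k) x + T x i k * pd (e j) (fun y => X y k) x)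

end LeafCalculus

/-! ## The 1+3 splitting -/

section Splitting

variable (g : Pt → Matrix (Fin 4) (Fin 4) ℝ)

/-- The lapse `N = (-g^{ττ})^{-1/2}`. -/
def lapse (x : Pt) : ℝ := 1 / Real.sqrt (-((g x)⁻¹ 0 0))

/-- The future directed unit normal `n_a = -N (dτ)_a`, index down. -/
def nDn (x : Pt) (a : Fin 4) : ℝ := if a = 0 then -lapse g x else 0

/-- The unit normal `n^a`. -/
def nUp (x : Pt) (a : Fin 4) : ℝ := ∑ b, (g x)⁻¹ a b * nDn g x b

/-- The metric `h_{ab} = g_{ab} + n_a n_b` as a space-time tensor. -/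
def h4 (x : Pt) : Matrix (Fin 4) (Fin 4) ℝ :=
  Matrix.of fun a b => g x a b + nDn g x a * nDn g x b

/-- The projection `h^a_b = δ^a_b + n^a n_b`. -/
def hMixed (x : Pt) (a b : Fin 4) : ℝ := (if a = b then 1 else 0) + nUp g x a * nDn g x b

/-- The shift `N^a = h^a_e τ^e` of `∂_τ`. -/
def shift (x : Pt) (a : Fin 4) : ℝ := hMixed g x a 0

/-- The induced metric `h_{ij}` on `Σ_τ`. -/
def h3 (x : Pt) : Matrix (Fin 3) (Fin 3) ℝ := (h4 g x).submatrix sp sp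

/-- The extrinsic curvature `K_{ab} = ½ L_n h_{ab}`, pulled back to `Σ_τ`. -/
def K3 (x : Pt) : Matrix (Fin 3) (Fin 3) ℝ :=
  ((1 / 2 : ℝ) • lieTen id (nUp g) (h4 g) x).submatrix sp sp

/-- The energy density `𝔢 = n^e n^f 𝒢_{ef}` of a source `𝒢`. -/
def eSrc (G : Pt → Matrix (Fin 4) (Fin 4) ℝ) (x : Pt) : ℝ :=
  ∑ a, ∑ b, nUp g x a * nUp g x b * G x a b

/-- The momentum density `𝔭_a = -h^e_a n^f 𝒢_{ef}`, pulled back to `Σ_τ`. -/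
def pSrc (G : Pt → Matrix (Fin 4) (Fin 4) ℝ) (x : Pt) (i : Fin 3) : ℝ :=
  -∑ a, ∑ b, hMixed g x a (sp i) * nUp g x b * G x a b

/-- Left side of the Hamiltonian constraint, `³R + (K^i_i)² - K_{ij}K^{ij} - 2𝔢`. -/
def hamiltonian (G : Pt → Matrix (Fin 4) (Fin 4) ℝ) (x : Pt) : ℝ :=
  scalarCurv sp (h3 g) x + tr (h3 g x) (K3 g x) ^ 2 - dot2 (h3 g x) (K3 g x) (K3 g x)
    - 2 * eSrc g G x

/-- Left side of the momentum constraint, `D_i K^i_j - D_j K^i_i + 𝔭_j`. -/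
def momentum (G : Pt → Matrix (Fin 4) (Fin 4) ℝ) (x : Pt) (j : Fin 3) : ℝ :=
  div2 sp (h3 g) (K3 g) x j - pd (sp j) (fun y => tr (h3 g y) (K3 g y)) x + pSrc g G x j

/-! ## The 1+2 splitting of `Σ_τ` -/

/-- The 2-lapse `N̂ = (h^{ρρ})^{-1/2}` of `∂_ρ` on `Σ_τ`. -/
def Nh (x : Pt) : ℝ := 1 / Real.sqrt ((h3 g x)⁻¹ 0 0)

/-- The unit normal `n̂_i = N̂ (dρ)_i` of the surfaces in `Σ_τ`, index down. -/
def nhDn (x : Pt) (i : Fin 3) : ℝ := if i = 0 then Nh g x else 0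

/-- The unit normal `n̂^i = h^{ij} n̂_j`. -/
def nhUp (x : Pt) (i : Fin 3) : ℝ := ∑ j, (h3 g x)⁻¹ i j * nhDn g x j

/-- The 2-shift `N̂^i = (∂_ρ)^i - N̂ n̂^i`. -/
def Sh (x : Pt) (i : Fin 3) : ℝ := (if i = 0 then 1 else 0) - Nh g x * nhUp g x i

/-- The surface components `N̂^A` of the 2-shift. -/
def ShA (x : Pt) (A : Fin 2) : ℝ := Sh g x A.succ

/-- A vector tangent to `Σ_τ`, seen as a space-time vector. -/
def toST (v : Fin 3 → ℝ) : Pt := Fin.cons 0 v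

/-- The induced metric `γ̂_{ab} = h_{ab} - n̂_a n̂_b` as a space-time tensor. -/
def gh4 (x : Pt) : Matrix (Fin 4) (Fin 4) ℝ :=
  Matrix.of fun a b => h4 g x a b
    - (∑ c, h4 g x a c * toST (nhUp g x) c) * (∑ c, h4 g x b c * toST (nhUp g x) c)

/-- `γ̂_{ij}` on `Σ_τ`. -/
def gh3 (x : Pt) : Matrix (Fin 3) (Fin 3) ℝ := (gh4 g x).submatrix sp sp

/-- `γ̂_{AB}` on the surfaces. -/
def gh (x : Pt) : Matrix (Fin 2) (Fin 2) ℝ := (gh4 g x).submatrix lf lf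

/-- The projection `γ̂^k_i = δ^k_i - n̂^k n̂_i`. -/
def ghMixed (x : Pt) (k i : Fin 3) : ℝ := (if k = i then 1 else 0) - nhUp g x k * nhDn g x i

/-- The acceleration `n̂^l D_l n̂_k`, pulled back to the surfaces. -/
def acc (x : Pt) (A : Fin 2) : ℝ := ∑ l, nhUp g x l * cov1 sp (h3 g) (nhDn g) x l A.succ

/-- The extrinsic curvature `K̂_{ij} = ½ L_n̂ γ̂_{ij}` of the surfaces in `Σ_τ`, pulled back. -/
def Kh (x : Pt) : Matrix (Fin 2) (Fin 2) ℝ :=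
  ((1 / 2 : ℝ) • lieTen sp (nhUp g) (gh3 g) x).submatrix Fin.succ Fin.succ

/-- The mean curvature `K̂^l_l`. -/
def trKh (x : Pt) : ℝ := tr (gh g x) (Kh g x)

/-- The trace-free part of `K̂_{AB}`. -/
def Kh0 (x : Pt) : Matrix (Fin 2) (Fin 2) ℝ := Kh g x - (trKh g x / 2) • gh g x

/-- `κ = n̂^k n̂^l K_{kl}`. -/
def kap (x : Pt) : ℝ := ∑ k, ∑ l, nhUp g x k * nhUp g x l * K3 g x k l

/-- `k_i = γ̂^k_i n̂^l K_{kl}`, pulled back to the surfaces. -/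
def kk (x : Pt) (A : Fin 2) : ℝ := ∑ k, ∑ l, ghMixed g x k A.succ * nhUp g x l * K3 g x k l

/-- `k^A`. -/
def kkUp (x : Pt) (A : Fin 2) : ℝ := ∑ B, (gh g x)⁻¹ A B * kk g x B

/-- `𝐊_{ij} = γ̂^k_i γ̂^l_j K_{kl}`, pulled back to the surfaces. -/
def KK (x : Pt) : Matrix (Fin 2) (Fin 2) ℝ :=
  Matrix.of fun A B => ∑ k, ∑ l, ghMixed g x k A.succ * ghMixed g x l B.succ * K3 g x k l

/-- `𝐊^l_l`. -/
def trKK (x : Pt) : ℝ := tr (gh g x) (KK g x)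

/-- The trace-free part of `𝐊_{AB}`. -/
def KK0 (x : Pt) : Matrix (Fin 2) (Fin 2) ℝ := KK g x - (trKK g x / 2) • gh g x

/-- `L_n N̂^i`, a vector on `Σ_τ`. -/
def LnSh (x : Pt) (i : Fin 3) : ℝ := lieVec id (nUp g) (fun y => toST (Sh g y)) x (sp i)

/-- `L_n N̂^A`. -/
def LnShA (x : Pt) (A : Fin 2) : ℝ := LnSh g x A.succ

/-- `L_n N̂`. -/
def LnNh (x : Pt) : ℝ := lieFun id (nUp g) (Nh g) x

/-! ## The conformal structure -/

variable (Om : Pt → ℝ)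

/-- `γ = Ω⁻² γ̂` as a space-time tensor. -/
def gam4 (x : Pt) : Matrix (Fin 4) (Fin 4) ℝ := (Om x ^ 2)⁻¹ • gh4 g x

/-- `γ_{AB}` on the surfaces. -/
def gam (x : Pt) : Matrix (Fin 2) (Fin 2) ℝ := (gam4 g Om x).submatrix lf lf

/-- `ln Ω²`. -/
def lnOm2 (x : Pt) : ℝ := Real.log (Om x ^ 2)

/-- `L_n ln Ω²`. -/
def LnOm (x : Pt) : ℝ := lieFun id (nUp g) (lnOm2 Om) x

/-- `L_n γ_{AB}`. -/
def LnGam (x : Pt) : Matrix (Fin 2) (Fin 2) ℝ :=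
  (lieTen id (nUp g) (gam4 g Om) x).submatrix lf lf

/-- The gauge, in adapted coordinates `(τ, ρ, x³, x⁴)` on an open set `U` (off the origins of the
foliation, where the coordinates break down and `Ω` vanishes): `g` is a smooth Lorentzian metric,
`τ` is a time function (timelike gradient, spacelike level surfaces), the shift of `∂_τ` vanishes,
the lapses are related by `N = ν N̂`, and `γ̂ = Ω² γ` with `γ^{ij} L_η γ_{ij} = 0` for
`η = ∂_τ, ∂_ρ`. -/
structure IsGauge (U : Set Pt) (g : Pt → Matrix (Fin 4) (Fin 4) ℝ) (Om nu : Pt → ℝ) : Prop where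
  isOpen : IsOpen U
  smooth_metric : ∀ a b, ContDiffOn ℝ ∞ (fun x => g x a b) U
  symm : ∀ x ∈ U, (g x).IsSymm
  timelike : ∀ x ∈ U, (g x)⁻¹ 0 0 < 0
  spacelike : ∀ x ∈ U, ((g x).submatrix sp sp).PosDef
  shift_zero : ∀ x ∈ U, ∀ a, shift g x a = 0
  smooth_nu : ContDiffOn ℝ ∞ nu U
  nu_ne : ∀ x ∈ U, nu x ≠ 0
  lapse_eq : ∀ x ∈ U, lapse g x = nu x * Nh g x
  smooth_Om : ContDiffOn ℝ ∞ Om U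
  Om_ne : ∀ x ∈ U, Om x ≠ 0
  conf_tau : ∀ x ∈ U, ∑ A, ∑ B, (gam g Om x)⁻¹ A B * pd 0 (fun y => gam g Om y A B) x = 0
  conf_rho : ∀ x ∈ U, ∑ A, ∑ B, (gam g Om x)⁻¹ A B * pd 1 (fun y => gam g Om y A B) x = 0

/-! ## The recast constraints -/

/-- Left side of the scalar equation:
`Ω⁻²[R_γ - 𝔻^k𝔻_k ln Ω²] - 2 L_n̂[L_n̂ ln Ω² - N̂⁻¹ 𝔻_k N̂^k] - 3/2 (K̂^l_l)² - K̂°_{kl}K̂°^{kl}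
- 2 N̂⁻¹ D̂^lD̂_l N̂ + 2κ 𝐊^l_l + ½(𝐊^l_l)² - 2 k^l k_l - 𝐊°_{kl}𝐊°^{kl} - 2𝔢`. -/
def scalEq (G : Pt → Matrix (Fin 4) (Fin 4) ℝ) (x : Pt) : ℝ :=
  (Om x ^ 2)⁻¹ * (scalarCurv lf (gam g Om) x - laplacian lf (gam g Om) (lnOm2 Om) x)
  - 2 * lieFun sp (nhUp g) (fun y => lieFun sp (nhUp g) (lnOm2 Om) y
      - (Nh g y)⁻¹ * divVec lf (gam g Om) (ShA g) y) x
  - 3 / 2 * trKh g x ^ 2 - dot2 (gh g x) (Kh0 g x) (Kh0 g x)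
  - 2 * (Nh g x)⁻¹ * laplacian lf (gh g) (Nh g) x
  + 2 * kap g x * trKK g x + 1 / 2 * trKK g x ^ 2
  - 2 * dot1 (gh g x) (kk g x) (kk g x) - dot2 (gh g x) (KK0 g x) (KK0 g x)
  - 2 * eSrc g G x

/-- Left side of the equation parallel to the surfaces:
`K̂^l_l k_A + D̂^l 𝐊°_{lA} + κ ṅ_A + (2N̂)⁻¹ γ̂_{Aj}[L_n̂(L_n N̂^j)] + 2 K̂_{AB} k^B - L_n̂(ln N̂) k_A
- ṅ^l 𝐊_{lA} - D̂_A κ - ½ D̂_A(L_n ln Ω²) + 𝔭_l γ̂^l_A`, with `ṅ` the acceleration of `n̂`. -/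
def parEq (G : Pt → Matrix (Fin 4) (Fin 4) ℝ) (x : Pt) (A : Fin 2) : ℝ :=
  trKh g x * kk g x A + div2 lf (gh g) (KK0 g) x A + kap g x * acc g x A
  + (2 * Nh g x)⁻¹ * ∑ j, gh3 g x A.succ j * lieVec sp (nhUp g) (LnSh g) x j
  + 2 * ∑ B, Kh g x A B * kkUp g x B
  - lieFun sp (nhUp g) (fun y => Real.log (Nh g y)) x * kk g x A
  - ∑ B, ∑ C, (gh g x)⁻¹ B C * acc g x C * KK g x B A
  - pd (lf A) (kap g) x - 1 / 2 * pd (lf A) (LnOm g Om) x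
  + ∑ l, pSrc g G x l * ghMixed g x l A.succ

/-- Left side of the equation orthogonal to the surfaces:
`κ K̂^l_l - 𝐊_{kl}K̂^{kl} + (2N̂)⁻¹ D̂_l(L_n N̂^l) - L_n̂[L_n ln Ω²] + k^l D̂_l(ln N̂) + 𝔭_l n̂^l`. -/
def ortEq (G : Pt → Matrix (Fin 4) (Fin 4) ℝ) (x : Pt) : ℝ :=
  kap g x * trKh g x - dot2 (gh g x) (KK g x) (Kh g x)
  + (2 * Nh g x)⁻¹ * divVec lf (gh g) (LnShA g) x
  - lieFun sp (nhUp g) (LnOm g Om) x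
  + ∑ A, kkUp g x A * pd (lf A) (fun y => Real.log (Nh g y)) x
  + ∑ l, pSrc g G x l * nhUp g x l

/-! ## Jets on `Σ_τ` and `S_{τ,ρ}` of the geometric variables -/

/-- 1-jet along `Σ_τ`. -/
def jet1 {V : Type} [NormedAddCommGroup V] [NormedSpace ℝ V] (f : Pt → V) (x : Pt) :
    V × (Fin 3 → V) := (f x, fun i => pd (sp i) f x)

/-- 2-jet along `Σ_τ`. -/
def jet2 {V : Type} [NormedAddCommGroup V] [NormedSpace ℝ V] (f : Pt → V) (x : Pt) :
    V × (Fin 3 → V) × (Fin 3 → Fin 3 → V) :=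
  (f x, fun i => pd (sp i) f x, fun i j => pd (sp i) (pd (sp j) f) x)

/-- 1-jet along the surface `S_{τ,ρ}`. -/
def jetLeaf {V : Type} [NormedAddCommGroup V] [NormedSpace ℝ V] (f : Pt → V) (x : Pt) :
    V × (Fin 2 → V) := (f x, fun A => pd (lf A) f x)

/-- Values of symmetric surface tensors (as plain arrays, which carry a norm). -/
abbrev Arr : Type := Fin 2 → Fin 2 → ℝ

/-- Values of `(Ω, γ_{AB}, N̂, N̂^A)`. -/
abbrev Var : Type := ℝ × Arr × ℝ × (Fin 2 → ℝ)

/-- Values of `(L_n N̂, L_n γ_{AB}, L_n N̂^A, L_n ln Ω²)`. -/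
abbrev Dot : Type := ℝ × Arr × (Fin 2 → ℝ) × ℝ

/-- The index set of the unknowns of the first order system: `L_n N̂^A` and `L_n ln Ω²`. -/
abbrev Idx : Type := Fin 2 ⊕ Unit

/-- The geometric variables `(Ω, γ_{AB}, N̂, N̂^A)` at a point. -/
def vars (x : Pt) : Var := (Om x, gam g Om x, Nh g x, ShA g x)

/-- Their derivatives `(L_n N̂, L_n γ_{AB}, L_n N̂^A, L_n ln Ω²)` at a point. -/
def dots (x : Pt) : Dot := (LnNh g x, LnGam g Om x, LnShA g x, LnOm g Om x)

/-- The unknown `u = (L_n N̂^A, L_n ln Ω²)`. -/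
def uVec (x : Pt) : Idx → ℝ := Sum.elim (LnShA g x) (fun _ => LnOm g Om x)

end Splitting

/-- Nondegenerate values of `Ω`, `γ_{AB}`, `N̂`. -/
def Nondeg (om : ℝ) (ga : Arr) (nh : ℝ) : Prop :=
  om ≠ 0 ∧ (Matrix.of ga).det ≠ 0 ∧ nh ≠ 0

/-- Nondegenerate values of the geometric variables. -/
def varDom : Set Var := {q | Nondeg q.1 q.2.1 q.2.2.1}

/-- `γ̂^{ij}` on `Σ_τ` in terms of the geometric variables: the surface block is the inverse of
`Ω² γ_{AB}`, the remaining components vanish. -/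
def surfInv (q : Var) : Matrix (Fin 3) (Fin 3) ℝ :=
  let gi : Matrix (Fin 2) (Fin 2) ℝ := (q.1 ^ 2 • Matrix.of q.2.1)⁻¹
  !![0, 0, 0; 0, gi 0 0, gi 0 1; 0, gi 1 0, gi 1 1]

/-- `n̂^i = N̂⁻¹ [(∂_ρ)^i - N̂^i]` in terms of the geometric variables. -/
def normalUp (q : Var) : Fin 3 → ℝ :=
  ![1 / q.2.2.1, -(q.2.2.2 0 / q.2.2.1), -(q.2.2.2 1 / q.2.2.1)]

/-! ### The first order system for `u` -/

/-- The coefficient matrix `𝒜^{(ρ)}` of `∂_ρ u`: blocks `N̂⁻² γ̂_{AB}` and `2`. -/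
def hypRho (q : Var) : Matrix Idx Idx ℝ :=
  Matrix.fromBlocks ((q.2.2.1 ^ 2)⁻¹ • (q.1 ^ 2 • Matrix.of q.2.1)) 0 0 (Matrix.of fun _ _ => 2)

/-- The coefficient matrix `𝒜^{(K)}` of `∂_K u`: blocks `-N̂^K N̂⁻² γ̂_{AB}`, `-δ_A^K`, `-δ_B^K`
and `-2 N̂^K`. -/
def hypSurf (q : Var) (K : Fin 2) : Matrix Idx Idx ℝ :=
  Matrix.fromBlocks (-(q.2.2.2 K / q.2.2.1 ^ 2) • (q.1 ^ 2 • Matrix.of q.2.1))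
    (Matrix.of fun A _ => if A = K then -1 else 0)
    (Matrix.of fun _ B => if B = K then -1 else 0)
    (Matrix.of fun _ _ => -2 * q.2.2.2 K)

/-- Symmetric hyperbolicity, with `ρ` as time, of
`A^{(ρ)} ∂_ρ u + A^{(K)} ∂_K u + B = 0`. -/
def IsSymmHyperbolic (Ar : Matrix Idx Idx ℝ) (As : Fin 2 → Matrix Idx Idx ℝ) : Prop :=
  Ar.PosDef ∧ ∀ K, (As K).IsSymm

/-- Arguments of the source term: the 1-jet along `Σ_τ` of `(Ω, γ_{AB}, N̂, N̂^A)`, the 1-jet along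
the surfaces of `(L_n N̂, L_n γ_{AB})`, and the values of `u` and `𝔭_i`. -/
abbrev HypArg : Type :=
  (Var × (Fin 3 → Var)) × ((ℝ × Arr) × (Fin 2 → ℝ × Arr)) × (Idx → ℝ) × (Fin 3 → ℝ)

/-- The arguments of the source term determined by a metric. -/
def hypArg (g : Pt → Matrix (Fin 4) (Fin 4) ℝ) (Om : Pt → ℝ)
    (G : Pt → Matrix (Fin 4) (Fin 4) ℝ) (x : Pt) : HypArg :=
  (jet1 (vars g Om) x, jetLeaf (fun y => ((LnNh g y, LnGam g Om y) : ℝ × Arr)) x,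
    uVec g Om x, pSrc g G x)

/-- Arguments with nondegenerate `Ω`, `γ_{AB}`, `N̂`. -/
def hypDom : Set HypArg := {j | j.1.1 ∈ varDom}

/-! ### The scalar equation as a second order equation for `Ω` -/

/-- The principal coefficients `-(2/Ω)(γ̂^{ij} + 2 n̂^i n̂^j)` of `∂_i ∂_j Ω`. -/
def ellCoeff (q : Var) : Matrix (Fin 3) (Fin 3) ℝ :=
  Matrix.of fun i j => -(2 / q.1) * (surfInv q i j + 2 * normalUp q i * normalUp q j)

/-- Ellipticity of a second order scalar operator with principal coefficients `a^{ij}`: the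
principal symbol vanishes for no nonzero real covector. -/
def IsElliptic (a : Matrix (Fin 3) (Fin 3) ℝ) : Prop :=
  ∀ ξ : Fin 3 → ℝ, ξ ≠ 0 → ∑ i, ∑ j, a i j * ξ i * ξ j ≠ 0

/-- Arguments of the lower order part: the 1-jet of `Ω` and the 2-jet of `(γ_{AB}, N̂, N̂^A)` along
`Σ_τ`, the values of `(L_n N̂, L_n γ_{AB}, L_n N̂^A, L_n ln Ω²)` and of `𝔢`. -/
abbrev EllArg : Type :=
  (ℝ × (Fin 3 → ℝ)) ×
    ((Arr × ℝ × (Fin 2 → ℝ)) × (Fin 3 → Arr × ℝ × (Fin 2 → ℝ)) ×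
      (Fin 3 → Fin 3 → Arr × ℝ × (Fin 2 → ℝ))) × Dot × ℝ

/-- The arguments of the lower order part determined by a metric. -/
def ellArg (g : Pt → Matrix (Fin 4) (Fin 4) ℝ) (Om : Pt → ℝ)
    (G : Pt → Matrix (Fin 4) (Fin 4) ℝ) (x : Pt) : EllArg :=
  (jet1 Om x, jet2 (fun y => ((gam g Om y, Nh g y, ShA g y) : Arr × ℝ × (Fin 2 → ℝ))) x,
    dots g Om x, eSrc g G x)

/-- Arguments with nondegenerate `Ω`, `γ_{AB}`, `N̂`. -/
def ellDom : Set EllArg := {j | Nondeg j.1.1 j.2.1.1.1 j.2.1.1.2.1}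

/-! ### The scalar equation as a second order equation for `N̂` -/

/-- The principal coefficients of `∂_i ∂_j N̂`: `-(2/N̂) γ̂^{AB}` on the surfaces, the remaining
ones zero. -/
def parCoeff (q : Var) : Matrix (Fin 3) (Fin 3) ℝ :=
  -(2 / q.2.2.1) • surfInv q

/-- Parabolicity, with `±ρ` as time, of `a^{ij} ∂_i ∂_j f + b^i ∂_i f + F = 0`: the second order
part is semidefinite and degenerates exactly in the covector direction `dρ`, and `∂_ρ f` occurs
with nonvanishing coefficient. -/
def IsParabolic (a : Matrix (Fin 3) (Fin 3) ℝ) (b : Fin 3 → ℝ) : Prop :=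
  (a.PosSemidef ∨ (-a).PosSemidef) ∧
    (∀ ξ : Fin 3 → ℝ, a.mulVec ξ = 0 ↔ ∀ A : Fin 2, ξ A.succ = 0) ∧ b 0 ≠ 0

/-- Arguments of the lower order coefficients: the value of `N̂`, the 2-jet of `(Ω, γ_{AB}, N̂^A)`
along `Σ_τ`, the values of `(L_n N̂, L_n γ_{AB}, L_n N̂^A, L_n ln Ω²)` and of `𝔢`. -/
abbrev ParArg : Type :=
  ℝ × ((ℝ × Arr × (Fin 2 → ℝ)) × (Fin 3 → ℝ × Arr × (Fin 2 → ℝ)) ×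
      (Fin 3 → Fin 3 → ℝ × Arr × (Fin 2 → ℝ))) × Dot × ℝ

/-- The arguments of the lower order coefficients determined by a metric. -/
def parArg (g : Pt → Matrix (Fin 4) (Fin 4) ℝ) (Om : Pt → ℝ)
    (G : Pt → Matrix (Fin 4) (Fin 4) ℝ) (x : Pt) : ParArg :=
  (Nh g x, jet2 (fun y => ((Om y, gam g Om y, ShA g y) : ℝ × Arr × (Fin 2 → ℝ))) x,
    dots g Om x, eSrc g G x)

/-- Arguments with nondegenerate `Ω`, `γ_{AB}`, `N̂`. -/
def parDom : Set ParArg := {j | Nondeg j.2.1.1.1 j.2.1.1.2.1 j.1}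

end TwoSurf

end

open TwoSurf

open scoped ContDiff BigOperators

noncomputable section

namespace TwoSurf

/-! ### Calculus of coordinate partial derivatives. -/

section PartialDerivatives

variable {V W : Type} [NormedAddCommGroup V] [NormedSpace ℝ V] [NormedAddCommGroup W]
  [NormedSpace ℝ W] {a : Fin 4} {x : Pt} {U : Set Pt}

/-! The recast equations are identities, not merely equivalences. In the gauge the Hamiltonian
expression equals (H), and the tangential and normal parts of the momentum expression equal (P) and
(O). Since `n̂` and the surface directions span the tangent space of `Σ_τ`, the equivalence in (1)
follows.

Vanishing shift means `n = N⁻¹ ∂_τ`, so `K` is half of `N⁻¹ ∂_τ h`. The metric `h` has the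
lapse-shift form with data `N̂`, `N̂^A`, `γ̂` (`IsGauge.splitOn`). Three geometric facts are proved
in coordinates: the twice contracted Gauss equation for such a metric (`SplitOn.scalarCurv_split`),
the two-dimensional conformal change of scalar curvature (`scalarCurv_conformal`), and the splitting
of the divergence of a symmetric tensor (`TensorSplitOn.div2_surf`, `TensorSplitOn.div2_normal`).
Both curvature facts rest on writing the scalar curvature as a coordinate divergence plus a
quadratic form in the Christoffel symbols (`MetricOn.scalarCurv_eq`), which confines second
derivatives to a vector field that transforms simply. The gauge then identifies the pieces of `K`:
`κ = L_n N̂ / N̂`, `k^A = L_n N̂^A / (2 N̂)`, `𝐊^l_l = L_n ln Ω²`, `𝐊° = ½ Ω² L_n γ`. It also gives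
`K̂^l_l = L_n̂ ln Ω² - N̂⁻¹ 𝔻_k N̂^k`, which is the bracket in (H).

For (2)–(4) each quantity is written as an explicit smooth function of jets, which makes the
coefficients universal. Where a Christoffel symbol or `curvVec` of `γ` is differentiated, the chain
rule leaves the `fderiv` of such a function. In (P) and (O) the derivatives of `u` enter linearly,
and the factors `2` and `-2N̂` make the matrices symmetric (`IsGauge.first_order_system`). For (H)
one master identity, `IsGauge.scalEq_eq`, isolates the second derivatives of `Ω`, the second
derivatives of `N̂` and the first derivatives of `N̂`. It works because `N̂ K̂^l_l` contains no
derivative of `N̂`. The elliptic and the parabolic reading are two ways of sorting its terms. The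
type of each system then follows from positivity of `γ̂`, together with `n̂^ρ ≠ 0` in the elliptic
case. -/

theorem pd_eventuallyEq {f g : Pt → V} (h : f =ᶠ[nhds x] g) : pd a f x = pd a g x := by
  unfold pd; rw [h.fderiv_eq]

theorem pd_congr {f g : Pt → V} (hU : IsOpen U) (hx : x ∈ U) (h : ∀ y ∈ U, f y = g y) :
    pd a f x = pd a g x :=
  pd_eventuallyEq (Filter.eventuallyEq_of_mem (hU.mem_nhds hx) h)

@[fun_prop]
theorem contDiffAt_pd {f : Pt → V} (hf : ContDiffAt ℝ ∞ f x) : ContDiffAt ℝ ∞ (pd a f) x := by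
  have h : ContDiffAt ℝ ∞ (fderiv ℝ f) x := hf.fderiv_right (by simp)
  exact h.clm_apply contDiffAt_const

theorem ContDiffAt.diff {f : Pt → V} (hf : ContDiffAt ℝ ∞ f x) : DifferentiableAt ℝ f x :=
  hf.differentiableAt (by simp)

theorem pd_const (c : V) : pd a (fun _ => c) x = 0 := by simp [pd]

theorem pd_add {f g : Pt → V} (hf : ContDiffAt ℝ ∞ f x) (hg : ContDiffAt ℝ ∞ g x) :
    pd a (fun y => f y + g y) x = pd a f x + pd a g x := by
  unfold pd; rw [fderiv_fun_add hf.diff hg.diff]; rfl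

theorem pd_sub {f g : Pt → V} (hf : ContDiffAt ℝ ∞ f x) (hg : ContDiffAt ℝ ∞ g x) :
    pd a (fun y => f y - g y) x = pd a f x - pd a g x := by
  unfold pd; rw [fderiv_fun_sub hf.diff hg.diff]; rfl

theorem pd_neg {f : Pt → V} : pd a (fun y => -f y) x = -pd a f x := by
  unfold pd; rw [fderiv_fun_neg]; rfl

theorem pd_mul {f g : Pt → ℝ} (hf : ContDiffAt ℝ ∞ f x) (hg : ContDiffAt ℝ ∞ g x) :
    pd a (fun y => f y * g y) x = pd a f x * g x + f x * pd a g x := by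
  unfold pd; rw [fderiv_fun_mul hf.diff hg.diff]
  simp; ring

theorem pd_pow_two {f : Pt → ℝ} (hf : ContDiffAt ℝ ∞ f x) :
    pd a (fun y => f y ^ 2) x = 2 * f x * pd a f x := by
  simp only [pow_two]; rw [pd_mul hf hf]; ring

theorem pd_inv {f : Pt → ℝ} (hf : ContDiffAt ℝ ∞ f x) (h0 : f x ≠ 0) :
    pd a (fun y => (f y)⁻¹) x = -pd a f x / f x ^ 2 := by
  have h : HasFDerivAt (fun y => (f y)⁻¹) _ x :=
    (hasDerivAt_inv h0).comp_hasFDerivAt x hf.diff.hasFDerivAt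
  unfold pd
  rw [h.fderiv]
  simp; field_simp

theorem pd_div {f g : Pt → ℝ} (hf : ContDiffAt ℝ ∞ f x) (hg : ContDiffAt ℝ ∞ g x)
    (h0 : g x ≠ 0) :
    pd a (fun y => f y / g y) x = pd a f x / g x - f x * pd a g x / g x ^ 2 := by
  simp only [div_eq_mul_inv]
  rw [pd_mul hf (show ContDiffAt ℝ ∞ (fun y => (g y)⁻¹) x from hg.inv h0), pd_inv hg h0]
  ring

theorem pd_log {f : Pt → ℝ} (hf : ContDiffAt ℝ ∞ f x) (h0 : f x ≠ 0) :
    pd a (fun y => Real.log (f y)) x = pd a f x / f x := by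
  unfold pd
  rw [(hf.diff.hasFDerivAt.log h0).fderiv]
  simp; field_simp

theorem pd_sum {ι : Type} (s : Finset ι) {f : ι → Pt → V} (hf : ∀ i ∈ s, ContDiffAt ℝ ∞ (f i) x) :
    pd a (fun y => ∑ i ∈ s, f i y) x = ∑ i ∈ s, pd a (f i) x := by
  unfold pd
  rw [fderiv_fun_sum (fun i hi => (hf i hi).diff)]
  simp

theorem pd_comm {f : Pt → V} (hf : ContDiffAt ℝ ∞ f x) (a b : Fin 4) :
    pd a (pd b f) x = pd b (pd a f) x := by
  have h : DifferentiableAt ℝ (fderiv ℝ f) x :=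
    (hf.fderiv_right (m := ∞) (by simp)).differentiableAt (by simp)
  have key : ∀ a b : Fin 4, pd a (pd b f) x = fderiv ℝ (fderiv ℝ f) x (Pi.single a 1)
      (Pi.single b 1) := by
    intro a b
    unfold pd
    rw [fderiv_clm_apply h (differentiableAt_const _)]
    simp
  rw [key, key]
  have := hf.isSymmSndFDerivAt (by simp; exact WithTop.coe_le_coe.2 (le_top : (2 : ℕ∞) ≤ ⊤))
  exact this _ _

theorem pd_pi {ι : Type} [Fintype ι] {f : Pt → ι → V} (hf : ContDiffAt ℝ ∞ f x) (i : ι) :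
    pd a f x i = pd a (fun y => f y i) x := by
  unfold pd
  rw [fderiv_apply hf.diff]; rfl

theorem pd_fst {f : Pt → V} {g : Pt → W} (hf : ContDiffAt ℝ ∞ f x) (hg : ContDiffAt ℝ ∞ g x) :
    pd a (fun y => (f y, g y)) x = (pd a f x, pd a g x) := by
  unfold pd
  rw [hf.diff.fderiv_prodMk hg.diff]; rfl

end PartialDerivatives


/-! ### Leaf metrics, metric compatibility and the divergence form of scalar curvature. -/

section LeafMetric

variable {ι : Type} [Fintype ι] [DecidableEq ι]

/-- A smooth, symmetric, nondegenerate leaf metric on an open set. -/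
structure MetricOn (U : Set Pt) (q : Pt → Matrix ι ι ℝ) : Prop where
  isOpen : IsOpen U
  smooth : ∀ x ∈ U, ∀ i j, ContDiffAt ℝ ∞ (fun y => q y i j) x
  symm : ∀ x ∈ U, ∀ i j, q x i j = q x j i
  det_ne : ∀ x ∈ U, (q x).det ≠ 0

theorem contDiffAt_det {E : Type} [NormedAddCommGroup E] [NormedSpace ℝ E] {x : E}
    {q : E → Matrix ι ι ℝ}
    (h : ∀ i j, ContDiffAt ℝ ∞ (fun y => q y i j) x) : ContDiffAt ℝ ∞ (fun y => (q y).det) x := by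
  simp only [Matrix.det_apply']
  exact ContDiffAt.sum fun σ _ => contDiffAt_const.mul (contDiffAt_prod fun i _ => h _ _)

/-- Cramer's rule: an entry of the inverse is a quotient of determinants, the numerator coming from
a matrix with one row replaced by a constant one. -/
theorem contDiffAt_matrix_inv {E : Type} [NormedAddCommGroup E] [NormedSpace ℝ E] {x : E}
    {q : E → Matrix ι ι ℝ}
    (h : ∀ i j, ContDiffAt ℝ ∞ (fun y => q y i j) x) (h0 : (q x).det ≠ 0) (i j : ι) :
    ContDiffAt ℝ ∞ (fun y => (q y)⁻¹ i j) x := by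
  simp only [Matrix.inv_def, Matrix.smul_apply, smul_eq_mul, Ring.inverse_eq_inv',
    Matrix.adjugate_apply]
  refine ((contDiffAt_det h).inv h0).mul (contDiffAt_det fun k l => ?_)
  simp only [Matrix.updateRow_apply]
  split_ifs
  · exact contDiffAt_const
  · exact h k l

namespace MetricOn

variable {U : Set Pt} {q : Pt → Matrix ι ι ℝ} (M : MetricOn U q) {e : ι → Fin 4} {x : Pt}
include M

theorem smooth_inv (hx : x ∈ U) (i j : ι) : ContDiffAt ℝ ∞ (fun y => (q y)⁻¹ i j) x :=
  contDiffAt_matrix_inv (M.smooth x hx) (M.det_ne x hx) i j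

theorem inv_mul (hx : x ∈ U) : (q x)⁻¹ * q x = 1 :=
  Matrix.nonsing_inv_mul _ (isUnit_iff_ne_zero.2 (M.det_ne x hx))

theorem mul_inv (hx : x ∈ U) : q x * (q x)⁻¹ = 1 :=
  Matrix.mul_nonsing_inv _ (isUnit_iff_ne_zero.2 (M.det_ne x hx))

theorem inv_symm (hx : x ∈ U) (i j : ι) : (q x)⁻¹ i j = (q x)⁻¹ j i := by
  have h : (q x).transpose = q x := by ext i j; exact M.symm x hx j i
  conv_lhs => rw [← h, ← Matrix.transpose_nonsing_inv]
  rfl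

theorem pd_symm (hx : x ∈ U) (a : Fin 4) (i j : ι) :
    pd a (fun y => q y i j) x = pd a (fun y => q y j i) x :=
  pd_congr M.isOpen hx fun y hy => M.symm y hy i j

theorem smooth_christoffel (hx : x ∈ U) (k i j : ι) :
    ContDiffAt ℝ ∞ (fun y => christoffel e q y k i j) x := by
  unfold christoffel
  have h1 := fun i j => M.smooth_inv hx i j
  have h2 := M.smooth x hx
  refine contDiffAt_const.mul (ContDiffAt.sum fun l _ => (h1 k l).mul ?_)
  have h3 : ∀ a i j, ContDiffAt ℝ ∞ (fun y => pd a (fun z => q z i j) y) x :=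
    fun a i j => contDiffAt_pd (h2 i j)
  exact ((h3 _ _ _).add (h3 _ _ _)).sub (h3 _ _ _)

theorem christoffel_symm (hx : x ∈ U) (k i j : ι) :
    christoffel e q x k i j = christoffel e q x k j i := by
  unfold christoffel
  congr 1
  refine Finset.sum_congr rfl fun l _ => ?_
  rw [M.pd_symm hx _ i j]; ring

/-- Obtained by differentiating `q⁻¹ q = 1`, which holds on the whole open set. -/
theorem pd_inv_entry (hx : x ∈ U) (a : Fin 4) :
    Matrix.of (fun i j => pd a (fun y => (q y)⁻¹ i j) x) =
      -((q x)⁻¹ * Matrix.of (fun i j => pd a (fun y => q y i j) x) * (q x)⁻¹) := by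
  have h1 : Matrix.of (fun i j => pd a (fun y => (q y)⁻¹ i j) x) * q x
      + (q x)⁻¹ * Matrix.of (fun i j => pd a (fun y => q y i j) x) = 0 := by
    ext i j
    have h : pd a (fun y => ∑ k, (q y)⁻¹ i k * q y k j) x = 0 := by
      rw [pd_congr (g := fun _ => (1 : Matrix ι ι ℝ) i j) M.isOpen hx, pd_const]
      intro y hy
      rw [← M.inv_mul hy]; rfl
    rw [pd_sum _ (fun k _ => (M.smooth_inv hx i k).mul (M.smooth x hx k j))] at h
    simp only [pd_mul (M.smooth_inv hx i _) (M.smooth x hx _ j), Finset.sum_add_distrib] at h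
    simpa [Matrix.mul_apply] using h
  have h2 := congrArg (· * (q x)⁻¹) h1
  simp only [Matrix.add_mul, Matrix.mul_assoc, M.mul_inv hx, Matrix.mul_one, Matrix.zero_mul] at h2
  rw [eq_neg_of_add_eq_zero_left h2, Matrix.mul_assoc]

theorem sum_mul_christoffel (hx : x ∈ U) (m i j : ι) :
    ∑ l, q x m l * christoffel e q x l i j = (1 / 2) * (pd (e i) (fun y => q y j m) x
      + pd (e j) (fun y => q y i m) x - pd (e m) (fun y => q y i j) x) := by
  have h : ∀ F : ι → ℝ, ∑ l, q x m l * ((1 / 2) * ∑ k, (q x)⁻¹ l k * F k) = (1 / 2) * F m := by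
    intro F
    have : Matrix.mulVec (q x) (Matrix.mulVec (q x)⁻¹ F) m = F m := by
      rw [Matrix.mulVec_mulVec, M.mul_inv hx, Matrix.one_mulVec]
    rw [← this]
    simp only [Matrix.mulVec, dotProduct, Finset.mul_sum]
    refine Finset.sum_congr rfl fun _ _ => Finset.sum_congr rfl fun _ _ => by ring
  exact h fun m => pd (e i) (fun y => q y j m) x
      + pd (e j) (fun y => q y i m) x - pd (e m) (fun y => q y i j) x

/-- Metric compatibility. -/
theorem pd_metric (hx : x ∈ U) (k i j : ι) :
    pd (e k) (fun y => q y i j) x = ∑ l, q x i l * christoffel e q x l k j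
      + ∑ l, q x j l * christoffel e q x l k i := by
  rw [M.sum_mul_christoffel hx, M.sum_mul_christoffel hx, M.pd_symm hx _ j i, M.pd_symm hx _ k i,
    M.pd_symm hx _ k j]
  ring

/-- Metric compatibility for the inverse metric. -/
theorem pd_inv_metric (hx : x ∈ U) (k i j : ι) :
    pd (e k) (fun y => (q y)⁻¹ i j) x = -∑ l, christoffel e q x i k l * (q x)⁻¹ l j
      - ∑ l, christoffel e q x j k l * (q x)⁻¹ l i := by
  -- With `C` the matrix of `Γ^l_{kj}`, compatibility reads `∂_k q = q C + Cᵀ q`; enclosing this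
  -- between two inverses gives the claim.
  set C : Matrix ι ι ℝ := Matrix.of fun l j => christoffel e q x l k j with hC
  have h1 : Matrix.of (fun i j => pd (e k) (fun y => q y i j) x) =
      q x * C + C.transpose * q x := by
    ext i j
    simp only [Matrix.of_apply, M.pd_metric hx, Matrix.add_apply, Matrix.mul_apply,
      Matrix.transpose_apply, hC]
    congr 1
    exact Finset.sum_congr rfl fun l _ => by rw [M.symm x hx j l]; ring
  have h2 := M.pd_inv_entry hx (e k)
  rw [h1, Matrix.mul_add, Matrix.add_mul, ← Matrix.mul_assoc, M.inv_mul hx, Matrix.one_mul,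
    Matrix.mul_assoc (q x)⁻¹, Matrix.mul_assoc C.transpose, M.mul_inv hx, Matrix.mul_one] at h2
  have h3 := congrFun (congrFun h2 i) j
  simp only [Matrix.of_apply, Matrix.neg_apply, Matrix.add_apply, Matrix.mul_apply,
    Matrix.transpose_apply, hC] at h3
  rw [h3, neg_add, ← sub_eq_add_neg]
  congr 1
  exact Finset.sum_congr rfl fun l _ => by rw [M.inv_symm hx l i]; ring

end MetricOn

/-- The vector `V^k = q^{ij} Γ^k_{ij} - q^{ki} Γ^j_{ji}` whose coordinate divergence carries the
second derivatives in the scalar curvature. -/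
def curvVec (e : ι → Fin 4) (q : Pt → Matrix ι ι ℝ) (x : Pt) (k : ι) : ℝ :=
  ∑ i, ∑ j, (q x)⁻¹ i j * christoffel e q x k i j
    - ∑ i, (q x)⁻¹ k i * ∑ j, christoffel e q x j i j

/-- The part of the scalar curvature quadratic in the Christoffel symbols. -/
def curvQuad (P : ι → ι → ℝ) (Γ : ι → ι → ι → ℝ) : ℝ :=
  ∑ i, ∑ j, P i j * ((∑ k, ∑ l, Γ k j l * Γ l i k) - (∑ k, Γ k i k) * (∑ l, Γ l j l))

namespace MetricOn

variable {U : Set Pt} {q : Pt → Matrix ι ι ℝ} (M : MetricOn U q) {e : ι → Fin 4} {x : Pt}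
include M

theorem smooth_curvVec (hx : x ∈ U) (k : ι) :
    ContDiffAt ℝ ∞ (fun y => curvVec e q y k) x := by
  have hP := fun i j => M.smooth_inv hx i j
  have hG := fun k i j => M.smooth_christoffel (e := e) hx k i j
  exact (ContDiffAt.sum fun i _ => ContDiffAt.sum fun j _ => (hP i j).mul (hG k i j)).sub
    (ContDiffAt.sum fun i _ => (hP k i).mul (ContDiffAt.sum fun j _ => hG j i j))

theorem pd_curvVec (hx : x ∈ U) (a : Fin 4) (k : ι) : pd a (fun y => curvVec e q y k) x =
    ∑ i, ∑ j, (pd a (fun y => (q y)⁻¹ i j) x * christoffel e q x k i j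
      + (q x)⁻¹ i j * pd a (fun y => christoffel e q y k i j) x)
    - ∑ i, (pd a (fun y => (q y)⁻¹ k i) x * ∑ j, christoffel e q x j i j
      + (q x)⁻¹ k i * ∑ j, pd a (fun y => christoffel e q y j i j) x) := by
  have hP := fun i j => M.smooth_inv hx i j
  have hG := fun k i j => M.smooth_christoffel (e := e) hx k i j
  have hS : ∀ i, ContDiffAt ℝ ∞ (fun y => ∑ j, christoffel e q y j i j) x :=
    fun i => ContDiffAt.sum fun j _ => hG j i j
  unfold curvVec
  rw [pd_sub (ContDiffAt.sum fun i _ => ContDiffAt.sum fun j _ => (hP i j).mul (hG k i j))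
    (ContDiffAt.sum fun i _ => (hP k i).mul (hS i)),
    pd_sum _ (fun i _ => ContDiffAt.sum fun j _ => (hP i j).mul (hG k i j)),
    pd_sum _ (fun i _ => (hP k i).mul (hS i))]
  congr 1
  · refine Finset.sum_congr rfl fun i _ => ?_
    rw [pd_sum _ (fun j _ => (hP i j).mul (hG k i j))]
    exact Finset.sum_congr rfl fun j _ => pd_mul (hP i j) (hG k i j)
  · refine Finset.sum_congr rfl fun i _ => ?_
    rw [pd_mul (hP k i) (hS i), pd_sum _ fun j _ => hG j i j]

end MetricOn

/-- The algebra behind the divergence form of scalar curvature, with the derivatives of `P` and `Γ`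
as formal symbols. Differentiating `P` in the divergence produces only terms quadratic in `Γ`, by
compatibility, and these combine with the quadratic terms of Ricci into `curvQuad`. Fixing the
dimension lets the sums be expanded and `ring` decide. -/
theorem curv_algebra {n : ℕ} (hn : n = 2 ∨ n = 3) (P : Fin n → Fin n → ℝ) (Γ : Fin n → Fin n → Fin n → ℝ)
    (dP : Fin n → Fin n → Fin n → ℝ) (dΓ : Fin n → Fin n → Fin n → Fin n → ℝ)
    (hP : ∀ i j, P i j = P j i) (hΓ : ∀ k i j, Γ k i j = Γ k j i)
    (hdP : ∀ k i j, dP k i j = -∑ l, Γ i k l * P l j - ∑ l, Γ j k l * P l i) :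
    ∑ i, ∑ j, P i j * (∑ k, (dΓ k k i j - dΓ j k i k)
      + ∑ k, ∑ l, (Γ k k l * Γ l i j - Γ k j l * Γ l i k)) =
    ∑ k, (∑ i, ∑ j, (dP k i j * Γ k i j + P i j * dΓ k k i j)
      - ∑ i, (dP k k i * ∑ j, Γ j i j + P k i * ∑ j, dΓ k j i j)) + curvQuad P Γ := by
  unfold curvQuad
  simp only [hdP]
  rcases hn with rfl | rfl
  · simp only [Fin.sum_univ_two, Fin.isValue, hΓ _ 1 0, hP 1 0]
    ring
  · simp only [Fin.sum_univ_three, Fin.isValue, hΓ _ 1 0, hΓ _ 2 0, hΓ _ 2 1, hP 1 0, hP 2 0, hP 2 1]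
    ring

theorem MetricOn.scalarCurv_eq {n : ℕ} (hn : n = 2 ∨ n = 3) {U : Set Pt}
    {q : Pt → Matrix (Fin n) (Fin n) ℝ} (M : MetricOn U q) {e : Fin n → Fin 4} {x : Pt}
    (hx : x ∈ U) : scalarCurv e q x = ∑ k, pd (e k) (fun y => curvVec e q y k) x
      + curvQuad (fun i j => (q x)⁻¹ i j) (christoffel e q x) := by
  simp only [M.pd_curvVec hx, scalarCurv, ricci]
  exact curv_algebra hn (fun i j => (q x)⁻¹ i j) (christoffel e q x)
    (fun k i j => pd (e k) (fun y => (q y)⁻¹ i j) x)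
    (fun a k i j => pd (e a) (fun y => christoffel e q y k i j) x)
    (M.inv_symm hx) (M.christoffel_symm hx) (M.pd_inv_metric hx)

end LeafMetric


/-! ### Conformal change of scalar curvature in two dimensions. -/

section Conformal

theorem MetricOn.inv_mul_entry {U : Set Pt} {q : Pt → Matrix (Fin 2) (Fin 2) ℝ} (M : MetricOn U q)
    {x : Pt} (hx : x ∈ U) (k j : Fin 2) :
    (q x)⁻¹ k 0 * q x 0 j + (q x)⁻¹ k 1 * q x 1 j = if k = j then 1 else 0 := by
  have h := congrFun (congrFun (M.inv_mul hx) k) j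
  rwa [Matrix.mul_apply, Fin.sum_univ_two, Matrix.one_apply] at h

/-- A two-dimensional symmetric matrix in terms of its inverse. -/
theorem MetricOn.eq_inv_inv {U : Set Pt} {q : Pt → Matrix (Fin 2) (Fin 2) ℝ} (M : MetricOn U q)
    {x : Pt} (hx : x ∈ U) : (q x)⁻¹ 0 0 * (q x)⁻¹ 1 1 - (q x)⁻¹ 0 1 ^ 2 ≠ 0 ∧
      q x 0 0 = (q x)⁻¹ 1 1 / ((q x)⁻¹ 0 0 * (q x)⁻¹ 1 1 - (q x)⁻¹ 0 1 ^ 2) ∧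
      q x 0 1 = -(q x)⁻¹ 0 1 / ((q x)⁻¹ 0 0 * (q x)⁻¹ 1 1 - (q x)⁻¹ 0 1 ^ 2) ∧
      q x 1 1 = (q x)⁻¹ 0 0 / ((q x)⁻¹ 0 0 * (q x)⁻¹ 1 1 - (q x)⁻¹ 0 1 ^ 2) := by
  have h00 := M.inv_mul_entry hx 0 0
  have h01 := M.inv_mul_entry hx 0 1
  have h10 := M.inv_mul_entry hx 1 0
  have h11 := M.inv_mul_entry hx 1 1
  rw [M.symm x hx 1 0, M.inv_symm hx 1 0] at *
  simp only [Fin.isValue, if_true, zero_ne_one, one_ne_zero, if_false] at *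
  set a := (q x)⁻¹ 0 0
  set b := (q x)⁻¹ 0 1
  set d := (q x)⁻¹ 1 1
  -- Multiplicativity of the determinant, read off from the entries of `q⁻¹ q = 1`.
  have hd : (a * d - b ^ 2) * (q x 0 0 * q x 1 1 - q x 0 1 ^ 2) = 1 := by
    linear_combination (b * q x 0 1 + d * q x 1 1) * h00 + h11 - (b * q x 0 0 + d * q x 0 1) * h01
  have hne : a * d - b ^ 2 ≠ 0 := left_ne_zero_of_mul_eq_one hd
  refine ⟨hne, ?_, ?_, ?_⟩ <;> rw [eq_div_iff hne]
  · linear_combination d * h00 - b * h10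
  · linear_combination d * h01 - b * h11
  · linear_combination a * h11 - b * h01

variable {U : Set Pt} {γ q : Pt → Matrix (Fin 2) (Fin 2) ℝ} {w f : Pt → ℝ}

/-- Here `f` plays the role of `ln w`; only its gradient enters. In `∂q = (∂w) γ + w ∂γ` the factor
`w` cancels against `q⁻¹ = w⁻¹ γ⁻¹`, and the first term gives the correction. -/
theorem christoffel_conformal (Mγ : MetricOn U γ)
    (hw : ∀ x ∈ U, ContDiffAt ℝ ∞ w x) (hw0 : ∀ x ∈ U, w x ≠ 0)
    (hfw : ∀ x ∈ U, ∀ a, pd a f x = pd a w x / w x)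
    (hq : ∀ x ∈ U, q x = w x • γ x) {x : Pt} (hx : x ∈ U) (k i j : Fin 2) :
    christoffel lf q x k i j = christoffel lf γ x k i j
      + (1 / 2) * ((if k = i then 1 else 0) * pd (lf j) f x + (if k = j then 1 else 0) * pd (lf i) f x
        - γ x i j * ∑ l, (γ x)⁻¹ k l * pd (lf l) f x) := by
  have hd : ∀ a i j, pd a (fun y => q y i j) x = pd a w x * γ x i j
      + w x * pd a (fun y => γ y i j) x := by
    intro a i j
    rw [pd_congr (g := fun y => w y * γ y i j) Mγ.isOpen hx (fun y hy => by rw [hq y hy]; rfl),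
      pd_mul (hw x hx) (Mγ.smooth x hx i j)]
  have hI : (q x)⁻¹ = (w x)⁻¹ • (γ x)⁻¹ := by
    -- `Matrix.inv_smul'` scales by a unit, so the nonzero number `w x` is first turned into one.
    rw [hq x hx, ← Units.smul_mk0 (hw0 x hx), Matrix.inv_smul' _ _
      (isUnit_iff_ne_zero.2 (Mγ.det_ne x hx))]
    rfl
  have h0 := hw0 x hx
  have rj := Mγ.inv_mul_entry hx k j
  have ri := Mγ.inv_mul_entry hx k i
  simp only [christoffel, hd, hI, Matrix.smul_apply, smul_eq_mul, Fin.sum_univ_two, hfw x hx]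
  rw [← rj, ← ri, Mγ.symm x hx i 0, Mγ.symm x hx i 1, Mγ.symm x hx j 0, Mγ.symm x hx j 1]
  field_simp
  ring

/-- In dimension `n` the two traces of the correction contribute `(1 - n/2)` and `-n/2` times the
gradient of `f`; for `n = 2` the first vanishes and the second is `-1`. -/
theorem curvVec_conformal (Mγ : MetricOn U γ)
    (hw : ∀ x ∈ U, ContDiffAt ℝ ∞ w x) (hw0 : ∀ x ∈ U, w x ≠ 0)
    (hfw : ∀ x ∈ U, ∀ a, pd a f x = pd a w x / w x)
    (hq : ∀ x ∈ U, q x = w x • γ x) {x : Pt} (hx : x ∈ U) (k : Fin 2) :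
    curvVec lf q x k = (w x)⁻¹ * (curvVec lf γ x k - ∑ l, (γ x)⁻¹ k l * pd (lf l) f x) := by
  have hI : (q x)⁻¹ = (w x)⁻¹ • (γ x)⁻¹ := by
    rw [hq x hx, ← Units.smul_mk0 (hw0 x hx), Matrix.inv_smul' _ _
      (isUnit_iff_ne_zero.2 (Mγ.det_ne x hx))]
    rfl
  obtain ⟨hne, e00, e01, e11⟩ := Mγ.eq_inv_inv hx
  unfold curvVec
  simp only [christoffel_conformal Mγ hw hw0 hfw hq hx, hI, Matrix.smul_apply, smul_eq_mul,
    Fin.sum_univ_two, Mγ.symm x hx 1 0, Mγ.inv_symm hx 1 0, e00, e01, e11]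
  fin_cases k <;> simp [Mγ.inv_symm hx 1 0] <;> field_simp <;> ring

/-- The scalar curvature of a conformally rescaled two-dimensional metric. -/
theorem scalarCurv_conformal (Mγ : MetricOn U γ) (Mq : MetricOn U q)
    (hw : ∀ x ∈ U, ContDiffAt ℝ ∞ w x) (hw0 : ∀ x ∈ U, w x ≠ 0)
    (hf : ∀ x ∈ U, ContDiffAt ℝ ∞ f x)
    (hfw : ∀ x ∈ U, ∀ a, pd a f x = pd a w x / w x)
    (hq : ∀ x ∈ U, q x = w x • γ x) {x : Pt} (hx : x ∈ U) :
    scalarCurv lf q x = (w x)⁻¹ * (scalarCurv lf γ x - laplacian lf γ f x) := by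
  have hI : (q x)⁻¹ = (w x)⁻¹ • (γ x)⁻¹ := by
    rw [hq x hx, ← Units.smul_mk0 (hw0 x hx), Matrix.inv_smul' _ _
      (isUnit_iff_ne_zero.2 (Mγ.det_ne x hx))]
    rfl
  have hP := fun i j => Mγ.smooth_inv hx i j
  have hG := fun k i j => Mγ.smooth_christoffel (e := lf) hx k i j
  have hfx := hf x hx
  have hwx := hw x hx
  have hw0x := hw0 x hx
  have hV := fun k => Mγ.smooth_curvVec (e := lf) hx k
  rw [Mγ.scalarCurv_eq (.inl rfl) hx, Mq.scalarCurv_eq (.inl rfl) hx]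
  have hdV : ∀ k, pd (lf k) (fun y => curvVec lf q y k) x =
      (w x)⁻¹ * (pd (lf k) (fun y => curvVec lf γ y k) x
        - ∑ l, (pd (lf k) (fun y => (γ y)⁻¹ k l) x * pd (lf l) f x
          + (γ x)⁻¹ k l * pd (lf k) (pd (lf l) f) x))
      - pd (lf k) f x / w x * (curvVec lf γ x k - ∑ l, (γ x)⁻¹ k l * pd (lf l) f x) := by
    intro k
    rw [pd_congr Mγ.isOpen hx fun y hy => curvVec_conformal Mγ hw hw0 hfw hq hy k]
    have hY : ∀ l, ContDiffAt ℝ ∞ (fun y => (γ y)⁻¹ k l * pd (lf l) f y) x :=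
      fun l => (hP k l).mul (contDiffAt_pd hfx)
    have hS : ContDiffAt ℝ ∞ (fun y => ∑ l, (γ y)⁻¹ k l * pd (lf l) f y) x :=
      ContDiffAt.sum fun l _ => hY l
    rw [pd_mul (show ContDiffAt ℝ ∞ (fun y => (w y)⁻¹) x from hwx.inv hw0x) ((hV k).sub hS),
      pd_inv hwx hw0x, pd_sub (hV k) hS, pd_sum _ fun l _ => hY l, hfw x hx]
    simp only [pd_mul (hP k _) (contDiffAt_pd hfx)]
    field_simp
    ring
  obtain ⟨hne, e00, e01, e11⟩ := Mγ.eq_inv_inv hx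
  simp only [hdV, Fin.sum_univ_two]
  simp only [Mγ.pd_inv_metric hx]
  -- The derivatives of `curvVec` agree on the two sides, so they may become free symbols. What
  -- remains is algebra in `γ⁻¹`, `Γ` and the derivatives of `f`, since `γ` has been expressed
  -- through its inverse.
  generalize pd (lf 0) (fun y => curvVec lf γ y 0) x = v0
  generalize pd (lf 1) (fun y => curvVec lf γ y 1) x = v1
  simp only [curvQuad, laplacian, cov1, curvVec,
    christoffel_conformal Mγ hw hw0 hfw hq hx, hI, Matrix.smul_apply, smul_eq_mul,
    Fin.sum_univ_two, Mγ.symm x hx 1 0, Mγ.inv_symm hx 1 0, e00, e01, e11,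
    Mγ.christoffel_symm hx _ 1 0, Fin.isValue, if_true, zero_ne_one, one_ne_zero, if_false]
  rw [pd_comm hfx (lf 1) (lf 0)]
  generalize pd (lf 0) f x = f0
  generalize pd (lf 1) f x = f1
  generalize pd (lf 0) (pd (lf 0) f) x = f00
  generalize pd (lf 0) (pd (lf 1) f) x = f01
  generalize pd (lf 1) (pd (lf 1) f) x = f11
  generalize christoffel lf γ x = Γ
  generalize (γ x)⁻¹ = P at *
  field_simp
  ring

end Conformal


/-! ### Three-metrics in lapse-shift form and their Christoffel symbols. -/

section Split

/-- The metric `N² dρ² + q_{AB} (dx^A + b^A dρ) (dx^B + b^B dρ)`. -/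
def splitMetric (N : ℝ) (b : Fin 2 → ℝ) (q : Matrix (Fin 2) (Fin 2) ℝ) : Matrix (Fin 3) (Fin 3) ℝ :=
  !![N ^ 2 + (q 0 0 * b 0 ^ 2 + 2 * q 0 1 * b 0 * b 1 + q 1 1 * b 1 ^ 2),
      q 0 0 * b 0 + q 0 1 * b 1, q 0 1 * b 0 + q 1 1 * b 1;
    q 0 0 * b 0 + q 0 1 * b 1, q 0 0, q 0 1;
    q 0 1 * b 0 + q 1 1 * b 1, q 0 1, q 1 1]

/-- The inverse of `splitMetric`, where `P` is the inverse of `q`. -/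
def splitInverse (N : ℝ) (b : Fin 2 → ℝ) (P : Matrix (Fin 2) (Fin 2) ℝ) :
    Matrix (Fin 3) (Fin 3) ℝ :=
  !![1 / N ^ 2, -b 0 / N ^ 2, -b 1 / N ^ 2;
    -b 0 / N ^ 2, P 0 0 + b 0 * b 0 / N ^ 2, P 0 1 + b 0 * b 1 / N ^ 2;
    -b 1 / N ^ 2, P 0 1 + b 0 * b 1 / N ^ 2, P 1 1 + b 1 * b 1 / N ^ 2]

/-- A smooth three-metric `h` with lapse `N`, shift `b` and leaf metric `q`. -/
structure SplitOn (U : Set Pt) (N : Pt → ℝ) (b : Pt → Fin 2 → ℝ) (q : Pt → Matrix (Fin 2) (Fin 2) ℝ)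
    (h : Pt → Matrix (Fin 3) (Fin 3) ℝ) : Prop extends MetricOn U q where
  smooth_lapse : ∀ x ∈ U, ContDiffAt ℝ ∞ N x
  lapse_ne : ∀ x ∈ U, N x ≠ 0
  smooth_shift : ∀ x ∈ U, ∀ A, ContDiffAt ℝ ∞ (fun y => b y A) x
  eq_split : ∀ x ∈ U, h x = splitMetric (N x) (b x) (q x)

/-- The extrinsic curvature `(2N)⁻¹ (∂_ρ q - L_b q)` of the leaves. -/
def extCurv (N : Pt → ℝ) (b : Pt → Fin 2 → ℝ) (q : Pt → Matrix (Fin 2) (Fin 2) ℝ) (x : Pt) :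
    Matrix (Fin 2) (Fin 2) ℝ :=
  Matrix.of fun A B => (1 / (2 * N x)) * (pd 1 (fun y => q y A B) x
    - ∑ C, (b x C * pd (lf C) (fun y => q y A B) x + q x C B * pd (lf A) (fun y => b y C) x
      + q x A C * pd (lf B) (fun y => b y C) x))

namespace SplitOn

variable {U : Set Pt} {N : Pt → ℝ} {b : Pt → Fin 2 → ℝ} {q : Pt → Matrix (Fin 2) (Fin 2) ℝ}
  {h : Pt → Matrix (Fin 3) (Fin 3) ℝ} (S : SplitOn U N b q h) {x : Pt}
include S

theorem inverse (hx : x ∈ U) : (h x)⁻¹ = splitInverse (N x) (b x) (q x)⁻¹ := by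
  have h00 := S.inv_mul_entry hx 0 0
  have h01 := S.inv_mul_entry hx 0 1
  have h10 := S.inv_mul_entry hx 1 0
  have h11 := S.inv_mul_entry hx 1 1
  rw [S.symm x hx 1 0, S.inv_symm hx 1 0] at *
  simp only [Fin.isValue, if_true, zero_ne_one, one_ne_zero, if_false] at *
  have hN := S.lapse_ne x hx
  refine Matrix.inv_eq_left_inv ?_
  rw [S.eq_split x hx]
  ext i j
  fin_cases i <;> fin_cases j <;>
    simp [splitMetric, splitInverse, Matrix.mul_apply, Fin.sum_univ_three] <;> field_simp
  · ring
  · ring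
  · ring
  · linear_combination (N x ^ 2 * b x 0) * h00 + (N x ^ 2 * b x 1) * h01
  · linear_combination N x ^ 2 * h00
  · linear_combination N x ^ 2 * h01
  · linear_combination (N x ^ 2 * b x 0) * h10 + (N x ^ 2 * b x 1) * h11
  · linear_combination N x ^ 2 * h10
  · linear_combination N x ^ 2 * h11

end SplitOn

/-- The Christoffel symbols `Γ^ρ_{ρA}` of `splitMetric`. -/
def chrRhoA (N : Pt → ℝ) (b : Pt → Fin 2 → ℝ) (q : Pt → Matrix (Fin 2) (Fin 2) ℝ) (x : Pt)
    (A : Fin 2) : ℝ :=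
  (pd (lf A) N x - ∑ B, extCurv N b q x A B * b x B) / N x

/-- The Christoffel symbol `Γ^ρ_{ρρ}` of `splitMetric`. -/
def chrRhoRho (N : Pt → ℝ) (b : Pt → Fin 2 → ℝ) (q : Pt → Matrix (Fin 2) (Fin 2) ℝ) (x : Pt) : ℝ :=
  (pd 1 N x + ∑ A, b x A * pd (lf A) N x - ∑ A, ∑ B, extCurv N b q x A B * b x A * b x B) / N x

/-- The Christoffel symbols `Γ^C_{ρA}` of `splitMetric`. -/
def chrSurfA (N : Pt → ℝ) (b : Pt → Fin 2 → ℝ) (q : Pt → Matrix (Fin 2) (Fin 2) ℝ) (x : Pt)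
    (C A : Fin 2) : ℝ :=
  N x * ∑ B, (q x)⁻¹ C B * extCurv N b q x B A + pd (lf A) (fun y => b y C) x
    + ∑ B, christoffel lf q x C A B * b x B - b x C * chrRhoA N b q x A

/-- The Christoffel symbols `Γ^C_{ρρ}` of `splitMetric`. -/
def chrSurfRho (N : Pt → ℝ) (b : Pt → Fin 2 → ℝ) (q : Pt → Matrix (Fin 2) (Fin 2) ℝ) (x : Pt)
    (C : Fin 2) : ℝ :=
  pd 1 (fun y => b y C) x - N x * ∑ B, (q x)⁻¹ C B * pd (lf B) N x
    + 2 * N x * ∑ A, ∑ B, (q x)⁻¹ C A * extCurv N b q x A B * b x B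
    + ∑ A, b x A * (pd (lf A) (fun y => b y C) x + ∑ B, christoffel lf q x C A B * b x B)
    - b x C * chrRhoRho N b q x

namespace SplitOn

variable {U : Set Pt} {N : Pt → ℝ} {b : Pt → Fin 2 → ℝ} {q : Pt → Matrix (Fin 2) (Fin 2) ℝ}
  {h : Pt → Matrix (Fin 3) (Fin 3) ℝ} (S : SplitOn U N b q h) {x : Pt}
include S

theorem extCurv_symm (hx : x ∈ U) (A B : Fin 2) : extCurv N b q x A B = extCurv N b q x B A := by
  simp only [extCurv, Matrix.of_apply]
  rw [S.pd_symm hx 1 A B]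
  congr 2
  refine Finset.sum_congr rfl fun C _ => ?_
  rw [S.pd_symm hx _ A B, S.symm x hx C B, S.symm x hx C A]
  ring

theorem pd_entry (hx : x ∈ U) (a : Fin 4) :
    pd a (fun y => h y 0 0) x = 2 * N x * pd a N x
      + (pd a (fun y => q y 0 0) x * b x 0 ^ 2 + 2 * q x 0 0 * b x 0 * pd a (fun y => b y 0) x
        + 2 * pd a (fun y => q y 0 1) x * b x 0 * b x 1
        + 2 * q x 0 1 * (pd a (fun y => b y 0) x * b x 1 + b x 0 * pd a (fun y => b y 1) x)
        + pd a (fun y => q y 1 1) x * b x 1 ^ 2 + 2 * q x 1 1 * b x 1 * pd a (fun y => b y 1) x) ∧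
    (∀ A : Fin 2, pd a (fun y => h y 0 A.succ) x =
      ∑ B, (pd a (fun y => q y A B) x * b x B + q x A B * pd a (fun y => b y B) x)) ∧
    (∀ A : Fin 2, pd a (fun y => h y A.succ 0) x =
      ∑ B, (pd a (fun y => q y A B) x * b x B + q x A B * pd a (fun y => b y B) x)) ∧
    ∀ A B : Fin 2, pd a (fun y => h y A.succ B.succ) x = pd a (fun y => q y A B) x := by
  have hN := S.smooth_lapse x hx
  have hb0 := S.smooth_shift x hx 0
  have hb1 := S.smooth_shift x hx 1
  have h00 := S.smooth x hx 0 0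
  have h01 := S.smooth x hx 0 1
  have h11 := S.smooth x hx 1 1
  have key : ∀ i j, pd a (fun y => h y i j) x =
      pd a (fun y => splitMetric (N y) (b y) (q y) i j) x :=
    fun i j => pd_congr S.isOpen hx fun y hy => by rw [S.eq_split y hy]
  simp only [key, Fin.forall_fin_two, Fin.sum_univ_two, S.pd_symm hx _ 1 0, S.symm x hx 1 0]
  simp only [splitMetric, Matrix.of_apply, Matrix.cons_val', Matrix.cons_val_zero, Fin.isValue,
    Fin.succ_zero_eq_one, Fin.succ_one_eq_two, Matrix.cons_val_one, Matrix.cons_val]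
  simp (disch := fun_prop) only [pd_add, pd_mul, pd_pow_two, pd_const]
  refine ⟨?_, ⟨?_, ?_⟩, ⟨?_, ?_⟩, ⟨?_, ?_⟩, ?_, ?_⟩ <;> first | trivial | ring

theorem inverse_entry (hx : x ∈ U) : (h x)⁻¹ 0 0 = 1 / N x ^ 2 ∧
    (∀ A : Fin 2, (h x)⁻¹ 0 A.succ = -b x A / N x ^ 2) ∧
    (∀ A : Fin 2, (h x)⁻¹ A.succ 0 = -b x A / N x ^ 2) ∧
    ∀ A B : Fin 2, (h x)⁻¹ A.succ B.succ = (q x)⁻¹ A B + b x A * b x B / N x ^ 2 := by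
  rw [S.inverse hx]
  simp [splitInverse, Fin.forall_fin_two, S.inv_symm hx 1 0, mul_comm (b x 1) (b x 0)]

theorem christoffel_rho (hx : x ∈ U) (i j : Fin 3) : christoffel sp h x 0 i j =
    (1 / N x ^ 2) * ((1 / 2) * (pd (sp i) (fun y => h y j 0) x + pd (sp j) (fun y => h y i 0) x
        - pd 1 (fun y => h y i j) x)
      - (1 / 2) * ∑ D : Fin 2, b x D * (pd (sp i) (fun y => h y j D.succ) x
        + pd (sp j) (fun y => h y i D.succ) x - pd (lf D) (fun y => h y i j) x)) := by
  obtain ⟨i00, i01, -, -⟩ := S.inverse_entry hx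
  rw [christoffel, Fin.sum_univ_succ]
  simp only [i00, i01, Fin.sum_univ_two, sp, lf, Fin.succ_zero_eq_one]
  ring

/-- Row `C` of `h⁻¹` is the row `(0, q^{CD})` minus `b^C` times the `ρ` row, whence the last term.
-/
theorem christoffel_surf (hx : x ∈ U) (C : Fin 2) (i j : Fin 3) :
    christoffel sp h x C.succ i j =
    (1 / 2) * ∑ D : Fin 2, (q x)⁻¹ C D * (pd (sp i) (fun y => h y j D.succ) x
        + pd (sp j) (fun y => h y i D.succ) x - pd (lf D) (fun y => h y i j) x)
      - b x C * christoffel sp h x 0 i j := by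
  obtain ⟨-, -, i10, i11⟩ := S.inverse_entry hx
  rw [S.christoffel_rho hx, christoffel, Fin.sum_univ_succ]
  simp only [i10, i11, Fin.sum_univ_two, sp, lf, Fin.succ_zero_eq_one]
  ring

theorem christoffel_rho_surf_surf (hx : x ∈ U) (A B : Fin 2) :
    christoffel sp h x 0 A.succ B.succ = -extCurv N b q x A B / N x := by
  have hN := S.lapse_ne x hx
  obtain ⟨-, -, e3, e4⟩ := S.pd_entry hx (lf A)
  obtain ⟨-, -, e3', e4'⟩ := S.pd_entry hx (lf B)
  rw [S.christoffel_rho hx]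
  simp only [e3, e4, e3', e4', (S.pd_entry hx _).2.2.2, extCurv, Matrix.of_apply, Fin.sum_univ_two]
  fin_cases A <;> fin_cases B <;>
    simp [S.pd_symm hx _ 1 0, S.symm x hx 1 0, lf] <;> field_simp <;> ring

theorem christoffel_rho_rho_surf (hx : x ∈ U) (A : Fin 2) :
    christoffel sp h x 0 0 A.succ = chrRhoA N b q x A := by
  have hN := S.lapse_ne x hx
  rw [S.christoffel_rho hx]
  simp only [(S.pd_entry hx _).1, (S.pd_entry hx _).2.1, (S.pd_entry hx _).2.2.1,
    (S.pd_entry hx _).2.2.2, chrRhoA, extCurv, Matrix.of_apply, Fin.sum_univ_two,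
    Fin.succ_zero_eq_one]
  fin_cases A <;> simp [S.pd_symm hx _ 1 0, S.symm x hx 1 0, sp, lf] <;> field_simp <;> ring

theorem christoffel_rho_rho_rho (hx : x ∈ U) :
    christoffel sp h x 0 0 0 = chrRhoRho N b q x := by
  have hN := S.lapse_ne x hx
  rw [S.christoffel_rho hx]
  simp only [(S.pd_entry hx _).1, (S.pd_entry hx _).2.1, chrRhoRho, extCurv, Matrix.of_apply, Fin.sum_univ_two,
    Fin.succ_zero_eq_one, S.pd_symm hx _ 1 0, S.symm x hx 1 0]
  field_simp
  ring

theorem christoffel_surf_surf_surf (hx : x ∈ U) (C A B : Fin 2) :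
    christoffel sp h x C.succ A.succ B.succ =
      christoffel lf q x C A B + b x C * extCurv N b q x A B / N x := by
  rw [S.christoffel_surf hx, S.christoffel_rho_surf_surf hx, christoffel]
  simp only [(S.pd_entry hx _).2.2.2]
  ring

theorem christoffel_surf_rho_surf (hx : x ∈ U) (C A : Fin 2) :
    christoffel sp h x C.succ 0 A.succ = chrSurfA N b q x C A := by
  have hN := S.lapse_ne x hx
  have r0 := S.inv_mul_entry hx C 0
  have r1 := S.inv_mul_entry hx C 1
  -- The index `C` is made explicit through Kronecker deltas, which are then traded for entries of
  -- `q⁻¹ q`. The claim thereby becomes a polynomial identity in which `q⁻¹` and `q` need no further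
  -- relation.
  have hd : pd (lf A) (fun y => b y C) x = (if C = 0 then 1 else 0) * pd (lf A) (fun y => b y 0) x
      + (if C = 1 then 1 else 0) * pd (lf A) (fun y => b y 1) x := by
    fin_cases C <;> simp
  rw [S.christoffel_surf hx, S.christoffel_rho_rho_surf hx, chrSurfA, hd, ← r0, ← r1]
  simp only [(S.pd_entry hx _).2.1, (S.pd_entry hx _).2.2.2, extCurv, Matrix.of_apply, Fin.sum_univ_two, christoffel,
    Fin.succ_zero_eq_one]
  fin_cases A <;> simp [S.pd_symm hx _ 1 0, S.symm x hx 1 0, sp, lf] <;> field_simp <;> ring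

theorem christoffel_surf_rho_rho (hx : x ∈ U) (C : Fin 2) :
    christoffel sp h x C.succ 0 0 = chrSurfRho N b q x C := by
  have hN := S.lapse_ne x hx
  have r0 := S.inv_mul_entry hx C 0
  have r1 := S.inv_mul_entry hx C 1
  have hd : ∀ a, pd a (fun y => b y C) x = (if C = 0 then 1 else 0) * pd a (fun y => b y 0) x
      + (if C = 1 then 1 else 0) * pd a (fun y => b y 1) x := by
    fin_cases C <;> simp
  rw [S.christoffel_surf hx, S.christoffel_rho_rho_rho hx, chrSurfRho]
  simp only [hd]
  rw [← r0, ← r1]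
  simp only [(S.pd_entry hx _).1, (S.pd_entry hx _).2.1, extCurv, Matrix.of_apply, Fin.sum_univ_two, christoffel,
    Fin.succ_zero_eq_one, S.pd_symm hx _ 1 0, S.symm x hx 1 0]
  field_simp
  ring

end SplitOn

end Split


/-! ### The Gauss equation for the leaves. -/

section SplitCurvature

/-- The mean curvature of the leaves. -/
def meanCurv (N : Pt → ℝ) (b : Pt → Fin 2 → ℝ) (q : Pt → Matrix (Fin 2) (Fin 2) ℝ) (x : Pt) : ℝ :=
  tr (q x) (extCurv N b q x)

/-- The product and quotient rules for the shape of `curvVec_surf`, stated for anonymous functions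
so that both surface components can use it without unfolding their entries. -/
theorem pd_surf_form {a : Fin 4} {x : Pt} {V P Q N n2 n3 c1 c2 c3 b0 b1 B H d2 d3 : Pt → ℝ}
    (hV : ContDiffAt ℝ ∞ V x) (hP : ContDiffAt ℝ ∞ P x) (hQ : ContDiffAt ℝ ∞ Q x)
    (hN : ContDiffAt ℝ ∞ N x) (hn2 : ContDiffAt ℝ ∞ n2 x) (hn3 : ContDiffAt ℝ ∞ n3 x)
    (hc1 : ContDiffAt ℝ ∞ c1 x) (hc2 : ContDiffAt ℝ ∞ c2 x) (hc3 : ContDiffAt ℝ ∞ c3 x)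
    (hb0 : ContDiffAt ℝ ∞ b0 x) (hb1 : ContDiffAt ℝ ∞ b1 x) (hB : ContDiffAt ℝ ∞ B x)
    (hH : ContDiffAt ℝ ∞ H x) (hd2 : ContDiffAt ℝ ∞ d2 x) (hd3 : ContDiffAt ℝ ∞ d3 x)
    (h0 : N x ≠ 0) :
    pd a (fun y => V y - 2 * (P y * n2 y + Q y * n3 y) / N y
      + (c1 y - b0 y * c2 y - b1 y * c3 y) / N y / N y + 2 * B y * H y / N y
      + B y * (d2 y + d3 y) / N y / N y) x =
    pd a V x
    - 2 * (pd a P x * n2 x + P x * pd a n2 x + pd a Q x * n3 x + Q x * pd a n3 x) / N x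
    + 2 * (P x * n2 x + Q x * n3 x) * pd a N x / N x ^ 2
    + (pd a c1 x - pd a b0 x * c2 x - b0 x * pd a c2 x - pd a b1 x * c3 x - b1 x * pd a c3 x)
      / N x ^ 2
    - 2 * (c1 x - b0 x * c2 x - b1 x * c3 x) * pd a N x / N x ^ 3
    + 2 * (pd a B x * H x + B x * pd a H x) / N x - 2 * B x * H x * pd a N x / N x ^ 2
    + (pd a B x * (d2 x + d3 x) + B x * (pd a d2 x + pd a d3 x)) / N x ^ 2
    - 2 * B x * (d2 x + d3 x) * pd a N x / N x ^ 3 := by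
  simp (disch := first | assumption | fun_prop (disch := assumption)) only [pd_add, pd_mul, pd_sub,
      pd_div, pd_const]
  field_simp
  ring
theorem pd_rho_form {a : Fin 4} {x : Pt} {N H d2 d3 : Pt → ℝ} (hN : ContDiffAt ℝ ∞ N x)
    (hH : ContDiffAt ℝ ∞ H x) (hd2 : ContDiffAt ℝ ∞ d2 x) (hd3 : ContDiffAt ℝ ∞ d3 x)
    (h0 : N x ≠ 0) :
    pd a (fun y => -2 * H y / N y - (d2 y + d3 y) / N y / N y) x =
    -2 * pd a H x / N x + 2 * H x * pd a N x / N x ^ 2 - (pd a d2 x + pd a d3 x) / N x ^ 2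
    + 2 * (d2 x + d3 x) * pd a N x / N x ^ 3 := by
  simp (disch := first | assumption | fun_prop (disch := assumption)) only [pd_add, pd_mul, pd_sub,
      pd_div, pd_const]
  field_simp
  ring

namespace SplitOn

variable {U : Set Pt} {N : Pt → ℝ} {b : Pt → Fin 2 → ℝ} {q : Pt → Matrix (Fin 2) (Fin 2) ℝ}
  {h : Pt → Matrix (Fin 3) (Fin 3) ℝ} (S : SplitOn U N b q h) {x : Pt}
include S

theorem metricOn : MetricOn U h where
  isOpen := S.isOpen
  smooth x hx i j := by
    have key : ContDiffAt ℝ ∞ (fun y => splitMetric (N y) (b y) (q y) i j) x := by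
      have hN := S.smooth_lapse x hx
      have hb0 := S.smooth_shift x hx 0
      have hb1 := S.smooth_shift x hx 1
      have h00 := S.smooth x hx 0 0
      have h01 := S.smooth x hx 0 1
      have h11 := S.smooth x hx 1 1
      fin_cases i <;> fin_cases j <;> simp [splitMetric] <;> fun_prop
    refine key.congr_of_eventuallyEq (Filter.eventuallyEq_of_mem (S.isOpen.mem_nhds hx) ?_)
    intro y hy
    simp only [S.eq_split y hy]
  symm x hx i j := by
    rw [S.eq_split x hx]
    fin_cases i <;> fin_cases j <;> rfl
  det_ne x hx h0 := by
    -- The inverse of a singular matrix is zero by convention, whereas the `ρρ` entry of this one is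
    -- `1 / N²`.
    have h1 : (h x)⁻¹ = 0 := by
      rw [Matrix.inv_def, h0]; simp
    have h2 := (S.inverse_entry hx).1
    rw [h1] at h2
    have := S.lapse_ne x hx
    simp at h2
    exact this (pow_eq_zero_iff two_ne_zero |>.1 h2.symm)

theorem smooth_extCurv (hx : x ∈ U) (A B : Fin 2) :
    ContDiffAt ℝ ∞ (fun y => extCurv N b q y A B) x := by
  have hN := S.smooth_lapse x hx
  have h0 := S.lapse_ne x hx
  have hb := S.smooth_shift x hx
  have hq := S.smooth x hx
  have hdq : ∀ a A B, ContDiffAt ℝ ∞ (fun y => pd a (fun z => q z A B) y) x :=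
    fun a A B => contDiffAt_pd (hq A B)
  have hdb : ∀ a A, ContDiffAt ℝ ∞ (fun y => pd a (fun z => b z A) y) x :=
    fun a A => contDiffAt_pd (hb A)
  unfold extCurv
  refine (contDiffAt_const.div (contDiffAt_const.mul hN) (by simpa using h0)).mul
    ((hdq _ _ _).sub (ContDiffAt.sum fun C _ => ?_))
  exact (((hb _).mul (hdq _ _ _)).add ((hq _ _).mul (hdb _ _))).add ((hq _ _).mul (hdb _ _))

theorem smooth_meanCurv (hx : x ∈ U) : ContDiffAt ℝ ∞ (meanCurv N b q) x := by
  unfold meanCurv tr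
  exact ContDiffAt.sum fun A _ => ContDiffAt.sum fun B _ =>
    (S.smooth_inv hx A B).mul (S.smooth_extCurv hx A B)

/-- The mean curvature enters the divergence form here, which is the source of its normal derivative
in the Gauss equation. The coordinate divergence of the shift is left over because `curvVec` is not
a tensor; it cancels later. -/
theorem curvVec_rho (hx : x ∈ U) : curvVec sp h x 0 = -2 * meanCurv N b q x / N x
    - (pd 2 (fun y => b y 0) x + pd 3 (fun y => b y 1) x) / N x / N x := by
  have hN := S.lapse_ne x hx
  obtain ⟨i00, i01, i10, i11⟩ := S.inverse_entry hx
  have hG := S.metricOn.christoffel_symm (e := sp) hx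
  simp only [curvVec, Fin.sum_univ_succ (n := 2), i00, i01, i10, i11]
  simp only [hG _ (Fin.succ _) 0, S.christoffel_rho_surf_surf hx, S.christoffel_rho_rho_surf hx,
    S.christoffel_rho_rho_rho hx, S.christoffel_surf_surf_surf hx, S.christoffel_surf_rho_surf hx,
    chrRhoA, chrRhoRho, chrSurfA, Fin.sum_univ_two,
    meanCurv, tr, S.inv_symm hx 1 0, S.extCurv_symm hx 1 0, S.christoffel_symm hx _ 1 0]
  simp only [lf, Fin.succ_zero_eq_one, Fin.succ_one_eq_two, Fin.reduceSucc]
  field_simp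
  ring

theorem curvVec_surf (hx : x ∈ U) (C : Fin 2) : curvVec sp h x C.succ = curvVec lf q x C
    - 2 * ((q x)⁻¹ C 0 * pd 2 N x + (q x)⁻¹ C 1 * pd 3 N x) / N x
    + (pd 1 (fun y => b y C) x - b x 0 * pd 2 (fun y => b y C) x
      - b x 1 * pd 3 (fun y => b y C) x) / N x / N x
    + 2 * b x C * meanCurv N b q x / N x
    + b x C * (pd 2 (fun y => b y 0) x + pd 3 (fun y => b y 1) x) / N x / N x := by
  have hN := S.lapse_ne x hx
  obtain ⟨i00, i01, i10, i11⟩ := S.inverse_entry hx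
  have hG := S.metricOn.christoffel_symm (e := sp) hx
  simp only [curvVec, Fin.sum_univ_succ (n := 2), i00, i01, i10, i11]
  simp only [hG _ (Fin.succ _) 0, S.christoffel_rho_rho_surf hx,
    S.christoffel_rho_rho_rho hx, S.christoffel_surf_surf_surf hx, S.christoffel_surf_rho_surf hx,
    S.christoffel_surf_rho_rho hx, chrRhoA, chrRhoRho, chrSurfA, chrSurfRho, Fin.sum_univ_two,
    meanCurv, tr, S.inv_symm hx 1 0, S.extCurv_symm hx 1 0, S.christoffel_symm hx _ 1 0]
  simp only [lf, Fin.succ_zero_eq_one, Fin.succ_one_eq_two, Fin.reduceSucc]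
  field_simp
  ring

/-- The inverse metric is `N⁻² m ⊗ m + q^{AB} ∂_A ⊗ ∂_B` with `m = ∂_ρ - b^A ∂_A`, which is `N`
times the unit normal. Each term of the quadratic form splits accordingly, and `X` is `Γ` with one
lower index contracted with `m`. -/
theorem curvQuad_frame (hx : x ∈ U) (Γ : Fin 3 → Fin 3 → Fin 3 → ℝ) (X : Fin 3 → Fin 3 → ℝ)
    (hX : ∀ k l, X k l = Γ k 0 l - ∑ A : Fin 2, b x A * Γ k A.succ l) :
    curvQuad (fun i j => (h x)⁻¹ i j) Γ =
      (1 / N x ^ 2) * (∑ k, ∑ l, X k l * X l k - (∑ k, X k k) ^ 2)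
      + ∑ A, ∑ B, (q x)⁻¹ A B * (∑ k, ∑ l, Γ k A.succ l * Γ l B.succ k
        - (∑ k, Γ k A.succ k) * ∑ k, Γ k B.succ k) := by
  obtain ⟨i00, i01, i10, i11⟩ := S.inverse_entry hx
  simp only [curvQuad, Fin.sum_univ_succ (n := 2), i00, i01, i10, i11]
  simp only [hX, Fin.sum_univ_two, S.inv_symm hx 1 0]
  ring

/-- Contraction with `m` cancels the Christoffel symbols of `q` and many shift terms, so the
quadratic form is far shorter in this frame than in coordinates. -/
theorem perp_entry (hx : x ∈ U) (X : Fin 3 → Fin 3 → ℝ)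
    (hX : ∀ k l, X k l = christoffel sp h x k 0 l
      - ∑ A : Fin 2, b x A * christoffel sp h x k A.succ l) :
    X 0 0 = pd 1 N x / N x ∧ (∀ A : Fin 2, X 0 A.succ = pd (lf A) N x / N x) ∧
    (∀ C A : Fin 2, X C.succ A.succ = N x * ∑ B, (q x)⁻¹ C B * extCurv N b q x B A
      + pd (lf A) (fun y => b y C) x - b x C * pd (lf A) N x / N x) ∧
    ∀ C : Fin 2, X C.succ 0 = pd 1 (fun y => b y C) x - N x * ∑ B, (q x)⁻¹ C B * pd (lf B) N x
      + N x * ∑ A, ∑ B, (q x)⁻¹ C A * extCurv N b q x A B * b x B - b x C * pd 1 N x / N x := by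
  have hN := S.lapse_ne x hx
  have hG := S.metricOn.christoffel_symm (e := sp) hx
  refine ⟨?_, fun A => ?_, fun C A => ?_, fun C => ?_⟩ <;>
    simp only [hX, hG _ (Fin.succ _) 0, S.christoffel_rho_surf_surf hx,
      S.christoffel_rho_rho_surf hx, S.christoffel_rho_rho_rho hx, S.christoffel_surf_surf_surf hx,
      S.christoffel_surf_rho_surf hx, S.christoffel_surf_rho_rho hx, chrRhoA, chrRhoRho, chrSurfA,
      chrSurfRho, Fin.sum_univ_two, S.extCurv_symm hx 1 0, S.christoffel_symm hx _ 1 0]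
  · field_simp
    ring
  · rw [S.extCurv_symm hx 0 A, S.extCurv_symm hx 1 A]
    field_simp
    ring
  · rw [S.christoffel_symm hx C 0 A, S.christoffel_symm hx C 1 A, S.extCurv_symm hx 0 A,
      S.extCurv_symm hx 1 A]
    field_simp
    ring
  · field_simp
    ring

theorem trace_surf_mul_surf (hx : x ∈ U) (A B : Fin 2) :
    ∑ k, ∑ l, christoffel sp h x k A.succ l * christoffel sp h x l B.succ k =
      ∑ C, ∑ D, christoffel lf q x C A D * christoffel lf q x D B C
      + pd (lf A) N x * pd (lf B) N x / N x ^ 2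
      - ∑ C, ∑ D, (q x)⁻¹ C D * (extCurv N b q x A C * extCurv N b q x B D
        + extCurv N b q x B C * extCurv N b q x A D)
      - ∑ C, (extCurv N b q x A C * pd (lf B) (fun y => b y C) x
        + extCurv N b q x B C * pd (lf A) (fun y => b y C) x) / N x := by
  have hN := S.lapse_ne x hx
  have hG := S.metricOn.christoffel_symm (e := sp) hx
  simp only [Fin.sum_univ_succ (n := 2), hG _ (Fin.succ _) 0, S.christoffel_rho_surf_surf hx,
      S.christoffel_rho_rho_surf hx, S.christoffel_surf_surf_surf hx,
      S.christoffel_surf_rho_surf hx, chrRhoA, chrSurfA, Fin.sum_univ_two,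
      S.extCurv_symm hx 0 A, S.extCurv_symm hx 1 A, S.extCurv_symm hx 0 B, S.extCurv_symm hx 1 B]
  field_simp
  ring

theorem trace_surf (hx : x ∈ U) (A : Fin 2) : ∑ k, christoffel sp h x k A.succ k =
    ∑ C, christoffel lf q x C A C + pd (lf A) N x / N x := by
  have hN := S.lapse_ne x hx
  have hG := S.metricOn.christoffel_symm (e := sp) hx
  simp only [Fin.sum_univ_succ (n := 2), hG _ (Fin.succ _) 0,
      S.christoffel_rho_rho_surf hx, S.christoffel_surf_surf_surf hx, chrRhoA, Fin.sum_univ_two]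
  field_simp
  ring

set_option maxHeartbeats 1000000 in
/-- The Gauss equation for the leaves. -/
theorem scalarCurv_split (hx : x ∈ U) : scalarCurv sp h x = scalarCurv lf q x
    - 2 * (N x)⁻¹ * (pd 1 (meanCurv N b q) x - b x 0 * pd 2 (meanCurv N b q) x
      - b x 1 * pd 3 (meanCurv N b q) x)
    - meanCurv N b q x ^ 2 - dot2 (q x) (extCurv N b q x) (extCurv N b q x)
    - 2 * (N x)⁻¹ * laplacian lf q N x := by
  have hN := S.lapse_ne x hx
  have sN := S.smooth_lapse x hx
  have sb0 := S.smooth_shift x hx 0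
  have sb1 := S.smooth_shift x hx 1
  have sH := S.smooth_meanCurv hx
  have sP := S.smooth_inv hx
  have sV := S.smooth_curvVec (e := lf) hx
  obtain ⟨X, hX⟩ : ∃ X : Fin 3 → Fin 3 → ℝ, ∀ k l, X k l = christoffel sp h x k 0 l
      - ∑ A : Fin 2, b x A * christoffel sp h x k A.succ l := ⟨_, fun _ _ => rfl⟩
  obtain ⟨X00, X01, X11, X10⟩ := S.perp_entry hx X hX
  -- The divergence form is used for both metrics: the divergences of `curvVec` of `q` match, and
  -- the remaining second derivatives are those of `N` and `b` and the first derivatives of the mean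
  -- curvature.
  rw [S.metricOn.scalarCurv_eq (.inr rfl) hx, S.scalarCurv_eq (.inl rfl) hx,
    Fin.sum_univ_succ, pd_congr S.isOpen hx fun y hy => S.curvVec_rho hy]
  simp only [fun a C => pd_congr (a := a) S.isOpen hx fun y hy => S.curvVec_surf hy C,
    Fin.sum_univ_two]
  rw [pd_rho_form sN sH (contDiffAt_pd sb0) (contDiffAt_pd sb1) hN,
    pd_surf_form (sV 0) (sP 0 0) (sP 0 1) sN (contDiffAt_pd sN) (contDiffAt_pd sN)
      (contDiffAt_pd sb0) (contDiffAt_pd sb0) (contDiffAt_pd sb0) sb0 sb1 sb0 sH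
      (contDiffAt_pd sb0) (contDiffAt_pd sb1) hN,
    pd_surf_form (sV 1) (sP 1 0) (sP 1 1) sN (contDiffAt_pd sN) (contDiffAt_pd sN)
      (contDiffAt_pd sb1) (contDiffAt_pd sb1) (contDiffAt_pd sb1) sb0 sb1 sb1 sH
      (contDiffAt_pd sb0) (contDiffAt_pd sb1) hN]
  have hH : meanCurv N b q x = tr (q x) (extCurv N b q x) := rfl
  obtain ⟨V, hV⟩ : ∃ V : Fin 2 → Pt → ℝ, ∀ C, (fun y => curvVec lf q y C) = V C :=
    ⟨fun C y => curvVec lf q y C, fun _ => rfl⟩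
  simp only [hV, hH]
  -- The value at `x` has already been replaced by the trace; only derivatives of the mean curvature
  -- still refer to the function, and these stay unexpanded.
  generalize meanCurv N b q = H
  have dP2 := fun i j => S.pd_inv_metric (e := lf) hx 0 i j
  have dP3 := fun i j => S.pd_inv_metric (e := lf) hx 1 i j
  simp only [Fin.sum_univ_two, S.christoffel_symm hx _ 1 0, lf,
    Fin.succ_zero_eq_one, Fin.succ_one_eq_two, Fin.reduceSucc] at dP2 dP3
  rw [S.curvQuad_frame hx _ X hX]
  simp only [S.trace_surf_mul_surf hx, S.trace_surf hx]
  simp only [Fin.sum_univ_succ (n := 2), X00, X01, X11, X10, curvQuad]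
  simp only [dot2, laplacian, cov1, Fin.sum_univ_two, tr,
    S.inv_symm hx 1 0, S.extCurv_symm hx 1 0, S.christoffel_symm hx _ 1 0]
  simp only [sp, lf, Fin.succ_zero_eq_one, Fin.succ_one_eq_two, Fin.reduceSucc]
  simp only [pd_comm sN 3 2, pd_comm sb0 2 1, pd_comm sb1 3 1,
    pd_comm sb0 3 2, pd_comm sb1 3 2, dP2, dP3, S.inv_symm hx 1 0]
  clear dP2 dP3 X00 X01 X11 X10 hX hV hH sV sH sP
  generalize (q x)⁻¹ = P
  generalize extCurv N b q x = K
  generalize christoffel (fun A : Fin 2 => A.succ.succ) q x = Γ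
  field_simp
  ring

end SplitOn

end SplitCurvature


/-! ### Splitting the divergence of a symmetric tensor. -/

section SplitDivergence

/-- A smooth symmetric tensor `T` on the three-space with normal-normal part `κ`, normal-tangential
part `k` and tangential part `W`. -/
structure TensorSplitOn (U : Set Pt) (N : Pt → ℝ) (b : Pt → Fin 2 → ℝ) (κ : Pt → ℝ)
    (k : Pt → Fin 2 → ℝ) (W : Pt → Matrix (Fin 2) (Fin 2) ℝ) (T : Pt → Matrix (Fin 3) (Fin 3) ℝ) :
    Prop where
  smooth_normal : ∀ x ∈ U, ContDiffAt ℝ ∞ κ x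
  smooth_mixed : ∀ x ∈ U, ∀ A, ContDiffAt ℝ ∞ (fun y => k y A) x
  smooth_tangent : ∀ x ∈ U, ∀ A B, ContDiffAt ℝ ∞ (fun y => W y A B) x
  symm_tangent : ∀ x ∈ U, ∀ A B, W x A B = W x B A
  rho_rho : ∀ x ∈ U, T x 0 0 = N x ^ 2 * κ x + 2 * N x * (b x 0 * k x 0 + b x 1 * k x 1)
    + (b x 0 ^ 2 * W x 0 0 + 2 * b x 0 * b x 1 * W x 0 1 + b x 1 ^ 2 * W x 1 1)
  rho_surf : ∀ x ∈ U, ∀ A : Fin 2, T x 0 A.succ = N x * k x A + (b x 0 * W x 0 A + b x 1 * W x 1 A)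
  surf_rho : ∀ x ∈ U, ∀ A : Fin 2, T x A.succ 0 = N x * k x A + (b x 0 * W x 0 A + b x 1 * W x 1 A)
  surf_surf : ∀ x ∈ U, ∀ A B : Fin 2, T x A.succ B.succ = W x A B

namespace SplitOn

variable {U : Set Pt} {N : Pt → ℝ} {b : Pt → Fin 2 → ℝ} {q : Pt → Matrix (Fin 2) (Fin 2) ℝ}
  {h : Pt → Matrix (Fin 3) (Fin 3) ℝ} (S : SplitOn U N b q h) {x : Pt}
include S

theorem contracted_christoffel_rho (hx : x ∈ U) :
    ∑ k, ∑ i, (h x)⁻¹ k i * christoffel sp h x 0 k i = -meanCurv N b q x / N x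
      + (pd 1 N x - b x 0 * pd 2 N x - b x 1 * pd 3 N x) / N x ^ 3 := by
  have hN := S.lapse_ne x hx
  obtain ⟨i00, i01, i10, i11⟩ := S.inverse_entry hx
  have hG := S.metricOn.christoffel_symm (e := sp) hx
  simp only [Fin.sum_univ_succ (n := 2), i00, i01, i10, i11]
  simp only [hG _ (Fin.succ _) 0, S.christoffel_rho_surf_surf hx, S.christoffel_rho_rho_surf hx,
    S.christoffel_rho_rho_rho hx, chrRhoA, chrRhoRho, Fin.sum_univ_two,
    meanCurv, tr, S.inv_symm hx 1 0, S.extCurv_symm hx 1 0]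
  simp only [lf, Fin.succ_zero_eq_one, Fin.succ_one_eq_two, Fin.reduceSucc]
  field_simp
  ring

theorem contracted_christoffel_surf (hx : x ∈ U) (C : Fin 2) :
    ∑ k, ∑ i, (h x)⁻¹ k i * christoffel sp h x C.succ k i =
      ∑ A, ∑ B, (q x)⁻¹ A B * christoffel lf q x C A B
      - ((q x)⁻¹ C 0 * pd 2 N x + (q x)⁻¹ C 1 * pd 3 N x) / N x
      + (pd 1 (fun y => b y C) x - b x 0 * pd 2 (fun y => b y C) x
        - b x 1 * pd 3 (fun y => b y C) x) / N x ^ 2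
      - b x C * (pd 1 N x - b x 0 * pd 2 N x - b x 1 * pd 3 N x) / N x ^ 3
      + b x C * meanCurv N b q x / N x := by
  have hN := S.lapse_ne x hx
  obtain ⟨i00, i01, i10, i11⟩ := S.inverse_entry hx
  have hG := S.metricOn.christoffel_symm (e := sp) hx
  simp only [Fin.sum_univ_succ (n := 2), i00, i01, i10, i11]
  simp only [hG _ (Fin.succ _) 0, S.christoffel_surf_surf_surf hx, S.christoffel_surf_rho_surf hx,
    S.christoffel_surf_rho_rho hx, chrRhoA, chrRhoRho, chrSurfA, chrSurfRho, Fin.sum_univ_two,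
    meanCurv, tr, S.inv_symm hx 1 0, S.extCurv_symm hx 1 0, S.christoffel_symm hx _ 1 0]
  simp only [lf, Fin.succ_zero_eq_one, Fin.succ_one_eq_two, Fin.reduceSucc]
  field_simp
  ring

/-- The contraction in the divergence is carried out with the decomposition of the inverse metric of
`curvQuad_frame`. The connection term on the contracted slot is kept as the trace `h^{ki} Γ^l_{ki}`,
which is evaluated separately. -/
theorem div2_frame (hx : x ∈ U) (T : Pt → Matrix (Fin 3) (Fin 3) ℝ) (X : Fin 3 → Fin 3 → ℝ)
    (hX : ∀ k l, X k l = christoffel sp h x k 0 l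
      - ∑ A : Fin 2, b x A * christoffel sp h x k A.succ l) (j : Fin 3) :
    div2 sp h T x j =
      (1 / N x ^ 2) * (pd 1 (fun y => T y 0 j) x - ∑ C, b x C * pd (lf C) (fun y => T y 0 j) x
        - ∑ A : Fin 2, b x A * (pd 1 (fun y => T y A.succ j) x
          - ∑ C, b x C * pd (lf C) (fun y => T y A.succ j) x)
        - ∑ l, (T x 0 l - ∑ A : Fin 2, b x A * T x A.succ l) * X l j)
      + ∑ A, ∑ B : Fin 2, (q x)⁻¹ A B * (pd (lf A) (fun y => T y B.succ j) x
        - ∑ l, T x B.succ l * christoffel sp h x l A.succ j)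
      - ∑ l, (∑ k, ∑ i, (h x)⁻¹ k i * christoffel sp h x l k i) * T x l j := by
  obtain ⟨i00, i01, i10, i11⟩ := S.inverse_entry hx
  simp only [div2, cov2, hX]
  simp only [Fin.sum_univ_succ (n := 2), i00, i01, i10, i11, Fin.sum_univ_two]
  simp only [sp, lf, Fin.succ_zero_eq_one, Fin.succ_one_eq_two, Fin.reduceSucc]
  ring

end SplitOn

namespace TensorSplitOn

variable {U : Set Pt} {N : Pt → ℝ} {b : Pt → Fin 2 → ℝ} {q : Pt → Matrix (Fin 2) (Fin 2) ℝ}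
  {h : Pt → Matrix (Fin 3) (Fin 3) ℝ} {κ : Pt → ℝ} {k : Pt → Fin 2 → ℝ}
  {W : Pt → Matrix (Fin 2) (Fin 2) ℝ} {T : Pt → Matrix (Fin 3) (Fin 3) ℝ}
  (Q : TensorSplitOn U N b κ k W T) (S : SplitOn U N b q h) {x : Pt}
include Q S

theorem pd_symm_tangent (hx : x ∈ U) (a : Fin 4) (A B : Fin 2) :
    pd a (fun y => W y A B) x = pd a (fun y => W y B A) x :=
  pd_congr S.isOpen hx fun y hy => Q.symm_tangent y hy A B

theorem pd_rho_rho (hx : x ∈ U) (a : Fin 4) : pd a (fun y => T y 0 0) x =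
    2 * N x * pd a N x * κ x + N x ^ 2 * pd a κ x
    + 2 * pd a N x * (b x 0 * k x 0 + b x 1 * k x 1)
    + 2 * N x * (pd a (fun y => b y 0) x * k x 0 + b x 0 * pd a (fun y => k y 0) x
      + pd a (fun y => b y 1) x * k x 1 + b x 1 * pd a (fun y => k y 1) x)
    + (2 * b x 0 * pd a (fun y => b y 0) x * W x 0 0 + b x 0 ^ 2 * pd a (fun y => W y 0 0) x
      + 2 * pd a (fun y => b y 0) x * b x 1 * W x 0 1 + 2 * b x 0 * pd a (fun y => b y 1) x * W x 0 1
      + 2 * b x 0 * b x 1 * pd a (fun y => W y 0 1) x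
      + 2 * b x 1 * pd a (fun y => b y 1) x * W x 1 1 + b x 1 ^ 2 * pd a (fun y => W y 1 1) x) := by
  have hN := S.smooth_lapse x hx
  have hb0 := S.smooth_shift x hx 0
  have hb1 := S.smooth_shift x hx 1
  have hκ := Q.smooth_normal x hx
  have hk0 := Q.smooth_mixed x hx 0
  have hk1 := Q.smooth_mixed x hx 1
  have h00 := Q.smooth_tangent x hx 0 0
  have h01 := Q.smooth_tangent x hx 0 1
  have h11 := Q.smooth_tangent x hx 1 1
  rw [pd_congr S.isOpen hx Q.rho_rho]
  simp (disch := fun_prop) only [pd_add, pd_mul, pd_pow_two, pd_const]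
  ring

theorem pd_rho_surf (hx : x ∈ U) (a : Fin 4) (A : Fin 2) :
    pd a (fun y => T y 0 A.succ) x = pd a N x * k x A + N x * pd a (fun y => k y A) x
    + (pd a (fun y => b y 0) x * W x 0 A + b x 0 * pd a (fun y => W y 0 A) x
      + pd a (fun y => b y 1) x * W x 1 A + b x 1 * pd a (fun y => W y 1 A) x) := by
  have hN := S.smooth_lapse x hx
  have hb0 := S.smooth_shift x hx 0
  have hb1 := S.smooth_shift x hx 1
  have hk0 := Q.smooth_mixed x hx A
  have h00 := Q.smooth_tangent x hx 0 A
  have h01 := Q.smooth_tangent x hx 1 A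
  rw [pd_congr S.isOpen hx fun y hy => Q.rho_surf y hy A]
  simp (disch := fun_prop) only [pd_add, pd_mul]
  ring

theorem pd_surf_rho (hx : x ∈ U) (a : Fin 4) (A : Fin 2) :
    pd a (fun y => T y A.succ 0) x = pd a (fun y => T y 0 A.succ) x :=
  pd_congr S.isOpen hx fun y hy => by rw [Q.rho_surf y hy, Q.surf_rho y hy]

theorem pd_surf_surf (hx : x ∈ U) (a : Fin 4) (A B : Fin 2) :
    pd a (fun y => T y A.succ B.succ) x = pd a (fun y => W y A B) x :=
  pd_congr S.isOpen hx fun y hy => Q.surf_surf y hy A B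

/-- The tangential part of the divergence. -/
theorem div2_surf (hx : x ∈ U) (A : Fin 2) : div2 sp h T x A.succ =
    meanCurv N b q x * k x A
    + (N x)⁻¹ * (pd 1 (fun y => k y A) x - ∑ C, (b x C * pd (lf C) (fun y => k y A) x
      + k x C * pd (lf A) (fun y => b y C) x))
    - κ x * pd (lf A) N x / N x + div2 lf q W x A
    + (N x)⁻¹ * ∑ B, ∑ C, (q x)⁻¹ B C * pd (lf C) N x * W x B A := by
  have hN := S.lapse_ne x hx
  have hG := S.metricOn.christoffel_symm (e := sp) hx
  obtain ⟨X, hX⟩ : ∃ X : Fin 3 → Fin 3 → ℝ, ∀ k l, X k l = christoffel sp h x k 0 l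
      - ∑ A : Fin 2, b x A * christoffel sp h x k A.succ l := ⟨_, fun _ _ => rfl⟩
  obtain ⟨X00, X01, X11, X10⟩ := S.perp_entry hx X hX
  rw [S.div2_frame hx T X hX]
  simp only [Fin.sum_univ_succ (fun l => (∑ k, ∑ i, (h x)⁻¹ k i * christoffel sp h x l k i) * _),
    S.contracted_christoffel_rho hx, S.contracted_christoffel_surf hx]
  simp only [Fin.sum_univ_succ (n := 2), X01, X11, Q.pd_rho_surf S hx, Q.pd_surf_surf S hx,
    Q.rho_rho x hx, Q.rho_surf x hx, Q.surf_rho x hx, Q.surf_surf x hx,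
    S.christoffel_rho_surf_surf hx,
    S.christoffel_surf_surf_surf hx, div2, cov2, Fin.sum_univ_two, Q.symm_tangent x hx 1 0,
    S.christoffel_symm hx _ 1 0, S.inv_symm hx 1 0,
    meanCurv, tr]
  simp only [lf, Fin.succ_zero_eq_one, Fin.succ_one_eq_two, Fin.reduceSucc,
    S.extCurv_symm hx 1 0]
  generalize (q x)⁻¹ = P
  generalize extCurv N b q x = K
  generalize christoffel (fun A : Fin 2 => A.succ.succ) q x = Γ
  field_simp
  ring

/-- The normal part of the divergence. -/
theorem div2_normal (hx : x ∈ U) :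
    (N x)⁻¹ * (div2 sp h T x 0 - ∑ A : Fin 2, b x A * div2 sp h T x A.succ) =
    (N x)⁻¹ * (pd 1 κ x - ∑ A, b x A * pd (lf A) κ x) + κ x * meanCurv N b q x
    + ∑ A, ∑ B, (q x)⁻¹ A B * cov1 lf q k x A B
    + 2 * (N x)⁻¹ * ∑ A, ∑ B, (q x)⁻¹ A B * k x A * pd (lf B) N x
    - dot2 (q x) (W x) (extCurv N b q x) := by
  have hN := S.lapse_ne x hx
  have hG := S.metricOn.christoffel_symm (e := sp) hx
  obtain ⟨X, hX⟩ : ∃ X : Fin 3 → Fin 3 → ℝ, ∀ k l, X k l = christoffel sp h x k 0 l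
      - ∑ A : Fin 2, b x A * christoffel sp h x k A.succ l := ⟨_, fun _ _ => rfl⟩
  obtain ⟨X00, X01, X11, X10⟩ := S.perp_entry hx X hX
  -- The tangential components are already known, so only the `ρ` component has to be expanded.
  have hA := fun A => Q.div2_surf S hx A
  simp only [hA]
  rw [S.div2_frame hx T X hX]
  simp only [Fin.sum_univ_succ (fun l => (∑ k, ∑ i, (h x)⁻¹ k i * christoffel sp h x l k i) * _),
    S.contracted_christoffel_rho hx, S.contracted_christoffel_surf hx]
  simp only [Fin.sum_univ_succ (n := 2), X00, X10, Q.pd_rho_surf S hx, Q.pd_rho_rho S hx, Q.pd_surf_rho S hx,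
    Q.rho_rho x hx, Q.rho_surf x hx, Q.surf_rho x hx, Q.surf_surf x hx,
    hG _ (Fin.succ _) 0, S.christoffel_rho_rho_surf hx, chrRhoA, chrSurfA,
    S.christoffel_surf_rho_surf hx, div2, cov2, cov1, dot2, Fin.sum_univ_two,
    Q.symm_tangent x hx 1 0,
    Q.pd_symm_tangent S hx _ 1 0, S.christoffel_symm hx _ 1 0, S.inv_symm hx 1 0,
    meanCurv, tr]
  simp only [lf, Fin.succ_zero_eq_one, Fin.succ_one_eq_two, Fin.reduceSucc,
    S.extCurv_symm hx 1 0]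
  generalize (q x)⁻¹ = P
  generalize extCurv N b q x = K
  generalize christoffel (fun A : Fin 2 => A.succ.succ) q x = Γ
  field_simp
  ring

end TensorSplitOn

end SplitDivergence


/-! ### The gauge puts the spatial metric in lapse-shift form. -/

namespace IsGauge

variable {U : Set Pt} {g : Pt → Matrix (Fin 4) (Fin 4) ℝ} {Om nu : Pt → ℝ}
  (H : IsGauge U g Om nu) {x : Pt}

theorem h4_sp_sp (i j : Fin 3) : h4 g x (sp i) (sp j) = g x (sp i) (sp j) := by
  simp [h4, nDn]

theorem h3_eq : h3 g x = (g x).submatrix sp sp := by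
  ext i j; exact h4_sp_sp i j

theorem nhUp_eq (i : Fin 3) : nhUp g x i = (h3 g x)⁻¹ i 0 * Nh g x := by
  simp [nhUp, nhDn]

include H

theorem smooth_g (hx : x ∈ U) (a b : Fin 4) : ContDiffAt ℝ ∞ (fun y => g y a b) x :=
  (H.smooth_metric a b).contDiffAt (H.isOpen.mem_nhds hx)

theorem lapse_pos (hx : x ∈ U) : 0 < lapse g x := by
  have := H.timelike x hx
  exact one_div_pos.2 (Real.sqrt_pos.2 (by linarith))

/-- The shift is `δ^a_0 - N n^a`, so its vanishing says `n = N⁻¹ ∂_τ`. -/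
theorem nUp_zero (hx : x ∈ U) : nUp g x 0 = 1 / lapse g x := by
  have h := H.shift_zero x hx 0
  have hl := (H.lapse_pos hx).ne'
  simp only [shift, hMixed, nDn, if_true] at h
  field_simp
  linarith

theorem nUp_succ (hx : x ∈ U) (i : Fin 3) : nUp g x i.succ = 0 := by
  have h := H.shift_zero x hx i.succ
  have hl := (H.lapse_pos hx).ne'
  simpa [shift, hMixed, nDn, hl] using h

theorem g_succ_zero (hx : x ∈ U) (i : Fin 3) : g x i.succ 0 = 0 := by
  have hl := (H.lapse_pos hx).ne'
  have ht := H.timelike x hx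
  -- Nondegeneracy follows from `g^{ττ} < 0`: the inverse of a singular matrix is zero by
  -- convention.
  have hu : IsUnit (g x).det := by
    by_contra h0
    rw [Matrix.nonsing_inv_apply_not_isUnit _ h0] at ht
    simp at ht
  have hi : ∀ j : Fin 3, (g x)⁻¹ j.succ 0 = 0 := by
    intro j
    have := H.nUp_succ hx j
    simpa [nUp, nDn, hl] using this
  have h := congrFun (congrFun (Matrix.mul_nonsing_inv (g x) hu) i.succ) 0
  rw [Matrix.mul_apply, Fin.sum_univ_succ] at h
  simpa [hi, ht.ne] using h

theorem g_symm (hx : x ∈ U) (a b : Fin 4) : g x a b = g x b a := (H.symm x hx).apply b a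

theorem h4_succ_zero (hx : x ∈ U) (i : Fin 3) : h4 g x i.succ 0 = 0 := by
  simp [h4, nDn, H.g_succ_zero hx]

theorem h4_zero_succ (hx : x ∈ U) (i : Fin 3) : h4 g x 0 i.succ = 0 := by
  simp [h4, nDn, H.g_symm hx 0, H.g_succ_zero hx]

theorem smooth_h3 (hx : x ∈ U) (i j : Fin 3) : ContDiffAt ℝ ∞ (fun y => h3 g y i j) x := by
  simp only [h3_eq]
  exact H.smooth_g hx _ _

theorem h3_posDef (hx : x ∈ U) : (h3 g x).PosDef := by
  rw [h3_eq]; exact H.spacelike x hx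

theorem h3_metricOn : MetricOn U (h3 g) where
  isOpen := H.isOpen
  smooth x hx i j := H.smooth_h3 hx i j
  symm x hx i j := by simp only [h3_eq]; exact H.g_symm hx _ _
  det_ne x hx := (H.h3_posDef hx).det_pos.ne'

theorem inv_zero_pos (hx : x ∈ U) : 0 < (h3 g x)⁻¹ 0 0 := (H.h3_posDef hx).inv.diag_pos

theorem Nh_pos (hx : x ∈ U) : 0 < Nh g x :=
  one_div_pos.2 (Real.sqrt_pos.2 (H.inv_zero_pos hx))

theorem Nh_sq (hx : x ∈ U) : Nh g x ^ 2 * (h3 g x)⁻¹ 0 0 = 1 := by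
  have h := H.inv_zero_pos hx
  rw [Nh, div_pow, Real.sq_sqrt h.le]
  field_simp

theorem nhUp_zero (hx : x ∈ U) : nhUp g x 0 = 1 / Nh g x := by
  have h0 := (H.Nh_pos hx).ne'
  rw [nhUp_eq]
  field_simp
  linarith [H.Nh_sq hx]

theorem nhUp_succ (hx : x ∈ U) (A : Fin 2) : nhUp g x A.succ = -ShA g x A / Nh g x := by
  have h0 := (H.Nh_pos hx).ne'
  simp [ShA, Sh, h0]

theorem Sh_zero (hx : x ∈ U) : Sh g x 0 = 0 := by
  have h0 := (H.Nh_pos hx).ne'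
  simp [Sh, H.nhUp_zero hx, h0]

theorem sum_h3_nhUp (hx : x ∈ U) (i : Fin 3) : ∑ j, h3 g x i j * nhUp g x j = nhDn g x i := by
  have h := congrFun (congrFun (H.h3_metricOn.mul_inv hx) i) 0
  rw [Matrix.mul_apply] at h
  simp only [nhUp_eq, ← mul_assoc, ← Finset.sum_mul, h, nhDn, Matrix.one_apply]
  split_ifs <;> simp

theorem gh4_sp_sp (hx : x ∈ U) (i j : Fin 3) :
    gh4 g x (sp i) (sp j) = h3 g x i j - nhDn g x i * nhDn g x j := by
  have h : ∀ i : Fin 3, ∑ c, h4 g x (sp i) c * toST (nhUp g x) c = nhDn g x i := by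
    intro i
    rw [Fin.sum_univ_succ, ← H.sum_h3_nhUp hx i]
    simp [toST, h3]
  simp only [gh4, Matrix.of_apply, h]
  rfl

theorem gh4_zero_succ (hx : x ∈ U) (i : Fin 3) : gh4 g x 0 i.succ = 0 := by
  have h : ∑ c, h4 g x 0 c * toST (nhUp g x) c = 0 := by
    rw [Fin.sum_univ_succ]
    simp [toST, H.h4_zero_succ hx]
  simp only [gh4, Matrix.of_apply, h, H.h4_zero_succ hx]
  ring

theorem gh4_succ_zero (hx : x ∈ U) (i : Fin 3) : gh4 g x i.succ 0 = 0 := by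
  have h : ∑ c, h4 g x 0 c * toST (nhUp g x) c = 0 := by
    rw [Fin.sum_univ_succ]
    simp [toST, H.h4_zero_succ hx]
  simp only [gh4, Matrix.of_apply, h, H.h4_succ_zero hx]
  ring

theorem gh_apply (hx : x ∈ U) (A B : Fin 2) : gh g x A B = h3 g x A.succ B.succ := by
  have := H.gh4_sp_sp hx A.succ B.succ
  simp only [nhDn, Fin.succ_ne_zero, if_false, mul_zero, sub_zero] at this
  exact this

/-- The surface component of lowering the index of `n̂`: as `n̂_A = 0` and `n̂^i` is `N̂⁻¹ (1,
-N̂^A)`, it can be solved for `h_{ρA}`. -/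
theorem h3_zero_succ (hx : x ∈ U) (A : Fin 2) :
    h3 g x 0 A.succ = ∑ B, gh g x A B * ShA g x B := by
  have h0 := (H.Nh_pos hx).ne'
  have h := H.sum_h3_nhUp hx A.succ
  simp only [Fin.sum_univ_succ (n := 2), H.nhUp_zero hx, H.nhUp_succ hx, nhDn, Fin.succ_ne_zero,
    if_false, Fin.sum_univ_two] at h
  simp only [H.gh_apply hx, Fin.sum_univ_two]
  rw [H.h3_metricOn.symm x hx 0 A.succ]
  field_simp at h
  linear_combination h

theorem h3_zero_zero (hx : x ∈ U) :
    h3 g x 0 0 = Nh g x ^ 2 + ∑ B, h3 g x 0 B.succ * ShA g x B := by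
  have h0 := (H.Nh_pos hx).ne'
  have h := H.sum_h3_nhUp hx 0
  simp only [Fin.sum_univ_succ (n := 2), H.nhUp_zero hx, H.nhUp_succ hx, nhDn, if_true,
    Fin.sum_univ_two] at h
  simp only [Fin.sum_univ_two]
  field_simp at h
  linear_combination h

theorem smooth_Nh (hx : x ∈ U) : ContDiffAt ℝ ∞ (Nh g) x := by
  have h := H.inv_zero_pos hx
  unfold Nh
  exact contDiffAt_const.div ((H.h3_metricOn.smooth_inv hx 0 0).sqrt h.ne') (Real.sqrt_pos.2 h).ne'

theorem smooth_ShA (hx : x ∈ U) (A : Fin 2) : ContDiffAt ℝ ∞ (fun y => ShA g y A) x := by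
  have hN := H.smooth_Nh hx
  have hP := H.h3_metricOn.smooth_inv hx A.succ 0
  simp only [ShA, Sh, nhUp_eq]
  exact contDiffAt_const.sub (hN.mul (hP.mul hN))

theorem gh_posDef (hx : x ∈ U) : (gh g x).PosDef := by
  have h : gh g x = (h3 g x).submatrix Fin.succ Fin.succ := by
    ext A B; exact H.gh_apply hx A B
  rw [h]
  exact (H.h3_posDef hx).submatrix (Fin.succ_injective _)

/-- The bridge from the invariantly defined lapse, shift and leaf metric to the coordinate formulas
for split metrics. -/
theorem splitOn : SplitOn U (Nh g) (ShA g) (gh g) (h3 g) where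
  isOpen := H.isOpen
  smooth x hx A B := (H.smooth_h3 hx A.succ B.succ).congr_of_eventuallyEq
    (Filter.eventuallyEq_of_mem (H.isOpen.mem_nhds hx) fun y hy => H.gh_apply hy A B)
  symm x hx A B := by
    rw [H.gh_apply hx, H.gh_apply hx]; exact H.h3_metricOn.symm x hx _ _
  det_ne x hx := (H.gh_posDef hx).det_pos.ne'
  smooth_lapse x hx := H.smooth_Nh hx
  lapse_ne x hx := (H.Nh_pos hx).ne'
  smooth_shift x hx A := H.smooth_ShA hx A
  eq_split x hx := by
    have hs := H.h3_metricOn.symm x hx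
    have e0 := H.h3_zero_zero hx
    have e1 := H.h3_zero_succ hx
    have e2 := H.gh_apply hx
    have s : gh g x 1 0 = gh g x 0 1 := by rw [e2, e2]; exact hs _ _
    simp only [Fin.sum_univ_two, Fin.forall_fin_two, Fin.succ_zero_eq_one, Fin.succ_one_eq_two]
      at e0 e1 e2
    ext i j
    fin_cases i <;> fin_cases j <;> simp [splitMetric]
    · rw [e0, e1.1, e1.2, s]; ring
    · exact e1.1
    · rw [e1.2, s]
    · rw [hs, e1.1]
    · exact e2.1.1.symm
    · exact e2.1.2.symm
    · rw [hs, e1.2, s]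
    · rw [hs]; exact e2.1.2.symm
    · exact e2.2.2.symm

end IsGauge


/-! ### The pieces of the extrinsic curvatures. -/

namespace IsGauge

variable {U : Set Pt} {g : Pt → Matrix (Fin 4) (Fin 4) ℝ} {Om nu : Pt → ℝ}
  (H : IsGauge U g Om nu) {x : Pt}

theorem KK_eq_K3 (A B : Fin 2) : KK g x A B = K3 g x A.succ B.succ := by
  simp only [KK, Matrix.of_apply, ghMixed, nhDn, Fin.succ_ne_zero, if_false, mul_zero, sub_zero]
  simp

include H

/-- The relation `N = ν N̂` enters here: it makes `n^τ = 1 / (ν N̂)` smooth, which is what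
differentiating `K` along `Σ_τ` requires. -/
theorem smooth_nUp_zero (hx : x ∈ U) : ContDiffAt ℝ ∞ (fun y => nUp g y 0) x := by
  have hn : ContDiffAt ℝ ∞ nu x := H.smooth_nu.contDiffAt (H.isOpen.mem_nhds hx)
  have hN := H.smooth_Nh hx
  have h0 : nu x * Nh g x ≠ 0 := mul_ne_zero (H.nu_ne x hx) (H.Nh_pos hx).ne'
  have h : ContDiffAt ℝ ∞ (fun y => 1 / (nu y * Nh g y)) x := contDiffAt_const.div (hn.mul hN) h0
  exact h.congr_of_eventuallyEq (Filter.eventuallyEq_of_mem (H.isOpen.mem_nhds hx)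
    fun y hy => by simp only [H.nUp_zero hy, H.lapse_eq y hy])

theorem lieFun_nUp (hx : x ∈ U) (f : Pt → ℝ) :
    lieFun id (nUp g) f x = nUp g x 0 * pd 0 f x := by
  rw [lieFun, Fin.sum_univ_succ]
  simp [H.nUp_succ hx]

theorem pd_nUp_succ (hx : x ∈ U) (a : Fin 4) (i : Fin 3) : pd a (fun y => nUp g y i.succ) x = 0 := by
  rw [pd_congr H.isOpen hx fun y hy => H.nUp_succ hy i, pd_const]

/-- Spatial gradients of `n^τ = 1/N` could enter only multiplied by a mixed component `T_{0i}` or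
`T_{i0}`, and these vanish. -/
theorem lieTen_nUp (hx : x ∈ U) (T : Pt → Matrix (Fin 4) (Fin 4) ℝ)
    (h0 : ∀ i : Fin 3, T x 0 i.succ = 0) (h1 : ∀ i : Fin 3, T x i.succ 0 = 0) (i j : Fin 3) :
    lieTen id (nUp g) T x i.succ j.succ =
      nUp g x 0 * pd 0 (fun y => T y i.succ j.succ) x := by
  rw [lieTen, Matrix.of_apply, Fin.sum_univ_succ]
  simp [H.nUp_succ hx, H.pd_nUp_succ hx, h0, h1]

theorem LnSh_eq (hx : x ∈ U) (i : Fin 3) :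
    LnSh g x i = nUp g x 0 * pd 0 (fun y => Sh g y i) x := by
  rw [LnSh, lieVec, Fin.sum_univ_succ]
  simp [H.nUp_succ hx, H.pd_nUp_succ hx, toST]

theorem LnSh_zero (hx : x ∈ U) : LnSh g x 0 = 0 := by
  rw [H.LnSh_eq hx, pd_congr H.isOpen hx fun y hy => H.Sh_zero hy, pd_const, mul_zero]

theorem LnShA_eq (hx : x ∈ U) (A : Fin 2) :
    LnShA g x A = nUp g x 0 * pd 0 (fun y => ShA g y A) x := H.LnSh_eq hx A.succ

theorem K3_eq (hx : x ∈ U) (i j : Fin 3) :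
    K3 g x i j = 1 / 2 * (nUp g x 0 * pd 0 (fun y => h3 g y i j) x) := by
  have := H.lieTen_nUp hx (h4 g) (H.h4_zero_succ hx) (H.h4_succ_zero hx) i j
  simp only [K3, Matrix.submatrix_apply, Matrix.smul_apply, smul_eq_mul, this]
  rfl

theorem K3_symm (hx : x ∈ U) (i j : Fin 3) : K3 g x i j = K3 g x j i := by
  rw [H.K3_eq hx, H.K3_eq hx, H.h3_metricOn.pd_symm hx]

theorem smooth_K3 (hx : x ∈ U) (i j : Fin 3) : ContDiffAt ℝ ∞ (fun y => K3 g y i j) x := by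
  have h : ContDiffAt ℝ ∞ (fun y => 1 / 2 * (nUp g y 0 * pd 0 (fun z => h3 g z i j) y)) x :=
    contDiffAt_const.mul ((H.smooth_nUp_zero hx).mul (contDiffAt_pd (H.smooth_h3 hx i j)))
  exact h.congr_of_eventuallyEq (Filter.eventuallyEq_of_mem (H.isOpen.mem_nhds hx)
    fun y hy => H.K3_eq hy i j)

theorem kap_eq_K3 (hx : x ∈ U) : kap g x = (K3 g x 0 0
    - 2 * ∑ A : Fin 2, ShA g x A * K3 g x 0 A.succ
    + ∑ A : Fin 2, ∑ B : Fin 2, ShA g x A * ShA g x B * K3 g x A.succ B.succ) / Nh g x ^ 2 := by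
  have h0 := (H.Nh_pos hx).ne'
  simp only [kap, Fin.sum_univ_succ (n := 2), H.nhUp_zero hx, H.nhUp_succ hx, Fin.sum_univ_two,
    H.K3_symm hx (Fin.succ _) 0]
  field_simp
  ring

theorem kk_eq_K3 (hx : x ∈ U) (A : Fin 2) : kk g x A = (K3 g x 0 A.succ
    - ∑ B : Fin 2, ShA g x B * K3 g x B.succ A.succ) / Nh g x := by
  have h0 := (H.Nh_pos hx).ne'
  have h : ∀ k, ∑ l, ghMixed g x k A.succ * nhUp g x l * K3 g x k l =
      if k = A.succ then ∑ l, nhUp g x l * K3 g x k l else 0 := by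
    intro k
    simp only [ghMixed, nhDn, Fin.succ_ne_zero, if_false, mul_zero, sub_zero]
    split_ifs <;> simp
  simp only [kk, h, Finset.sum_ite_eq', Finset.mem_univ, if_true]
  simp only [Fin.sum_univ_succ (n := 2), H.nhUp_zero hx, H.nhUp_succ hx, Fin.sum_univ_two,
    H.K3_symm hx A.succ]
  field_simp
  ring

theorem tensorSplitOn : TensorSplitOn U (Nh g) (ShA g) (kap g) (kk g) (KK g) (K3 g) where
  smooth_normal x hx := by
    have h0 := (H.Nh_pos hx).ne'
    have hN := H.smooth_Nh hx
    have hb := H.smooth_ShA hx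
    have hK := H.smooth_K3 hx
    have h := ((hK 0 0).sub ((contDiffAt_const (c := (2 : ℝ))).mul
      (ContDiffAt.sum (s := Finset.univ) fun A _ => (hb A).mul (hK 0 A.succ)))).add
      (ContDiffAt.sum (s := Finset.univ) fun A _ => ContDiffAt.sum (s := Finset.univ) fun B _ =>
        ((hb A).mul (hb B)).mul (hK A.succ B.succ))
    exact (h.div (hN.pow 2) (pow_ne_zero 2 h0)).congr_of_eventuallyEq
      (Filter.eventuallyEq_of_mem (H.isOpen.mem_nhds hx) fun y hy => H.kap_eq_K3 hy)
  smooth_mixed x hx A := by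
    have h0 := (H.Nh_pos hx).ne'
    have hN := H.smooth_Nh hx
    have hb := H.smooth_ShA hx
    have hK := H.smooth_K3 hx
    have h := (hK 0 A.succ).sub (ContDiffAt.sum (s := Finset.univ)
      fun B _ => (hb B).mul (hK B.succ A.succ))
    exact (h.div hN h0).congr_of_eventuallyEq
      (Filter.eventuallyEq_of_mem (H.isOpen.mem_nhds hx) fun y hy => H.kk_eq_K3 hy A)
  smooth_tangent x hx A B := by
    simp only [KK_eq_K3]; exact H.smooth_K3 hx _ _
  symm_tangent x hx A B := by
    simp only [KK_eq_K3]; exact H.K3_symm hx _ _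
  rho_rho x hx := by
    have h0 := (H.Nh_pos hx).ne'
    simp only [H.kap_eq_K3 hx, H.kk_eq_K3 hx, KK_eq_K3, Fin.sum_univ_two, H.K3_symm hx (Fin.succ 1) (Fin.succ 0)]
    field_simp
    ring
  rho_surf x hx A := by
    have h0 := (H.Nh_pos hx).ne'
    simp only [H.kk_eq_K3 hx, KK_eq_K3, Fin.sum_univ_two]
    field_simp
    ring
  surf_rho x hx A := by
    have h0 := (H.Nh_pos hx).ne'
    simp only [H.kk_eq_K3 hx, KK_eq_K3, Fin.sum_univ_two, H.K3_symm hx A.succ 0]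
    field_simp
    ring
  surf_surf x hx A B := (KK_eq_K3 A B).symm

theorem tr_K3 (hx : x ∈ U) : tr (h3 g x) (K3 g x) = kap g x + trKK g x := by
  have h0 := (H.Nh_pos hx).ne'
  have Q := H.tensorSplitOn
  obtain ⟨i00, i01, i10, i11⟩ := H.splitOn.inverse_entry hx
  simp only [trKK, tr, Fin.sum_univ_succ (n := 2), i00, i01, i10, i11]
  simp only [Q.rho_rho x hx, Q.rho_surf x hx, Q.surf_rho x hx, Q.surf_surf x hx, Fin.sum_univ_two,
    Q.symm_tangent x hx 1 0]
  field_simp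
  ring

theorem dot2_K3 (hx : x ∈ U) : dot2 (h3 g x) (K3 g x) (K3 g x) =
    kap g x ^ 2 + 2 * dot1 (gh g x) (kk g x) (kk g x) + dot2 (gh g x) (KK g x) (KK g x) := by
  have h0 := (H.Nh_pos hx).ne'
  have Q := H.tensorSplitOn
  obtain ⟨i00, i01, i10, i11⟩ := H.splitOn.inverse_entry hx
  simp only [dot2, dot1, Fin.sum_univ_succ (n := 2), i00, i01, i10, i11]
  simp only [Q.rho_rho x hx, Q.rho_surf x hx, Q.surf_rho x hx, Q.surf_surf x hx, Fin.sum_univ_two,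
    Q.symm_tangent x hx 1 0, H.splitOn.inv_symm hx 1 0]
  field_simp
  ring

/-- In the lapse-shift form of `h`, the normal-normal part of `∂_τ h` is `2 N̂⁻¹ ∂_τ N̂`: the
variations of shift and leaf metric drop out. Likewise the mixed part sees only the shift, and the
tangential part only `γ̂`. -/
theorem kap_eq (hx : x ∈ U) : kap g x = LnNh g x / Nh g x := by
  have h0 := (H.Nh_pos hx).ne'
  obtain ⟨e1, e2, e3, e4⟩ := H.splitOn.pd_entry hx 0
  rw [H.kap_eq_K3 hx, LnNh, H.lieFun_nUp hx]
  simp only [H.K3_eq hx, Fin.sum_univ_two, e1, e2, e4, H.splitOn.pd_symm hx _ 1 0,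
    H.splitOn.symm x hx 1 0]
  field_simp
  ring

theorem kk_eq (hx : x ∈ U) (A : Fin 2) :
    kk g x A = (∑ B, gh g x A B * LnShA g x B) / (2 * Nh g x) := by
  have h0 := (H.Nh_pos hx).ne'
  obtain ⟨e1, e2, e3, e4⟩ := H.splitOn.pd_entry hx 0
  rw [H.kk_eq_K3 hx]
  simp only [H.K3_eq hx, Fin.sum_univ_two, e2, e4, H.LnShA_eq hx, H.splitOn.pd_symm hx _ _ A]
  field_simp
  ring

theorem KK_eq (hx : x ∈ U) (A B : Fin 2) :
    KK g x A B = 1 / 2 * (nUp g x 0 * pd 0 (fun y => gh g y A B) x) := by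
  rw [KK_eq_K3, H.K3_eq hx, (H.splitOn.pd_entry hx 0).2.2.2]

theorem gh3_zero_succ (hx : x ∈ U) (A : Fin 2) :
    gh3 g x 0 A.succ = ∑ B, gh g x A B * ShA g x B := by
  rw [← H.h3_zero_succ hx]
  have := H.gh4_sp_sp hx 0 A.succ
  simp only [nhDn, Fin.succ_ne_zero, if_false, mul_zero, sub_zero] at this
  exact this

theorem gh3_succ_zero (hx : x ∈ U) (A : Fin 2) :
    gh3 g x A.succ 0 = ∑ B, gh g x A B * ShA g x B := by
  rw [← H.h3_zero_succ hx, H.h3_metricOn.symm x hx 0]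
  have := H.gh4_sp_sp hx A.succ 0
  simp only [nhDn, Fin.succ_ne_zero, if_false, zero_mul, sub_zero] at this
  exact this

theorem pd_nhUp_zero (hx : x ∈ U) (a : Fin 4) :
    pd a (fun y => nhUp g y 0) x = -pd a (Nh g) x / Nh g x ^ 2 := by
  rw [pd_congr H.isOpen hx fun y hy => H.nhUp_zero hy, pd_div contDiffAt_const (H.smooth_Nh hx)
    (H.Nh_pos hx).ne', pd_const]
  ring

theorem pd_nhUp_succ (hx : x ∈ U) (a : Fin 4) (A : Fin 2) : pd a (fun y => nhUp g y A.succ) x =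
    -pd a (fun y => ShA g y A) x / Nh g x + ShA g x A * pd a (Nh g) x / Nh g x ^ 2 := by
  rw [pd_congr H.isOpen hx fun y hy => H.nhUp_succ hy A, pd_div (H.smooth_ShA hx A).neg
    (H.smooth_Nh hx) (H.Nh_pos hx).ne', pd_neg]
  ring

theorem Kh_eq (hx : x ∈ U) : Kh g x = extCurv (Nh g) (ShA g) (gh g) x := by
  have h0 := (H.Nh_pos hx).ne'
  have g3 : ∀ (y : Pt) (A B : Fin 2), gh3 g y A.succ B.succ = gh g y A B := fun _ _ _ => rfl
  ext A B
  simp only [Kh, extCurv, lieTen, Matrix.submatrix_apply, Matrix.smul_apply, Matrix.of_apply,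
    smul_eq_mul]
  simp only [Fin.sum_univ_succ (n := 2), H.pd_nhUp_zero hx, H.pd_nhUp_succ hx, H.gh3_zero_succ hx,
    H.gh3_succ_zero hx, g3, H.nhUp_zero hx, H.nhUp_succ hx, Fin.sum_univ_two]
  simp only [sp, lf, Fin.succ_zero_eq_one, Fin.succ_one_eq_two, Fin.reduceSucc,
    H.splitOn.symm x hx B]
  field_simp
  ring

end IsGauge


/-! ### The conformal gauge and the Hamiltonian constraint. -/

theorem dot2_traceFree {q K : Matrix (Fin 2) (Fin 2) ℝ} {a b d : ℝ} (h0 : a * d - b ^ 2 ≠ 0)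
    (i00 : q⁻¹ 0 0 = a) (i01 : q⁻¹ 0 1 = b) (i10 : q⁻¹ 1 0 = b) (i11 : q⁻¹ 1 1 = d)
    (e00 : q 0 0 = d / (a * d - b ^ 2)) (e01 : q 0 1 = -b / (a * d - b ^ 2))
    (e10 : q 1 0 = -b / (a * d - b ^ 2)) (e11 : q 1 1 = a / (a * d - b ^ 2))
    (hK : K 1 0 = K 0 1) :
    dot2 q (K - (tr q K / 2) • q) (K - (tr q K / 2) • q) = dot2 q K K - tr q K ^ 2 / 2 := by
  simp only [dot2, tr, Fin.sum_univ_two, Matrix.sub_apply, Matrix.smul_apply, smul_eq_mul, i00, i01,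
    i10, i11, e00, e01, e10, e11, hK]
  field_simp
  ring

/-- With `t` the trace, expansion gives `K·K - t² + (t²/4) q^{AB} q_{AB}`, and `q^{AB} q_{AB} = 2`
in dimension two. -/
theorem MetricOn.dot2_traceFree {U : Set Pt} {q : Pt → Matrix (Fin 2) (Fin 2) ℝ} (M : MetricOn U q)
    {x : Pt} (hx : x ∈ U) {K : Matrix (Fin 2) (Fin 2) ℝ} (hK : K 1 0 = K 0 1) :
    dot2 (q x) (K - (tr (q x) K / 2) • q x) (K - (tr (q x) K / 2) • q x)
      = dot2 (q x) K K - tr (q x) K ^ 2 / 2 := by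
  obtain ⟨h0, e00, e01, e11⟩ := M.eq_inv_inv hx
  exact TwoSurf.dot2_traceFree h0 rfl rfl (M.inv_symm hx 1 0) rfl e00 e01
    ((M.symm x hx 1 0).trans e01) e11 hK

namespace IsGauge

variable {U : Set Pt} {g : Pt → Matrix (Fin 4) (Fin 4) ℝ} {Om nu : Pt → ℝ}
  (H : IsGauge U g Om nu) {x : Pt}

theorem gam_apply (A B : Fin 2) : gam g Om x A B = (Om x ^ 2)⁻¹ * gh g x A B := rfl

include H

theorem smooth_Om_at (hx : x ∈ U) : ContDiffAt ℝ ∞ Om x :=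
  H.smooth_Om.contDiffAt (H.isOpen.mem_nhds hx)

theorem Om_sq_ne (hx : x ∈ U) : Om x ^ 2 ≠ 0 := pow_ne_zero 2 (H.Om_ne x hx)

theorem gh_eq_smul (hx : x ∈ U) : gh g x = Om x ^ 2 • gam g Om x := by
  have h0 := H.Om_ne x hx
  ext A B
  simp only [gam, gam4, gh, Matrix.submatrix_apply, Matrix.smul_apply, smul_eq_mul]
  field_simp

theorem gam_metricOn : MetricOn U (gam g Om) where
  isOpen := H.isOpen
  smooth x hx A B := (((H.smooth_Om_at hx).pow 2).inv (H.Om_sq_ne hx)).mul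
    (H.splitOn.smooth x hx A B)
  symm x hx A B := by simp only [gam_apply, H.splitOn.symm x hx A B]
  det_ne x hx h := by
    have h1 := H.splitOn.det_ne x hx
    rw [H.gh_eq_smul hx, Matrix.det_smul, h, mul_zero] at h1
    exact h1 rfl

theorem smooth_lnOm2 (hx : x ∈ U) : ContDiffAt ℝ ∞ (lnOm2 Om) x :=
  ((H.smooth_Om_at hx).pow 2).log (H.Om_sq_ne hx)

theorem pd_lnOm2 (hx : x ∈ U) (a : Fin 4) : pd a (lnOm2 Om) x = 2 * pd a Om x / Om x := by
  have h0 := H.Om_ne x hx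
  unfold lnOm2
  rw [pd_log ((H.smooth_Om_at hx).pow 2) (H.Om_sq_ne hx), pd_pow_two (H.smooth_Om_at hx)]
  field_simp

theorem inv_gh (hx : x ∈ U) : (gh g x)⁻¹ = (Om x ^ 2)⁻¹ • (gam g Om x)⁻¹ := by
  rw [H.gh_eq_smul hx, ← Units.smul_mk0 (H.Om_sq_ne hx), Matrix.inv_smul' _ _
      (isUnit_iff_ne_zero.2 (H.gam_metricOn.det_ne x hx))]
  rfl

theorem pd_gh (hx : x ∈ U) (a : Fin 4) (A B : Fin 2) : pd a (fun y => gh g y A B) x =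
    2 * Om x * pd a Om x * gam g Om x A B + Om x ^ 2 * pd a (fun y => gam g Om y A B) x := by
  rw [pd_congr (g := fun y => Om y ^ 2 * gam g Om y A B) H.isOpen hx
    (fun y hy => by rw [H.gh_eq_smul hy]; rfl), pd_mul ((H.smooth_Om_at hx).pow 2)
    (H.gam_metricOn.smooth x hx A B), pd_pow_two (H.smooth_Om_at hx)]

theorem scalarCurv_gh (hx : x ∈ U) : scalarCurv lf (gh g) x =
    (Om x ^ 2)⁻¹ * (scalarCurv lf (gam g Om) x - laplacian lf (gam g Om) (lnOm2 Om) x) := by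
  refine scalarCurv_conformal (w := fun y => Om y ^ 2) H.gam_metricOn H.splitOn.toMetricOn
    (fun y hy => (H.smooth_Om_at hy).pow 2) (fun y hy => H.Om_sq_ne hy)
    (fun y hy => H.smooth_lnOm2 hy) (fun y hy a => ?_) (fun y hy => H.gh_eq_smul hy) hx
  have h0 := H.Om_ne y hy
  rw [H.pd_lnOm2 hy, pd_pow_two (H.smooth_Om_at hy)]
  field_simp

theorem sum_inv_gam_mul (hx : x ∈ U) : (gam g Om x)⁻¹ 0 0 * gam g Om x 0 0
    + (gam g Om x)⁻¹ 0 1 * gam g Om x 0 1 + ((gam g Om x)⁻¹ 1 0 * gam g Om x 1 0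
    + (gam g Om x)⁻¹ 1 1 * gam g Om x 1 1) = 2 := by
  have h0 := H.gam_metricOn.inv_mul_entry hx 0 0
  have h1 := H.gam_metricOn.inv_mul_entry hx 1 1
  rw [H.gam_metricOn.symm x hx 1 0] at *
  simp only [if_true] at h0 h1
  linear_combination h0 + h1

theorem LnOm_eq (hx : x ∈ U) : LnOm g Om x = nUp g x 0 * (2 * pd 0 Om x / Om x) := by
  rw [LnOm, H.lieFun_nUp hx, H.pd_lnOm2 hx]

/-- In the trace of `½ N⁻¹ ∂_τ (Ω² γ)` the gauge condition along `∂_τ` removes `∂_τ γ`; the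
dimension two cancels the factor `½`. -/
theorem trKK_eq (hx : x ∈ U) : trKK g x = LnOm g Om x := by
  have h0 := H.Om_ne x hx
  have hc := H.conf_tau x hx
  have ht := H.sum_inv_gam_mul hx
  simp only [Fin.sum_univ_two] at hc
  rw [H.LnOm_eq hx]
  simp only [trKK, tr, H.KK_eq hx, H.inv_gh hx, H.pd_gh hx, Fin.sum_univ_two, Matrix.smul_apply,
    smul_eq_mul]
  field_simp
  linear_combination (nUp g x 0 * Om x) * hc + 2 * nUp g x 0 * pd 0 Om x * ht

theorem lieFun_nhUp (hx : x ∈ U) (f : Pt → ℝ) : lieFun sp (nhUp g) f x =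
    (Nh g x)⁻¹ * (pd 1 f x - ∑ A, ShA g x A * pd (lf A) f x) := by
  have h0 := (H.Nh_pos hx).ne'
  simp only [lieFun, Fin.sum_univ_succ (n := 2), H.nhUp_zero hx, H.nhUp_succ hx, Fin.sum_univ_two,
    sp, lf, Fin.succ_zero_eq_one]
  field_simp
  ring

theorem trKh_eq_meanCurv (hx : x ∈ U) : trKh g x = meanCurv (Nh g) (ShA g) (gh g) x := by
  rw [trKh, meanCurv, H.Kh_eq hx]

/-- The gauge condition along `∂_ρ` removes the trace of `∂_ρ γ`. The Lie derivative of `γ` along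
the shift has trace `2 𝔻_k N̂^k`, and the derivatives of `Ω²` along `∂_ρ` and the shift combine into
`L_n̂`. -/
theorem trKh_eq (hx : x ∈ U) : trKh g x = lieFun sp (nhUp g) (lnOm2 Om) x
    - (Nh g x)⁻¹ * divVec lf (gam g Om) (ShA g) x := by
  have h0 := H.Om_ne x hx
  have hN := (H.Nh_pos hx).ne'
  have hc := H.conf_rho x hx
  have ht := H.sum_inv_gam_mul hx
  have r00 := H.gam_metricOn.inv_mul_entry hx 0 0
  have r01 := H.gam_metricOn.inv_mul_entry hx 0 1
  have r10 := H.gam_metricOn.inv_mul_entry hx 1 0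
  have r11 := H.gam_metricOn.inv_mul_entry hx 1 1
  have s := H.gam_metricOn.symm x hx 1 0
  have si := H.gam_metricOn.inv_symm hx 1 0
  have ge : ∀ A B, gh g x A B = Om x ^ 2 * gam g Om x A B := fun A B => by
    rw [H.gh_eq_smul hx]; rfl
  rw [H.lieFun_nhUp hx]
  simp only [trKh, tr, H.Kh_eq hx, extCurv, Matrix.of_apply, H.inv_gh hx, H.pd_gh hx,
    Fin.sum_univ_two, Matrix.smul_apply, smul_eq_mul, H.pd_lnOm2 hx, divVec, christoffel,
    ge, H.gam_metricOn.pd_symm hx _ 1 0]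
  simp only [Fin.sum_univ_two, s, si, H.gam_metricOn.pd_symm hx _ 1 0, if_true, zero_ne_one, one_ne_zero,
    if_false, Fin.isValue] at hc ht r00 r01 r10 r11 ⊢
  simp only [lf, Fin.succ_zero_eq_one, Fin.succ_one_eq_two, Fin.reduceSucc]
  field_simp
  linear_combination (Om x) * hc + 2 * (pd 1 Om x - ShA g x 0 * pd 2 Om x
      - ShA g x 1 * pd 3 Om x) * ht
    - 2 * Om x * (pd 2 (fun y => ShA g y 0) x * r00 + pd 2 (fun y => ShA g y 1) x * r01
      + pd 3 (fun y => ShA g y 0) x * r10 + pd 3 (fun y => ShA g y 1) x * r11)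

theorem hamiltonian_eq (hx : x ∈ U) (G : Pt → Matrix (Fin 4) (Fin 4) ℝ) :
    hamiltonian g G x = scalEq g Om G x := by
  have h0 := (H.Nh_pos hx).ne'
  have hKh : Kh g x 1 0 = Kh g x 0 1 := by rw [H.Kh_eq hx]; exact H.splitOn.extCurv_symm hx 1 0
  have t1 := H.splitOn.dot2_traceFree hx hKh
  have t2 := H.splitOn.dot2_traceFree hx (H.tensorSplitOn.symm_tangent x hx 1 0)
  have e1 : dot2 (gh g x) (Kh0 g x) (Kh0 g x) = _ := t1
  have e2 : dot2 (gh g x) (KK0 g x) (KK0 g x) = _ := t2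
  -- The bracket in (H) is the mean curvature on all of `U`, not only at `x`, so the two have the
  -- same derivatives.
  have e3 : lieFun sp (nhUp g) (fun y => lieFun sp (nhUp g) (lnOm2 Om) y
      - (Nh g y)⁻¹ * divVec lf (gam g Om) (ShA g) y) x =
      (Nh g x)⁻¹ * (pd 1 (meanCurv (Nh g) (ShA g) (gh g)) x
        - ∑ A, ShA g x A * pd (lf A) (meanCurv (Nh g) (ShA g) (gh g)) x) := by
    rw [H.lieFun_nhUp hx]
    simp only [fun a => pd_congr (a := a) (f := fun y => lieFun sp (nhUp g) (lnOm2 Om) y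
      - (Nh g y)⁻¹ * divVec lf (gam g Om) (ShA g) y) H.isOpen hx
      fun y hy => (H.trKh_eq hy).symm.trans (H.trKh_eq_meanCurv hy)]
  rw [hamiltonian, scalEq, H.splitOn.scalarCurv_split hx, H.scalarCurv_gh hx, H.tr_K3 hx,
    H.dot2_K3 hx, e1, e2, e3, ← H.Kh_eq hx, H.trKh_eq_meanCurv hx]
  simp only [meanCurv, ← H.Kh_eq hx, Fin.sum_univ_two, lf, Fin.succ_zero_eq_one,
    Fin.succ_one_eq_two, Fin.reduceSucc, trKK]
  ring

end IsGauge


/-! ### The momentum constraint. -/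

namespace MetricOn

variable {U : Set Pt} {q : Pt → Matrix (Fin 2) (Fin 2) ℝ} (M : MetricOn U q) {e : Fin 2 → Fin 4}
  {x : Pt}
include M

/-- By metric compatibility the divergence of `f q` is `df`. This passes from the divergence of `𝐊`
to that of its trace-free part. -/
theorem div2_sub_smul (hx : x ∈ U) {T : Pt → Matrix (Fin 2) (Fin 2) ℝ} {f : Pt → ℝ}
    (hT : ∀ i j, ContDiffAt ℝ ∞ (fun y => T y i j) x) (hf : ContDiffAt ℝ ∞ f x) (j : Fin 2) :
    div2 e q (fun y => T y - f y • q y) x j = div2 e q T x j - pd (e j) f x := by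
  have r0 := M.inv_mul_entry hx 0 j
  have r1 := M.inv_mul_entry hx 1 j
  have hd : pd (e j) f x = (if 0 = j then 1 else 0) * pd (e 0) f x
      + (if 1 = j then 1 else 0) * pd (e 1) f x := by
    fin_cases j <;> simp
  have key : ∀ a i j, pd a (fun y => (T y - f y • q y) i j) x = pd a (fun y => T y i j) x
      - (pd a f x * q x i j + f x * pd a (fun y => q y i j) x) := by
    intro a i j
    rw [← pd_mul hf (M.smooth x hx i j), ← pd_sub (hT i j) (hf.mul (M.smooth x hx i j))]
    rfl
  rw [hd, ← r0, ← r1]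
  simp only [div2, cov2, key]
  simp only [M.pd_metric hx, Matrix.sub_apply, Matrix.smul_apply, smul_eq_mul, Fin.sum_univ_two]
  fin_cases j <;>
  · simp only [Fin.zero_eta, Fin.mk_one, Fin.isValue, M.symm x hx 1 0, M.inv_symm hx 1 0]
    ring

theorem sum_inv_cov1_lower (hx : x ∈ U) {v : Pt → Fin 2 → ℝ}
    (hv : ∀ A, ContDiffAt ℝ ∞ (fun y => v y A) x) :
    ∑ A, ∑ B, (q x)⁻¹ A B * cov1 e q (fun y B => ∑ C, q y B C * v y C) x A B =
      divVec e q v x := by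
  have key : ∀ a B, pd a (fun y => ∑ C, q y B C * v y C) x =
      ∑ C, (pd a (fun y => q y B C) x * v x C + q x B C * pd a (fun y => v y C) x) := by
    intro a B
    rw [pd_sum _ fun C _ => (M.smooth x hx B C).mul (hv C)]
    exact Finset.sum_congr rfl fun C _ => pd_mul (M.smooth x hx B C) (hv C)
  have r00 := M.inv_mul_entry hx 0 0
  have r01 := M.inv_mul_entry hx 0 1
  have r10 := M.inv_mul_entry hx 1 0
  have r11 := M.inv_mul_entry hx 1 1
  simp only [cov1, key]
  simp only [M.pd_metric hx, divVec, Fin.sum_univ_two]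
  simp only [M.symm x hx 1 0, M.inv_symm hx 1 0, M.christoffel_symm hx _ 1 0, if_true, zero_ne_one,
    one_ne_zero, if_false, Fin.isValue] at r00 r01 r10 r11 ⊢
  set Γ := christoffel e q x
  linear_combination (pd (e 0) (fun y => v y 0) x + Γ 0 0 0 * v x 0 + Γ 0 0 1 * v x 1) * r00
    + (pd (e 0) (fun y => v y 1) x + Γ 1 0 0 * v x 0 + Γ 1 0 1 * v x 1) * r01
    + (pd (e 1) (fun y => v y 0) x + Γ 0 0 1 * v x 0 + Γ 0 1 1 * v x 1) * r10
    + (pd (e 1) (fun y => v y 1) x + Γ 1 0 1 * v x 0 + Γ 1 1 1 * v x 1) * r11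

end MetricOn

namespace IsGauge

variable {U : Set Pt} {g : Pt → Matrix (Fin 4) (Fin 4) ℝ} {Om nu : Pt → ℝ}
  (H : IsGauge U g Om nu) {x : Pt}
include H

theorem smooth_LnShA (hx : x ∈ U) (A : Fin 2) : ContDiffAt ℝ ∞ (fun y => LnShA g y A) x :=
  ((H.smooth_nUp_zero hx).mul (contDiffAt_pd (H.smooth_ShA hx A))).congr_of_eventuallyEq
    (Filter.eventuallyEq_of_mem (H.isOpen.mem_nhds hx) fun _ hy => H.LnShA_eq hy A)

theorem smooth_LnOm (hx : x ∈ U) : ContDiffAt ℝ ∞ (LnOm g Om) x :=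
  ((H.smooth_nUp_zero hx).mul (contDiffAt_pd (H.smooth_lnOm2 hx))).congr_of_eventuallyEq
    (Filter.eventuallyEq_of_mem (H.isOpen.mem_nhds hx) fun _ hy => H.lieFun_nUp hy _)

theorem kkUp_eq (hx : x ∈ U) (A : Fin 2) : kkUp g x A = LnShA g x A / (2 * Nh g x) := by
  have h0 := (H.Nh_pos hx).ne'
  have r0 := H.splitOn.inv_mul_entry hx A 0
  have r1 := H.splitOn.inv_mul_entry hx A 1
  have hd : LnShA g x A = (if A = 0 then 1 else 0) * LnShA g x 0
      + (if A = 1 then 1 else 0) * LnShA g x 1 := by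
    fin_cases A <;> simp
  rw [hd, ← r0, ← r1]
  simp only [kkUp, H.kk_eq hx, Fin.sum_univ_two]
  ring

/-- Since `n̂_i` is `N̂ dρ`, its derivative with a surface index is `-N̂ Γ^ρ_{lA}`, and contracting
`l` with `n̂` gives a component found in `perp_entry`. -/
theorem acc_eq (hx : x ∈ U) (A : Fin 2) : acc g x A = -pd (lf A) (Nh g) x / Nh g x := by
  have h0 := (H.Nh_pos hx).ne'
  obtain ⟨-, X01, -, -⟩ := H.splitOn.perp_entry hx _ fun _ _ => rfl
  have hs : ∀ l, cov1 sp (h3 g) (nhDn g) x l A.succ = -(christoffel sp (h3 g) x 0 l A.succ * Nh g x) := by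
    intro l
    simp [cov1, nhDn, pd_const]
  have := X01 A
  simp only [acc, hs, Fin.sum_univ_succ (n := 2), H.nhUp_zero hx, H.nhUp_succ hx]
  simp only [Fin.sum_univ_two] at this ⊢
  field_simp at this ⊢
  linear_combination -this

/-- Differentiating the factor `N̂⁻¹` of `n̂` in the commutator yields a multiple of `n̂`, which
`γ̂` annihilates; hence no derivative of `N̂` survives. -/
theorem sum_gh3_lieVec (hx : x ∈ U) (A : Fin 2) :
    ∑ j, gh3 g x A.succ j * lieVec sp (nhUp g) (LnSh g) x j =
      (Nh g x)⁻¹ * ∑ B, gh g x A B * (pd 1 (fun y => LnShA g y B) x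
        - ∑ C, ShA g x C * pd (lf C) (fun y => LnShA g y B) x
        + ∑ C, LnShA g x C * pd (lf C) (fun y => ShA g y B) x) := by
  have h0 := (H.Nh_pos hx).ne'
  have hN := H.smooth_Nh hx
  have hb := H.smooth_ShA hx
  have g1 : gh3 g x A.succ 0 = ∑ B, gh g x A B * ShA g x B := H.gh3_succ_zero hx A
  have d0 : ∀ a, pd a (fun y => LnSh g y 0) x = 0 := by
    intro a
    rw [pd_congr H.isOpen hx fun y hy => H.LnSh_zero hy, pd_const]
  have e1 : ∀ (y : Pt) (B : Fin 2), LnSh g y B.succ = LnShA g y B := fun _ _ => rfl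
  have e2 : ∀ B : Fin 2, gh3 g x A.succ B.succ = gh g x A B := fun _ => rfl
  simp only [lieVec, Fin.sum_univ_succ (n := 2), g1, d0, e1, e2, H.LnSh_zero hx, H.nhUp_zero hx,
    H.nhUp_succ hx, H.pd_nhUp_zero hx, H.pd_nhUp_succ hx]
  simp only [Fin.sum_univ_two, sp, lf, Fin.succ_zero_eq_one, Fin.succ_one_eq_two, Fin.reduceSucc]
  field_simp
  ring

theorem pd_kk (hx : x ∈ U) (a : Fin 4) (A : Fin 2) : pd a (fun y => kk g y A) x =
    (∑ B, (pd a (fun y => gh g y A B) x * LnShA g x B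
      + gh g x A B * pd a (fun y => LnShA g y B) x)) / (2 * Nh g x)
    - kk g x A * pd a (Nh g) x / Nh g x := by
  have h0 := (H.Nh_pos hx).ne'
  have hN := H.smooth_Nh hx
  have hq := H.splitOn.smooth x hx
  have hu := H.smooth_LnShA hx
  have hm : ∀ B, ContDiffAt ℝ ∞ (fun y => gh g y A B * LnShA g y B) x := fun B => (hq A B).mul (hu B)
  rw [pd_congr H.isOpen hx fun y hy => H.kk_eq hy A, pd_div (ContDiffAt.sum fun B _ => hm B)
    (contDiffAt_const.mul hN) (mul_ne_zero two_ne_zero h0), pd_sum _ fun B _ => hm B,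
    pd_mul contDiffAt_const hN, pd_const, H.kk_eq hx]
  simp only [pd_mul (hq A _) (hu _)]
  field_simp
  ring

theorem pd_tr_K3 (hx : x ∈ U) (a : Fin 4) : pd a (fun y => tr (h3 g y) (K3 g y)) x =
    pd a (kap g) x + pd a (LnOm g Om) x := by
  rw [← pd_add (H.tensorSplitOn.smooth_normal x hx) (H.smooth_LnOm hx)]
  exact pd_congr H.isOpen hx fun y hy => by rw [H.tr_K3 hy, H.trKK_eq hy]

theorem pd_log_Nh (hx : x ∈ U) (a : Fin 4) :
    pd a (fun y => Real.log (Nh g y)) x = pd a (Nh g) x / Nh g x :=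
  pd_log (H.smooth_Nh hx) (H.Nh_pos hx).ne'

/-- The half gradient found here, combined with the full gradient of `L_n ln Ω²` in the derivative
of the trace of `K`, leaves the coefficient `-½` in (P). -/
theorem div2_KK0 (hx : x ∈ U) (A : Fin 2) : div2 lf (gh g) (KK0 g) x A =
    div2 lf (gh g) (KK g) x A - pd (lf A) (LnOm g Om) x / 2 := by
  have ht : ContDiffAt ℝ ∞ (fun y => trKK g y / 2) x :=
    ((H.smooth_LnOm hx).div_const 2).congr_of_eventuallyEq
      (Filter.eventuallyEq_of_mem (H.isOpen.mem_nhds hx) fun y hy => by simp only [H.trKK_eq hy])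
  have h := H.splitOn.div2_sub_smul (e := lf) hx (H.tensorSplitOn.smooth_tangent x hx) ht A
  rw [pd_congr (g := fun y => LnOm g Om y / 2) H.isOpen hx fun y hy => by rw [H.trKK_eq hy],
    pd_div (H.smooth_LnOm hx) contDiffAt_const two_ne_zero, pd_const] at h
  have : div2 lf (gh g) (KK0 g) x A = _ := h
  rw [this]
  ring

/-- Writing `k_A` through `L_n N̂^B` turns its normal derivative into the term `L_n̂ (L_n N̂^j)`.
The derivative of the lowering metric `γ̂` accounts for `2 K̂_{AB} k^B`, that of `1/N̂` for the
`L_n̂ (ln N̂)` term. -/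
theorem momentum_surf (hx : x ∈ U) (G : Pt → Matrix (Fin 4) (Fin 4) ℝ) (A : Fin 2) :
    momentum g G x A.succ = parEq g Om G x A := by
  have h0 := (H.Nh_pos hx).ne'
  have hp : ∑ l, pSrc g G x l * ghMixed g x l A.succ = pSrc g G x A.succ := by
    simp [ghMixed, nhDn]
  rw [momentum, parEq, hp, H.tensorSplitOn.div2_surf H.splitOn hx, H.pd_tr_K3 hx, H.div2_KK0 hx,
    H.sum_gh3_lieVec hx, H.lieFun_nhUp hx, H.trKh_eq_meanCurv hx]
  simp only [H.pd_kk hx, H.acc_eq hx, H.kkUp_eq hx, H.pd_log_Nh hx, H.Kh_eq hx, extCurv,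
    Matrix.of_apply, H.kk_eq hx]
  simp only [Fin.sum_univ_two, lf, sp]
  simp only [H.splitOn.symm x hx 1 0, Fin.succ_zero_eq_one, Fin.succ_one_eq_two, Fin.reduceSucc]
  field_simp
  ring

theorem momentum_normal (hx : x ∈ U) (G : Pt → Matrix (Fin 4) (Fin 4) ℝ) :
    ∑ j, nhUp g x j * momentum g G x j = ortEq g Om G x := by
  have h0 := (H.Nh_pos hx).ne'
  have hN := H.smooth_Nh hx
  have hu := H.smooth_LnShA hx
  have hv : ∀ A, ContDiffAt ℝ ∞ (fun y => LnShA g y A / (2 * Nh g y)) x := fun A =>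
    (hu A).div (contDiffAt_const.mul hN) (mul_ne_zero two_ne_zero h0)
  have h1 := H.tensorSplitOn.div2_normal H.splitOn hx
  have h2 := H.splitOn.sum_inv_cov1_lower (e := lf) hx hv
  have h3' : ∀ A B, cov1 lf (gh g) (fun y B => ∑ C, gh g y B C * (LnShA g y C / (2 * Nh g y))) x A B
      = cov1 lf (gh g) (kk g) x A B := by
    have e : ∀ y ∈ U, ∀ B, ∑ C, gh g y B C * (LnShA g y C / (2 * Nh g y)) = kk g y B := by
      intro y hy B
      rw [H.kk_eq hy, Finset.sum_div]
      exact Finset.sum_congr rfl fun C _ => by ring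
    intro A B
    simp only [cov1, e x hx, fun a B => pd_congr (a := a) H.isOpen hx fun y hy => e y hy B]
  -- The quotient rule contributes `-k^A ∂_A ln N̂`. It cancels one of the two copies of this term
  -- in `div2_normal`, leaving the single one in (O).
  have h4 : divVec lf (gh g) (fun y A => LnShA g y A / (2 * Nh g y)) x =
      (2 * Nh g x)⁻¹ * divVec lf (gh g) (LnShA g) x
      - ∑ A, LnShA g x A * pd (lf A) (Nh g) x / (2 * Nh g x ^ 2) := by
    simp only [divVec, fun a A => pd_div (a := a) (hu A) (contDiffAt_const.mul hN)
      (mul_ne_zero two_ne_zero h0), pd_mul contDiffAt_const hN, pd_const, Fin.sum_univ_two]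
    field_simp
    ring
  have h5 : ∑ A, ∑ B, (gh g x)⁻¹ A B * kk g x A * pd (lf B) (Nh g) x =
      ∑ A, LnShA g x A / (2 * Nh g x) * pd (lf A) (Nh g) x := by
    simp only [← H.kkUp_eq hx, kkUp, Fin.sum_univ_two, H.splitOn.inv_symm hx 1 0]
    ring
  simp only [h3', h4] at h2
  rw [h2, h5] at h1
  rw [ortEq, H.lieFun_nhUp hx, H.trKh_eq_meanCurv hx, H.Kh_eq hx]
  simp only [momentum, H.pd_tr_K3 hx, H.kkUp_eq hx, H.pd_log_Nh hx, Fin.sum_univ_succ (n := 2),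
    H.nhUp_zero hx, H.nhUp_succ hx]
  simp only [Fin.sum_univ_two, lf, sp, Fin.succ_zero_eq_one, Fin.succ_one_eq_two,
    Fin.reduceSucc] at h1 ⊢
  field_simp at h1 ⊢
  linear_combination h1

theorem constraints_iff (hx : x ∈ U) (G : Pt → Matrix (Fin 4) (Fin 4) ℝ) :
    (hamiltonian g G x = 0 ↔ scalEq g Om G x = 0) ∧
      ((∀ j, momentum g G x j = 0) ↔ (∀ A, parEq g Om G x A = 0) ∧ ortEq g Om G x = 0) := by
  have h0 := (H.Nh_pos hx).ne'
  refine ⟨by rw [H.hamiltonian_eq hx], fun h => ⟨fun A => ?_, ?_⟩, fun ⟨h1, h2⟩ => ?_⟩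
  · rw [← H.momentum_surf hx, h]
  · rw [← H.momentum_normal hx]; simp [h]
  · have hs : ∀ A : Fin 2, momentum g G x A.succ = 0 := fun A => by rw [H.momentum_surf hx, h1]
    -- With zero tangential components the normal contraction is `N̂⁻¹` times the `ρ` component.
    refine Fin.cases ?_ hs
    rw [← H.momentum_normal hx, Fin.sum_univ_succ] at h2
    simpa [hs, H.nhUp_zero hx, h0] using h2

end IsGauge


/-! ## Functions of jets -/

/-- 1-jets of a surface metric along the surface. -/
abbrev MetJet : Type := Arr × (Fin 2 → Arr)

/-- 1-jets of `(Ω, γ_{AB}, N̂, N̂^A)` along `Σ_τ`. -/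
abbrev VarJet : Type := Var × (Fin 3 → Var)

/-- The inverse of a surface metric. -/
def invArr (q : Arr) : Arr := fun A B => (Matrix.of q)⁻¹ A B

/-- Christoffel symbols as a function of the 1-jet of the metric. -/
def chrArr (p : MetJet) (k i j : Fin 2) : ℝ :=
  (1 / 2) * ∑ l, invArr p.1 k l * (p.2 i j l + p.2 j i l - p.2 l i j)

/-- The vector `curvVec` as a function of the 1-jet of the metric. -/
def curvArr (p : MetJet) (k : Fin 2) : ℝ :=
  ∑ i, ∑ j, invArr p.1 i j * chrArr p k i j - ∑ i, invArr p.1 k i * ∑ j, chrArr p j i j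

/-- The scalar curvature as a function of the 2-jet of the metric. -/
def scalArr (p : MetJet) (dd : Fin 2 → Fin 2 → Arr) : ℝ :=
  ∑ k, fderiv ℝ curvArr p (p.2 k, dd k) k + curvQuad (invArr p.1) (chrArr p)

section Smooth

variable {E : Type} [NormedAddCommGroup E] [NormedSpace ℝ E] {z : E}

theorem contDiffAt_entry {q : E → Arr} (hq : ContDiffAt ℝ ∞ q z) (A B : Fin 2) :
    ContDiffAt ℝ ∞ (fun y => q y A B) z :=
  contDiffAt_pi.1 (contDiffAt_pi.1 hq A) B

theorem contDiffAt_arr {q : E → Arr} (hq : ∀ A B, ContDiffAt ℝ ∞ (fun y => q y A B) z) :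
    ContDiffAt ℝ ∞ q z :=
  contDiffAt_pi.2 fun A => contDiffAt_pi.2 fun B => hq A B

theorem contDiffAt_invArr {q : E → Arr} (hq : ContDiffAt ℝ ∞ q z) (h0 : (Matrix.of (q z)).det ≠ 0)
    (A B : Fin 2) : ContDiffAt ℝ ∞ (fun y => invArr (q y) A B) z :=
  contDiffAt_matrix_inv (q := fun y => Matrix.of (q y)) (contDiffAt_entry hq) h0 A B

theorem contDiffAt_chrArr {p : MetJet} (h0 : (Matrix.of p.1).det ≠ 0) (k i j : Fin 2) :
    ContDiffAt ℝ ∞ (fun p => chrArr p k i j) p := by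
  have h := contDiffAt_invArr (q := fun p : MetJet => p.1) contDiffAt_fst h0
  unfold chrArr
  fun_prop

theorem contDiffAt_chrArr_map {p : MetJet} (h0 : (Matrix.of p.1).det ≠ 0) :
    ContDiffAt ℝ ∞ chrArr p :=
  contDiffAt_pi.2 fun k => contDiffAt_arr (contDiffAt_chrArr h0 k)

theorem contDiffAt_curvArr {p : MetJet} (h0 : (Matrix.of p.1).det ≠ 0) :
    ContDiffAt ℝ ∞ curvArr p := by
  have h := contDiffAt_invArr (q := fun p : MetJet => p.1) contDiffAt_fst h0
  have h1 := contDiffAt_chrArr h0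
  refine contDiffAt_pi.2 fun k => ?_
  unfold curvArr
  fun_prop

/-- Joint smoothness in base point and direction. This is why second derivatives may be fed into
universal functions through `fderiv` without expanding the chain rule. -/
theorem contDiffAt_fderiv_apply {V W : Type} [NormedAddCommGroup V] [NormedSpace ℝ V]
    [NormedAddCommGroup W] [NormedSpace ℝ W] {f : V → W} {p v : E → V}
    (hf : ContDiffAt ℝ ∞ f (p z)) (hp : ContDiffAt ℝ ∞ p z) (hv : ContDiffAt ℝ ∞ v z) :
    ContDiffAt ℝ ∞ (fun y => fderiv ℝ f (p y) (v y)) z :=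
  ContDiffAt.clm_apply ((hf.fderiv_right (m := ∞) (by simp)).comp z hp) hv

theorem contDiffAt_scalArr {p : E → MetJet} {dd : E → Fin 2 → Fin 2 → Arr}
    (h0 : (Matrix.of (p z).1).det ≠ 0) (hp : ContDiffAt ℝ ∞ p z) (hd : ContDiffAt ℝ ∞ dd z) :
    ContDiffAt ℝ ∞ (fun y => scalArr (p y) (dd y)) z := by
  have h := contDiffAt_invArr (q := fun y => (p y).1) hp.fst h0
  have h1 : ∀ k i j, ContDiffAt ℝ ∞ (fun y => chrArr (p y) k i j) z :=
    fun k i j => (contDiffAt_chrArr h0 k i j).comp z hp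
  have h2 : ∀ k, ContDiffAt ℝ ∞ (fun y => fderiv ℝ curvArr (p y) ((p y).2 k, dd y k) k) z :=
    fun k => contDiffAt_pi.1 (contDiffAt_fderiv_apply (contDiffAt_curvArr h0) hp (by fun_prop)) k
  unfold scalArr curvQuad
  fun_prop

theorem contDiffAt_dot1 {q : E → Arr} {v w : E → Fin 2 → ℝ} (hq : ContDiffAt ℝ ∞ q z)
    (h0 : (Matrix.of (q z)).det ≠ 0) (hv : ContDiffAt ℝ ∞ v z) (hw : ContDiffAt ℝ ∞ w z) :
    ContDiffAt ℝ ∞ (fun y => dot1 (Matrix.of (q y)) (v y) (w y)) z := by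
  have h := contDiffAt_invArr hq h0
  change ContDiffAt ℝ ∞ (fun y => ∑ A, ∑ B, invArr (q y) A B * v y A * w y B) z
  fun_prop

theorem contDiffAt_dot2 {q S T : E → Arr} (hq : ContDiffAt ℝ ∞ q z)
    (h0 : (Matrix.of (q z)).det ≠ 0) (hS : ContDiffAt ℝ ∞ S z) (hT : ContDiffAt ℝ ∞ T z) :
    ContDiffAt ℝ ∞ (fun y => dot2 (Matrix.of (q y)) (Matrix.of (S y)) (Matrix.of (T y))) z := by
  have h := contDiffAt_invArr hq h0
  change ContDiffAt ℝ ∞ (fun y => ∑ i, ∑ j, ∑ k, ∑ l,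
    invArr (q y) i k * invArr (q y) j l * S y i j * T y k l) z
  fun_prop

end Smooth

/-- The 1-jet of `γ_{AB}` along the surface. -/
def jetGam (J : VarJet) : MetJet := (J.1.2.1, fun A => (J.2 A.succ).2.1)

/-- `γ̂_{AB} = Ω² γ_{AB}`. -/
def jetGh (J : VarJet) : Arr := fun A B => J.1.1 ^ 2 * J.1.2.1 A B

/-- The derivatives of `γ̂_{AB} = Ω² γ_{AB}` along `Σ_τ`. -/
def jetDGh (J : VarJet) (i : Fin 3) : Arr := fun A B =>
  2 * J.1.1 * (J.2 i).1 * J.1.2.1 A B + J.1.1 ^ 2 * (J.2 i).2.1 A B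

/-- The Christoffel symbols of `γ̂_{AB}`. -/
def jetChr (J : VarJet) : Fin 2 → Fin 2 → Fin 2 → ℝ := chrArr (jetGh J, fun A => jetDGh J A.succ)

/-- The divergence `𝔻_A N̂^A`. -/
def jetDiv (J : VarJet) : ℝ :=
  ∑ A : Fin 2, (J.2 A.succ).2.2.2 A + ∑ k, ∑ l, chrArr (jetGam J) k k l * J.1.2.2.2 l

/-- `N̂ K̂^l_l`. -/
def jetMean (J : VarJet) : ℝ :=
  2 / J.1.1 * ((J.2 0).1 - ∑ A : Fin 2, J.1.2.2.2 A * (J.2 A.succ).1) - jetDiv J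

/-- `K̂_{AB}`. -/
def jetKh (J : VarJet) : Arr := fun A B => (1 / (2 * J.1.2.2.1)) * (jetDGh J 0 A B
  - ∑ C : Fin 2, (J.1.2.2.2 C * jetDGh J C.succ A B + jetGh J C B * (J.2 A.succ).2.2.2 C
    + jetGh J A C * (J.2 B.succ).2.2.2 C))

section Smooth

variable {J : VarJet}

theorem contDiffAt_jetGam : ContDiffAt ℝ ∞ jetGam J := by
  unfold jetGam; fun_prop

theorem contDiffAt_jetGh : ContDiffAt ℝ ∞ jetGh J := by
  unfold jetGh; fun_prop

theorem contDiffAt_jetDGh : ContDiffAt ℝ ∞ jetDGh J := by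
  unfold jetDGh; fun_prop

theorem det_jetGh_ne (h : J.1 ∈ varDom) : (Matrix.of (jetGh J)).det ≠ 0 := by
  have : (Matrix.of (jetGh J)).det = J.1.1 ^ 4 * (Matrix.of J.1.2.1).det := by
    simp only [jetGh, Matrix.det_fin_two, Matrix.of_apply]; ring
  rw [this]
  exact mul_ne_zero (pow_ne_zero 4 h.1) h.2.1

theorem contDiffAt_jetChr (h : J.1 ∈ varDom) : ContDiffAt ℝ ∞ jetChr J := by
  have h1 := contDiffAt_jetGh (J := J)
  have h2 := contDiffAt_jetDGh (J := J)
  exact (contDiffAt_chrArr_map (p := (jetGh J, fun A => jetDGh J A.succ)) (det_jetGh_ne h)).comp J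
    (f := fun J => (jetGh J, fun A : Fin 2 => jetDGh J A.succ)) (by fun_prop)

theorem contDiffAt_chr_jetGam (h : J.1 ∈ varDom) :
    ContDiffAt ℝ ∞ (fun J => chrArr (jetGam J)) J :=
  (contDiffAt_chrArr_map (p := jetGam J) h.2.1).comp J contDiffAt_jetGam

theorem contDiffAt_jetDiv (h : J.1 ∈ varDom) : ContDiffAt ℝ ∞ jetDiv J := by
  have := contDiffAt_chr_jetGam h
  unfold jetDiv; fun_prop

theorem contDiffAt_jetMean (h : J.1 ∈ varDom) : ContDiffAt ℝ ∞ jetMean J := by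
  have := contDiffAt_jetDiv h
  have h0 := h.1
  unfold jetMean; fun_prop (disch := assumption)

theorem contDiffAt_jetKh (h : J.1 ∈ varDom) : ContDiffAt ℝ ∞ jetKh J := by
  have h1 := contDiffAt_jetGh (J := J)
  have h2 := contDiffAt_jetDGh (J := J)
  have h0 : 2 * J.1.2.2.1 ≠ 0 := mul_ne_zero two_ne_zero h.2.2
  unfold jetKh; fun_prop (disch := assumption)

end Smooth


/-! ### Evaluating jet functions on a metric in the gauge. -/

section Components

variable {a : Fin 4} {x : Pt}

theorem pd_comp {V W : Type} [NormedAddCommGroup V] [NormedSpace ℝ V] [NormedAddCommGroup W]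
    [NormedSpace ℝ W] {F : V → W} {j : Pt → V} (hF : ContDiffAt ℝ ∞ F (j x))
    (hj : ContDiffAt ℝ ∞ j x) : pd a (fun y => F (j y)) x = fderiv ℝ F (j x) (pd a j x) := by
  unfold pd
  rw [HasFDerivAt.fderiv (f := fun y => F (j y)) 
    ((hF.differentiableAt (by simp)).hasFDerivAt.comp x hj.diff.hasFDerivAt)]
  rfl

theorem pd_vec {b : Pt → Fin 2 → ℝ} (hb : ∀ A, ContDiffAt ℝ ∞ (fun y => b y A) x) :
    pd a b x = fun A => pd a (fun y => b y A) x :=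
  funext fun A => pd_pi (contDiffAt_pi.2 hb) A

theorem pd_arr {q : Pt → Arr} (hq : ∀ A B, ContDiffAt ℝ ∞ (fun y => q y A B) x) :
    pd a q x = fun A B => pd a (fun y => q y A B) x := by
  funext A
  rw [pd_pi (contDiffAt_arr hq) A]
  exact pd_vec (hq A)

end Components

/-- `γ_{AB}` as a plain array. -/
def gamArr (g : Pt → Matrix (Fin 4) (Fin 4) ℝ) (Om : Pt → ℝ) (x : Pt) : Arr :=
  fun A B => gam g Om x A B

/-- The 1-jet of `(Ω, γ_{AB}, N̂, N̂^A)`, with arbitrary values in place of the derivatives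
of `N̂`. -/
def varJet (g : Pt → Matrix (Fin 4) (Fin 4) ℝ) (Om : Pt → ℝ) (nd : Fin 3 → ℝ) (x : Pt) : VarJet :=
  (vars g Om x, fun i => (pd (sp i) Om x, fun A B => pd (sp i) (fun y => gam g Om y A B) x, nd i,
    fun A => pd (sp i) (fun y => ShA g y A) x))

section VarJet

variable (g : Pt → Matrix (Fin 4) (Fin 4) ℝ) (Om : Pt → ℝ) (nd : Fin 3 → ℝ) (x : Pt)

theorem varJet_fst : (varJet g Om nd x).1 = (Om x, gamArr g Om x, Nh g x, ShA g x) := rfl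

theorem varJet_snd (i : Fin 3) : (varJet g Om nd x).2 i =
    (pd (sp i) Om x, fun A B => pd (sp i) (fun y => gam g Om y A B) x, nd i,
      fun A => pd (sp i) (fun y => ShA g y A) x) := rfl

end VarJet

namespace IsGauge

variable {U : Set Pt} {g : Pt → Matrix (Fin 4) (Fin 4) ℝ} {Om nu : Pt → ℝ}
  (H : IsGauge U g Om nu) {x : Pt}
include H

theorem vars_mem (hx : x ∈ U) : vars g Om x ∈ varDom :=
  ⟨H.Om_ne x hx, H.gam_metricOn.det_ne x hx, (H.Nh_pos hx).ne'⟩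

theorem smooth_gam (hx : x ∈ U) (A B : Fin 2) : ContDiffAt ℝ ∞ (fun y => gam g Om y A B) x :=
  H.gam_metricOn.smooth x hx A B

theorem smooth_gam_arr (hx : x ∈ U) : ContDiffAt ℝ ∞ (gamArr g Om) x :=
  contDiffAt_arr (H.smooth_gam hx)

theorem smooth_ShA_vec (hx : x ∈ U) : ContDiffAt ℝ ∞ (ShA g) x :=
  contDiffAt_pi.2 (H.smooth_ShA hx)

theorem pd_gam (hx : x ∈ U) (a : Fin 4) : pd a (gamArr g Om) x =
    fun A B => pd a (fun y => gam g Om y A B) x :=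
  pd_arr (H.smooth_gam hx)

theorem pd_ShA (hx : x ∈ U) (a : Fin 4) : pd a (ShA g) x = fun A => pd a (fun y => ShA g y A) x :=
  pd_vec (H.smooth_ShA hx)

theorem pd_pd_gam (hx : x ∈ U) (a b : Fin 4) :
    pd a (pd b (gamArr g Om)) x =
      fun A B => pd a (pd b (fun y => gam g Om y A B)) x := by
  rw [pd_congr H.isOpen hx fun y hy => H.pd_gam hy b]
  exact pd_arr fun A B => contDiffAt_pd (H.smooth_gam hx A B)

theorem pd_pd_ShA (hx : x ∈ U) (a b : Fin 4) : pd a (pd b (ShA g)) x =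
    fun A => pd a (pd b (fun y => ShA g y A)) x := by
  rw [pd_congr H.isOpen hx fun y hy => H.pd_ShA hy b]
  exact pd_vec fun A => contDiffAt_pd (H.smooth_ShA hx A)

theorem gh_eq_jet (hx : x ∈ U) (nd : Fin 3 → ℝ) : gh g x = Matrix.of (jetGh (varJet g Om nd x)) :=
  H.gh_eq_smul hx

theorem pd_gh_eq_jet (hx : x ∈ U) (nd : Fin 3 → ℝ) (i : Fin 3) (A B : Fin 2) :
    pd (sp i) (fun y => gh g y A B) x = jetDGh (varJet g Om nd x) i A B :=
  H.pd_gh hx _ A B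

theorem christoffel_gh_eq_jet (hx : x ∈ U) (nd : Fin 3 → ℝ) (k i j : Fin 2) :
    christoffel lf (gh g) x k i j = jetChr (varJet g Om nd x) k i j := by
  have h : ∀ A i j, pd (lf A) (fun y => gh g y i j) x = jetDGh (varJet g Om nd x) A.succ i j :=
    fun A => H.pd_gh_eq_jet hx nd A.succ
  simp only [christoffel, h, H.gh_eq_jet hx nd]
  rfl

omit H in
theorem divVec_eq_jet (nd : Fin 3 → ℝ) :
    divVec lf (gam g Om) (ShA g) x = jetDiv (varJet g Om nd x) := rfl

/-- The placeholder `nd` is arbitrary because `jetMean` never reads the derivatives of `N̂`. That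
`N̂ K̂^l_l` is free of them is what makes the parabolic reading possible. -/
theorem trKh_eq_jet (hx : x ∈ U) (nd : Fin 3 → ℝ) :
    trKh g x = (Nh g x)⁻¹ * jetMean (varJet g Om nd x) := by
  rw [H.trKh_eq hx, H.lieFun_nhUp hx, divVec_eq_jet nd, jetMean]
  simp only [H.pd_lnOm2 hx, varJet, vars, Fin.sum_univ_two]
  simp only [sp, lf, Fin.succ_zero_eq_one, Fin.succ_one_eq_two, Fin.reduceSucc]
  ring

theorem Kh_eq_jet (hx : x ∈ U) (nd : Fin 3 → ℝ) :
    Kh g x = Matrix.of (jetKh (varJet g Om nd x)) := by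
  have h : ∀ A i j, pd (lf A) (fun y => gh g y i j) x = jetDGh (varJet g Om nd x) A.succ i j :=
    fun A => H.pd_gh_eq_jet hx nd A.succ
  have h1 : ∀ i j, pd 1 (fun y => gh g y i j) x = jetDGh (varJet g Om nd x) 0 i j :=
    H.pd_gh_eq_jet hx nd 0
  rw [H.Kh_eq hx]
  simp only [extCurv, h, h1, H.gh_eq_jet hx nd]
  rfl

theorem jet1_vars (hx : x ∈ U) :
    jet1 (vars g Om) x = varJet g Om (fun i => pd (sp i) (Nh g) x) x := by
  have h1 := H.smooth_Nh hx
  have h2 := H.smooth_ShA_vec hx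
  have h3 := H.smooth_gam_arr hx
  refine Prod.ext rfl (funext fun i => ?_)
  -- `vars` stores `γ` as a plain array; naming it `gamArr` lets the rule for pairs apply slot by
  -- slot.
  change pd (sp i) (fun y => (Om y, gamArr g Om y, Nh g y, ShA g y)) x = _
  rw [pd_fst (H.smooth_Om_at hx) (h3.prodMk (h1.prodMk h2)), pd_fst h3 (h1.prodMk h2),
    pd_fst h1 h2, H.pd_gam hx, H.pd_ShA hx]
  rfl

theorem LnGam_eq (hx : x ∈ U) (A B : Fin 2) :
    LnGam g Om x A B = nUp g x 0 * pd 0 (fun y => gam g Om y A B) x := by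
  refine H.lieTen_nUp hx (gam4 g Om) (fun i => ?_) (fun i => ?_) A.succ B.succ
  · simp [gam4, H.gh4_zero_succ hx]
  · simp [gam4, H.gh4_succ_zero hx]

theorem KK_eq_LnGam (hx : x ∈ U) (A B : Fin 2) : KK g x A B =
    1 / 2 * Om x ^ 2 * LnGam g Om x A B + LnOm g Om x / 2 * gh g x A B := by
  have := H.Om_ne x hx
  rw [H.KK_eq hx, H.pd_gh hx, H.LnGam_eq hx, H.LnOm_eq hx, H.gh_eq_smul hx]
  simp only [Matrix.smul_apply, smul_eq_mul]
  field_simp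
  ring

/-- The gauge makes `L_n γ` trace-free, so it carries the trace-free part of `𝐊` while `L_n ln Ω²`
carries the trace. Thus the divergence of `𝐊°` in (P) contains no derivative of `u`. -/
theorem KK0_eq (hx : x ∈ U) (A B : Fin 2) :
    KK0 g x A B = 1 / 2 * Om x ^ 2 * LnGam g Om x A B := by
  simp only [KK0, Matrix.sub_apply, Matrix.smul_apply, smul_eq_mul, H.KK_eq_LnGam hx,
    H.trKK_eq hx]
  ring

theorem smooth_LnGam (hx : x ∈ U) (A B : Fin 2) : ContDiffAt ℝ ∞ (fun y => LnGam g Om y A B) x :=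
  ((H.smooth_nUp_zero hx).mul (contDiffAt_pd (H.smooth_gam hx A B))).congr_of_eventuallyEq
    (Filter.eventuallyEq_of_mem (H.isOpen.mem_nhds hx) fun _ hy => H.LnGam_eq hy A B)

theorem smooth_LnNh (hx : x ∈ U) : ContDiffAt ℝ ∞ (LnNh g) x :=
  ((H.smooth_nUp_zero hx).mul (contDiffAt_pd (H.smooth_Nh hx))).congr_of_eventuallyEq
    (Filter.eventuallyEq_of_mem (H.isOpen.mem_nhds hx) fun _ hy => H.lieFun_nUp hy _)

end IsGauge


/-! ### The symmetric hyperbolic system. -/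

/-- `𝐊°_{AB} = ½ Ω² L_n γ_{AB}`. -/
def hypKK0 (j : HypArg) : Arr := fun A B => 1 / 2 * j.1.1.1 ^ 2 * j.2.1.1.2 A B

/-- The derivatives of `𝐊°_{AB}` along the surface. -/
def hypDKK0 (j : HypArg) (C : Fin 2) : Arr := fun A B =>
  j.1.1.1 * (j.1.2 C.succ).1 * j.2.1.1.2 A B + 1 / 2 * j.1.1.1 ^ 2 * (j.2.1.2 C).2 A B

/-- `𝐊_{AB}`. -/
def hypKK (j : HypArg) : Arr := fun A B =>
  hypKK0 j A B + j.2.2.1 (Sum.inr ()) / 2 * jetGh j.1 A B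

/-- `k_A`. -/
def hypK (j : HypArg) (A : Fin 2) : ℝ :=
  (∑ B, jetGh j.1 A B * j.2.2.1 (Sum.inl B)) / (2 * j.1.1.2.2.1)

/-- The lower order terms of the equation parallel to the surfaces. -/
def hypPar (j : HypArg) (A : Fin 2) : ℝ :=
  jetMean j.1 / j.1.1.2.2.1 * hypK j A
  + ∑ k, ∑ i, invArr (jetGh j.1) k i * (hypDKK0 j k i A
      - ∑ l, jetChr j.1 l k i * hypKK0 j l A - ∑ l, jetChr j.1 l k A * hypKK0 j i l)
  - j.2.1.1.1 * (j.1.2 A.succ).2.2.1 / j.1.1.2.2.1 ^ 2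
  + (∑ B, jetGh j.1 A B * ∑ C : Fin 2, j.2.2.1 (Sum.inl C) * (j.1.2 C.succ).2.2.2 B)
      / (2 * j.1.1.2.2.1 ^ 2)
  + ∑ B, jetKh j.1 A B * j.2.2.1 (Sum.inl B) / j.1.1.2.2.1
  - ((j.1.2 0).2.2.1 - ∑ B : Fin 2, j.1.1.2.2.2 B * (j.1.2 B.succ).2.2.1) / j.1.1.2.2.1 ^ 2
      * hypK j A
  + ∑ B, ∑ C : Fin 2, invArr (jetGh j.1) B C * ((j.1.2 C.succ).2.2.1 / j.1.1.2.2.1) * hypKK j B A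
  - ((j.2.1.2 A).1 / j.1.1.2.2.1 - j.2.1.1.1 * (j.1.2 A.succ).2.2.1 / j.1.1.2.2.1 ^ 2)
  + j.2.2.2 A.succ

/-- The lower order terms of the equation orthogonal to the surfaces. -/
def hypOrt (j : HypArg) : ℝ :=
  j.2.1.1.1 * jetMean j.1 / j.1.1.2.2.1 ^ 2
  - dot2 (Matrix.of (jetGh j.1)) (Matrix.of (hypKK j)) (Matrix.of (jetKh j.1))
  + (∑ k, ∑ l, jetChr j.1 k k l * j.2.2.1 (Sum.inl l)) / (2 * j.1.1.2.2.1)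
  + (∑ A : Fin 2, j.2.2.1 (Sum.inl A) * (j.1.2 A.succ).2.2.1) / (2 * j.1.1.2.2.1 ^ 2)
  + ∑ l, j.2.2.2 l * normalUp j.1.1 l

/-- The source term of the first order system for `u`. -/
def hypSource (j : HypArg) : Idx → ℝ :=
  Sum.elim (fun A => 2 * hypPar j A) fun _ => -2 * j.1.1.2.2.1 * hypOrt j

section Smooth

variable {j : HypArg}

theorem contDiffAt_normalUp {q : Var} (h : q ∈ varDom) : ContDiffAt ℝ ∞ normalUp q := by
  have h0 : q.2.2.1 ≠ 0 := h.2.2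
  refine contDiffAt_pi.2 fun i => ?_
  fin_cases i
  · change ContDiffAt ℝ ∞ (fun q : Var => 1 / q.2.2.1) q
    fun_prop (disch := assumption)
  · change ContDiffAt ℝ ∞ (fun q : Var => -(q.2.2.2 0 / q.2.2.1)) q
    fun_prop (disch := assumption)
  · change ContDiffAt ℝ ∞ (fun q : Var => -(q.2.2.2 1 / q.2.2.1)) q
    fun_prop (disch := assumption)

theorem contDiffAt_hypSource (h : j ∈ hypDom) : ContDiffAt ℝ ∞ hypSource j := by
  have h' : j.1.1 ∈ varDom := h
  have h0 : j.1.1.2.2.1 ≠ 0 := h'.2.2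
  have h1 : 2 * j.1.1.2.2.1 ≠ 0 := mul_ne_zero two_ne_zero h0
  have h2 : j.1.1.2.2.1 ^ 2 ≠ 0 := pow_ne_zero 2 h0
  have h3 : 2 * j.1.1.2.2.1 ^ 2 ≠ 0 := mul_ne_zero two_ne_zero h2
  have hf : ContDiffAt ℝ ∞ (fun j : HypArg => j.1) j := contDiffAt_fst
  have hgh : ContDiffAt ℝ ∞ (fun j : HypArg => jetGh j.1) j := contDiffAt_jetGh.comp j hf
  have hM : ContDiffAt ℝ ∞ (fun j : HypArg => jetMean j.1) j := (contDiffAt_jetMean h').comp j hf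
  have hX : ContDiffAt ℝ ∞ (fun j : HypArg => jetChr j.1) j := (contDiffAt_jetChr h').comp j hf
  have hKh : ContDiffAt ℝ ∞ (fun j : HypArg => jetKh j.1) j := (contDiffAt_jetKh h').comp j hf
  have hn : ContDiffAt ℝ ∞ (fun j : HypArg => normalUp j.1.1) j :=
    (contDiffAt_normalUp h').comp (f := fun j : HypArg => j.1.1) j hf.fst
  have hi := contDiffAt_invArr hgh (det_jetGh_ne h')
  have hK0 : ContDiffAt ℝ ∞ hypKK0 j := by unfold hypKK0; fun_prop
  have hDK0 : ContDiffAt ℝ ∞ hypDKK0 j := by unfold hypDKK0; fun_prop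
  have hKK : ContDiffAt ℝ ∞ hypKK j := by unfold hypKK; fun_prop
  have hk : ContDiffAt ℝ ∞ hypK j := by unfold hypK; fun_prop (disch := assumption)
  have hd := contDiffAt_dot2 hgh (det_jetGh_ne h') hKK hKh
  refine contDiffAt_pi.2 fun r => ?_
  rcases r with A | _
  · change ContDiffAt ℝ ∞ (fun j => 2 * hypPar j A) j
    unfold hypPar
    fun_prop (disch := assumption)
  · change ContDiffAt ℝ ∞ (fun j => -2 * j.1.1.2.2.1 * hypOrt j) j
    unfold hypOrt
    fun_prop (disch := assumption)

theorem contDiffAt_hypRho {q : Var} (h : q ∈ varDom) (r s : Idx) :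
    ContDiffAt ℝ ∞ (fun q => hypRho q r s) q := by
  have h0 : q.2.2.1 ^ 2 ≠ 0 := pow_ne_zero 2 h.2.2
  rcases r with A | _ <;> rcases s with B | _
  · change ContDiffAt ℝ ∞ (fun q : Var => (q.2.2.1 ^ 2)⁻¹ * (q.1 ^ 2 * q.2.1 A B)) q
    fun_prop (disch := assumption)
  all_goals exact contDiffAt_const

theorem contDiffAt_hypSurf {q : Var} (h : q ∈ varDom) (K : Fin 2) (r s : Idx) :
    ContDiffAt ℝ ∞ (fun q => hypSurf q K r s) q := by
  have h0 : q.2.2.1 ^ 2 ≠ 0 := pow_ne_zero 2 h.2.2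
  rcases r with A | _ <;> rcases s with B | _
  · change ContDiffAt ℝ ∞ (fun q : Var => -(q.2.2.2 K / q.2.2.1 ^ 2) * (q.1 ^ 2 * q.2.1 A B)) q
    fun_prop (disch := assumption)
  · exact contDiffAt_const
  · exact contDiffAt_const
  · change ContDiffAt ℝ ∞ (fun q : Var => -2 * q.2.2.2 K) q
    fun_prop

end Smooth

namespace IsGauge

variable {U : Set Pt} {g : Pt → Matrix (Fin 4) (Fin 4) ℝ} {Om nu : Pt → ℝ}
  (H : IsGauge U g Om nu) {x : Pt}
include H

theorem isSymmHyperbolic (hx : x ∈ U) :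
    IsSymmHyperbolic (hypRho (vars g Om x)) (hypSurf (vars g Om x)) := by
  have hg : (vars g Om x).1 ^ 2 • Matrix.of (vars g Om x).2.1 = gh g x := (H.gh_eq_smul hx).symm
  have hN := H.Nh_pos hx
  refine ⟨?_, fun K => ?_⟩
  · rw [hypRho, hg]
    have hq : ((Nh g x ^ 2)⁻¹ • gh g x).PosDef := (H.gh_posDef hx).smul (by positivity)
    refine Matrix.PosDef.of_dotProduct_mulVec_pos ?_ fun v hv => ?_
    · refine Matrix.IsHermitian.fromBlocks hq.1 (by simp) ?_
      ext; simp
    · have h1 := hq.posSemidef.dotProduct_mulVec_nonneg (v ∘ Sum.inl)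
      have hs : star v ⬝ᵥ (Matrix.fromBlocks ((Nh g x ^ 2)⁻¹ • gh g x) 0 0
          (Matrix.of fun _ _ => (2 : ℝ))).mulVec v =
          star (v ∘ Sum.inl) ⬝ᵥ ((Nh g x ^ 2)⁻¹ • gh g x).mulVec (v ∘ Sum.inl)
            + 2 * v (Sum.inr ()) ^ 2 := by
        simp [dotProduct, Matrix.mulVec]
        ring
      change 0 < star v ⬝ᵥ (Matrix.fromBlocks ((Nh g x ^ 2)⁻¹ • gh g x) 0 0
          (Matrix.of fun _ _ => (2 : ℝ))).mulVec v
      rw [hs]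
      -- The matrix is block diagonal with both blocks positive: a nonzero vector has a nonzero
      -- surface part, or else a nonzero last entry.
      by_cases h0 : v ∘ Sum.inl = 0
      · have : v (Sum.inr ()) ≠ 0 := by
          intro h
          refine hv (funext fun r => ?_)
          rcases r with A | _
          · exact congrFun h0 A
          · exact h
        positivity
      · have := hq.dotProduct_mulVec_pos h0
        positivity
  · rw [hypSurf, hg]
    refine Matrix.IsSymm.fromBlocks ?_ ?_ ?_
    · exact Matrix.IsSymm.smul (Matrix.IsSymm.ext fun A B => H.splitOn.symm x hx B A) _
    · ext; simp
    · ext; simp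

theorem hypArg_mem (hx : x ∈ U) (G : Pt → Matrix (Fin 4) (Fin 4) ℝ) :
    hypArg g Om G x ∈ hypDom := H.vars_mem hx

theorem jetLeaf_dots (hx : x ∈ U) :
    jetLeaf (fun y => ((LnNh g y, LnGam g Om y) : ℝ × Arr)) x =
      ((LnNh g x, fun A B => LnGam g Om x A B), fun C => (pd (lf C) (LnNh g) x,
        fun A B => pd (lf C) (fun y => LnGam g Om y A B) x)) := by
  refine Prod.ext rfl (funext fun C => ?_)
  have h := H.smooth_LnGam hx
  change pd (lf C) (fun y => (LnNh g y, (fun A B => LnGam g Om y A B : Arr))) x = _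
  rw [pd_fst (H.smooth_LnNh hx) (contDiffAt_arr h), pd_arr h]

theorem hypArg_eq (hx : x ∈ U) (G : Pt → Matrix (Fin 4) (Fin 4) ℝ) : hypArg g Om G x =
    (varJet g Om (fun i => pd (sp i) (Nh g) x) x,
      ((LnNh g x, fun A B => LnGam g Om x A B), fun C => (pd (lf C) (LnNh g) x,
        fun A B => pd (lf C) (fun y => LnGam g Om y A B) x)), uVec g Om x, pSrc g G x) := by
  rw [hypArg, H.jet1_vars hx, H.jetLeaf_dots hx]

theorem pd_uVec (hx : x ∈ U) (a : Fin 4) : pd a (uVec g Om) x =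
    Sum.elim (fun A => pd a (fun y => LnShA g y A) x) fun _ => pd a (LnOm g Om) x := by
  have h : ContDiffAt ℝ ∞ (uVec g Om) x := contDiffAt_pi.2 fun r => by
    rcases r with A | _
    · exact H.smooth_LnShA hx A
    · exact H.smooth_LnOm hx
  funext r
  rw [pd_pi h r]
  rcases r with A | _ <;> rfl

end IsGauge


namespace IsGauge

variable {U : Set Pt} {g : Pt → Matrix (Fin 4) (Fin 4) ℝ} {Om nu : Pt → ℝ}
  (H : IsGauge U g Om nu) {x : Pt}
include H

theorem pd_KK0 (hx : x ∈ U) (a : Fin 4) (A B : Fin 2) : pd a (fun y => KK0 g y A B) x =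
    Om x * pd a Om x * LnGam g Om x A B
      + 1 / 2 * Om x ^ 2 * pd a (fun y => LnGam g Om y A B) x := by
  have h1 := H.smooth_Om_at hx
  have h2 := H.smooth_LnGam hx A B
  have h3 : ContDiffAt ℝ ∞ (fun y => 1 / 2 * Om y ^ 2) x := contDiffAt_const.mul (h1.pow 2)
  rw [pd_congr H.isOpen hx fun y hy => H.KK0_eq hy A B, pd_mul h3 h2,
    pd_mul contDiffAt_const (h1.pow 2), pd_const, pd_pow_two h1]
  ring

theorem pd_kap (hx : x ∈ U) (a : Fin 4) : pd a (kap g) x =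
    pd a (LnNh g) x / Nh g x - LnNh g x * pd a (Nh g) x / Nh g x ^ 2 := by
  rw [pd_congr H.isOpen hx fun y hy => H.kap_eq hy,
    pd_div (H.smooth_LnNh hx) (H.smooth_Nh hx) (H.Nh_pos hx).ne']

omit H in
theorem sum_ghMixed (v : Fin 3 → ℝ) (A : Fin 2) :
    ∑ l, v l * ghMixed g x l A.succ = v A.succ := by
  simp [ghMixed, nhDn]

theorem nhUp_eq_normalUp (hx : x ∈ U) : nhUp g x = normalUp (vars g Om x) := by
  funext i
  fin_cases i
  · exact H.nhUp_zero hx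
  · exact (H.nhUp_succ hx 0).trans (neg_div _ _)
  · exact (H.nhUp_succ hx 1).trans (neg_div _ _)

/-- Derivatives of `u` come only from `L_n̂ (L_n N̂^j)` and the gradient of `L_n ln Ω²`. In every
other term `κ`, `k`, `𝐊` are replaced by their values in `L_n N̂`, `L_n γ` and `u`, with derivatives
of the first two along the surface only. -/
theorem parEq_eq (hx : x ∈ U) (G : Pt → Matrix (Fin 4) (Fin 4) ℝ) (A : Fin 2) :
    parEq g Om G x A = (∑ B, gh g x A B * (pd 1 (fun y => LnShA g y B) x
        - ∑ C, ShA g x C * pd (lf C) (fun y => LnShA g y B) x)) / (2 * Nh g x ^ 2)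
      - 1 / 2 * pd (lf A) (LnOm g Om) x + hypPar (hypArg g Om G x) A := by
  have h0 := (H.Nh_pos hx).ne'
  rw [H.hypArg_eq hx, parEq, H.sum_gh3_lieVec hx, sum_ghMixed, H.lieFun_nhUp hx, H.kap_eq hx,
    H.pd_kap hx]
  set nd := fun i => pd (sp i) (Nh g) x with hnd
  simp only [H.trKh_eq_jet hx nd, H.kk_eq hx, H.kkUp_eq hx, H.acc_eq hx, H.pd_log_Nh hx,
    div2, cov2, H.pd_KK0 hx, H.KK0_eq hx, H.KK_eq_LnGam hx, H.christoffel_gh_eq_jet hx nd,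
    H.Kh_eq_jet hx nd, H.gh_eq_jet hx nd, Matrix.of_apply, hypPar, hypK, hypKK, hypKK0, hypDKK0,
    varJet_fst, varJet_snd, invArr, uVec, Sum.elim_inl, Sum.elim_inr]
  set J := varJet g Om nd x
  simp only [hnd, Fin.sum_univ_two]
  simp only [sp, lf, Fin.succ_zero_eq_one, Fin.succ_one_eq_two, Fin.reduceSucc]
  field_simp
  ring

theorem ortEq_eq (hx : x ∈ U) (G : Pt → Matrix (Fin 4) (Fin 4) ℝ) :
    ortEq g Om G x = (∑ K, pd (lf K) (fun y => LnShA g y K) x) / (2 * Nh g x)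
      - (Nh g x)⁻¹ * (pd 1 (LnOm g Om) x - ∑ K, ShA g x K * pd (lf K) (LnOm g Om) x)
      + hypOrt (hypArg g Om G x) := by
  have h0 := (H.Nh_pos hx).ne'
  have hK : KK g x = Matrix.of (hypKK (hypArg g Om G x)) := by
    ext A B
    rw [H.KK_eq_LnGam hx, H.gh_eq_smul hx]
    rfl
  rw [ortEq, hK, H.lieFun_nhUp hx, H.kap_eq hx, H.nhUp_eq_normalUp hx, hypOrt]
  set k := hypKK (hypArg g Om G x)
  rw [H.hypArg_eq hx]
  set nd := fun i => pd (sp i) (Nh g) x with hnd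
  simp only [H.trKh_eq_jet hx nd, H.kkUp_eq hx, H.pd_log_Nh hx, divVec, H.Kh_eq_jet hx nd,
    H.christoffel_gh_eq_jet hx nd, H.gh_eq_jet hx nd, varJet_snd, uVec, Sum.elim_inl]
  rw [show normalUp (varJet g Om nd x).1 = normalUp (vars g Om x) from rfl]
  simp only [varJet_fst]
  set J := varJet g Om nd x
  set D := dot2 (Matrix.of (jetGh J)) (Matrix.of k) (Matrix.of (jetKh J))
  set P := ∑ l, pSrc g G x l * normalUp (vars g Om x) l
  simp only [hnd, Fin.sum_univ_two]
  simp only [sp, lf, Fin.succ_zero_eq_one, Fin.succ_one_eq_two, Fin.reduceSucc]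
  field_simp
  ring

/-- The factor `2` turns `-½ ∂_A (L_n ln Ω²)` into `-∂_A`, and `-2N̂` turns `(2N̂)⁻¹ ∂_K (L_n N̂^K)`
into `-∂_K`. The off-diagonal blocks are then transposes of each other, and the entry for `∂_ρ (L_n
ln Ω²)` becomes `2 > 0`. -/
theorem first_order_system (hx : x ∈ U) (G : Pt → Matrix (Fin 4) (Fin 4) ℝ) :
    Sum.elim (fun A => 2 * parEq g Om G x A) (fun _ => -2 * Nh g x * ortEq g Om G x) =
      (hypRho (vars g Om x)).mulVec (pd 1 (uVec g Om) x)
        + ∑ K, (hypSurf (vars g Om x) K).mulVec (pd (lf K) (uVec g Om) x)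
        + hypSource (hypArg g Om G x) := by
  have h0 := (H.Nh_pos hx).ne'
  have hg : (vars g Om x).1 ^ 2 • Matrix.of (vars g Om x).2.1 = gh g x := (H.gh_eq_smul hx).symm
  have hN : (vars g Om x).2.2.1 = Nh g x := rfl
  have hS : (vars g Om x).2.2.2 = ShA g x := rfl
  have hN' : (hypArg g Om G x).1.1.2.2.1 = Nh g x := rfl
  funext r
  rcases r with A | _
  · simp only [Sum.elim_inl, H.parEq_eq hx, Pi.add_apply, Fin.sum_univ_two, hypRho, hypSurf, hg,
      H.pd_uVec hx, Matrix.fromBlocks_mulVec, Matrix.smul_apply, Matrix.mulVec, dotProduct,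
      Function.comp, Sum.elim_inr, smul_eq_mul, Finset.univ_unique, Finset.sum_singleton,
      Matrix.of_apply, Matrix.zero_apply, hypSource, hN, hS]
    fin_cases A <;>
    · simp only [lf, Fin.zero_eta, Fin.mk_one, Fin.isValue, if_true, zero_ne_one, one_ne_zero,
        if_false]
      field_simp
      ring
  · simp only [Sum.elim_inr, H.ortEq_eq hx, Pi.add_apply, Fin.sum_univ_two, hypRho, hypSurf, hg,
      H.pd_uVec hx, Matrix.fromBlocks_mulVec, Matrix.mulVec, dotProduct,
      Function.comp, Sum.elim_inl, Finset.univ_unique, Finset.sum_singleton,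
      Matrix.of_apply, Matrix.zero_apply, hypSource, hN, hN', hS]
    simp only [lf, Fin.isValue, if_true, zero_ne_one, one_ne_zero, if_false]
    field_simp
    ring

end IsGauge


/-! ### The scalar equation as a function of jets. -/

/-- Arguments of the scalar equation with the second derivatives of `Ω` and the derivatives of `N̂`
removed: the 1-jet of the geometric variables (the derivatives of `N̂` do not matter), the second
derivatives of `(γ_{AB}, N̂^A)`, the values of the time derivatives and of `𝔢`. -/
abbrev ScalArg : Type := VarJet × (Fin 3 → Fin 3 → Arr × (Fin 2 → ℝ)) × Dot × ℝ

/-- The derivative `∂_i` of `𝔻_A N̂^A`. -/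
def scalDDiv (z : ScalArg) (i : Fin 3) : ℝ :=
  ∑ A : Fin 2, (z.2.1 i A.succ).2 A + ∑ k, ∑ l,
    (fderiv ℝ chrArr (jetGam z.1) ((z.1.2 i).2.1, fun A : Fin 2 => (z.2.1 i A.succ).1) k k l
        * z.1.1.2.2.2 l
      + chrArr (jetGam z.1) k k l * (z.1.2 i).2.2.2 l)

/-- The derivative `∂_i` of `N̂ K̂^l_l`, without the second derivatives of `Ω`. -/
def scalDMean (z : ScalArg) (i : Fin 3) : ℝ :=
  -(2 / z.1.1.1 * ∑ A : Fin 2, (z.1.2 i).2.2.2 A * (z.1.2 A.succ).1)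
  - 2 / z.1.1.1 ^ 2 * (z.1.2 i).1
      * ((z.1.2 0).1 - ∑ A : Fin 2, z.1.1.2.2.2 A * (z.1.2 A.succ).1)
  - scalDDiv z i

/-- `𝔻^A 𝔻_A ln Ω²`, without the second derivatives of `Ω`. -/
def scalLap (J : VarJet) : ℝ :=
  ∑ A : Fin 2, ∑ B : Fin 2, invArr J.1.2.1 A B * (-(2 / J.1.1 ^ 2 * (J.2 A.succ).1 * (J.2 B.succ).1)
    - ∑ C : Fin 2, chrArr (jetGam J) C A B * (2 * (J.2 C.succ).1 / J.1.1))

/-- The trace-free part of `K̂_{AB}`. -/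
def jetKh0 (J : VarJet) : Arr := fun A B =>
  jetKh J A B - jetMean J / J.1.2.2.1 / 2 * jetGh J A B

/-- `k_A`. -/
def scalK (z : ScalArg) : Fin 2 → ℝ := fun A =>
  (∑ B, jetGh z.1 A B * z.2.2.1.2.2.1 B) / (2 * z.1.1.2.2.1)

/-- `𝐊°_{AB}`. -/
def scalKK0 (z : ScalArg) : Arr := fun A B => 1 / 2 * z.1.1.1 ^ 2 * z.2.2.1.2.1 A B

/-- The part of the scalar equation free of second derivatives of `Ω` and derivatives of `N̂`. -/
def scalRest (z : ScalArg) : ℝ :=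
  (z.1.1.1 ^ 2)⁻¹ * (scalArr (jetGam z.1) (fun A B => (z.2.1 A.succ B.succ).1) - scalLap z.1)
  - 2 / z.1.1.2.2.1 * ∑ i, normalUp z.1.1 i * scalDMean z i
  - 3 / 2 * (jetMean z.1 / z.1.1.2.2.1) ^ 2
  - dot2 (Matrix.of (jetGh z.1)) (Matrix.of (jetKh0 z.1)) (Matrix.of (jetKh0 z.1))
  + 2 * (z.2.2.1.1 / z.1.1.2.2.1) * z.2.2.1.2.2.2 + 1 / 2 * z.2.2.1.2.2.2 ^ 2
  - 2 * dot1 (Matrix.of (jetGh z.1)) (scalK z) (scalK z)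
  - dot2 (Matrix.of (jetGh z.1)) (Matrix.of (scalKK0 z)) (Matrix.of (scalKK0 z))
  - 2 * z.2.2.2

/-- The coefficients of `∂_i N̂` in the scalar equation. -/
def scalGrad (J : VarJet) (i : Fin 3) : ℝ :=
  2 * jetMean J / J.1.2.2.1 ^ 2 * normalUp J.1 i
  + (Fin.cons 0 (fun C => 2 / J.1.2.2.1 * ∑ A, ∑ B, invArr (jetGh J) A B * jetChr J C A B) :
      Fin 3 → ℝ) i

section Smooth

theorem contDiffAt_jetGh_inv {J : VarJet} (h : J.1 ∈ varDom) (A B : Fin 2) :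
    ContDiffAt ℝ ∞ (fun J => invArr (jetGh J) A B) J :=
  contDiffAt_invArr contDiffAt_jetGh (det_jetGh_ne h) A B

theorem contDiffAt_normalUp_jet {J : VarJet} (h : J.1 ∈ varDom) :
    ContDiffAt ℝ ∞ (fun J : VarJet => normalUp J.1) J :=
  (contDiffAt_normalUp h).comp J contDiffAt_fst

theorem contDiffAt_scalGrad {J : VarJet} (h : J.1 ∈ varDom) : ContDiffAt ℝ ∞ scalGrad J := by
  have h0 : J.1.2.2.1 ≠ 0 := h.2.2
  have h2 : J.1.2.2.1 ^ 2 ≠ 0 := pow_ne_zero 2 h0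
  have h3 := contDiffAt_jetGh_inv h
  have h4 := contDiffAt_jetChr h
  have h5 := contDiffAt_normalUp_jet h
  have h6 := contDiffAt_jetMean h
  refine contDiffAt_pi.2 fun i => ?_
  unfold scalGrad
  refine ContDiffAt.add (by fun_prop (disch := assumption)) ?_
  refine Fin.cases ?_ (fun C => ?_) i
  · exact contDiffAt_const
  · simp only [Fin.cons_succ]
    fun_prop (disch := assumption)

theorem contDiffAt_scalLap {J : VarJet} (h : J.1 ∈ varDom) : ContDiffAt ℝ ∞ scalLap J := by
  have h0 : J.1.1 ≠ 0 := h.1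
  have h2 : J.1.1 ^ 2 ≠ 0 := pow_ne_zero 2 h0
  have h3 := contDiffAt_chr_jetGam h
  have h4 := contDiffAt_invArr (q := fun J : VarJet => J.1.2.1) (z := J) (by fun_prop) h.2.1
  unfold scalLap
  fun_prop (disch := assumption)

theorem contDiffAt_jetKh0 {J : VarJet} (h : J.1 ∈ varDom) : ContDiffAt ℝ ∞ jetKh0 J := by
  have h0 : J.1.2.2.1 ≠ 0 := h.2.2
  have h3 := contDiffAt_jetKh h
  have h4 := contDiffAt_jetMean h
  have h5 := contDiffAt_jetGh (J := J)
  unfold jetKh0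
  fun_prop (disch := assumption)

theorem contDiffAt_scalDDiv {z : ScalArg} (h : z.1.1 ∈ varDom) : ContDiffAt ℝ ∞ scalDDiv z := by
  have hf : ContDiffAt ℝ ∞ (fun z : ScalArg => z.1) z := contDiffAt_fst
  have h1 : ContDiffAt ℝ ∞ (fun z : ScalArg => jetGam z.1) z := contDiffAt_jetGam.comp z hf
  have h2 : ContDiffAt ℝ ∞ (fun z : ScalArg => chrArr (jetGam z.1)) z :=
    (contDiffAt_chr_jetGam h).comp z hf
  have h3 : ∀ i : Fin 3, ContDiffAt ℝ ∞ (fun z : ScalArg => fderiv ℝ chrArr (jetGam z.1)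
      ((z.1.2 i).2.1, fun A : Fin 2 => (z.2.1 i A.succ).1)) z := fun i =>
    contDiffAt_fderiv_apply (p := fun z : ScalArg => jetGam z.1)
      (contDiffAt_chrArr_map (p := jetGam z.1) h.2.1) h1 (by fun_prop)
  refine contDiffAt_pi.2 fun i => ?_
  have h4 := h3 i
  unfold scalDDiv
  fun_prop

theorem contDiffAt_scalDMean {z : ScalArg} (h : z.1.1 ∈ varDom) : ContDiffAt ℝ ∞ scalDMean z := by
  have h0 : z.1.1.1 ≠ 0 := h.1
  have h2 : z.1.1.1 ^ 2 ≠ 0 := pow_ne_zero 2 h0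
  have h3 := contDiffAt_scalDDiv h
  unfold scalDMean
  fun_prop (disch := assumption)

theorem contDiffAt_scalRest {z : ScalArg} (h : z.1.1 ∈ varDom) : ContDiffAt ℝ ∞ scalRest z := by
  have h0 : z.1.1.2.2.1 ≠ 0 := h.2.2
  have h1 : 2 * z.1.1.2.2.1 ≠ 0 := mul_ne_zero two_ne_zero h0
  have h2 : z.1.1.1 ^ 2 ≠ 0 := pow_ne_zero 2 h.1
  have hf : ContDiffAt ℝ ∞ (fun z : ScalArg => z.1) z := contDiffAt_fst
  have hgh : ContDiffAt ℝ ∞ (fun z : ScalArg => jetGh z.1) z := contDiffAt_jetGh.comp z hf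
  have hR := contDiffAt_scalArr (p := fun z : ScalArg => jetGam z.1)
    (dd := fun z A B => (z.2.1 A.succ B.succ).1) (z := z) h.2.1 (contDiffAt_jetGam.comp z hf)
    (by fun_prop)
  have hL : ContDiffAt ℝ ∞ (fun z : ScalArg => scalLap z.1) z := (contDiffAt_scalLap h).comp z hf
  have hM : ContDiffAt ℝ ∞ (fun z : ScalArg => jetMean z.1) z := (contDiffAt_jetMean h).comp z hf
  have hn : ContDiffAt ℝ ∞ (fun z : ScalArg => normalUp z.1.1) z :=
    (contDiffAt_normalUp_jet h).comp z hf
  have hD := contDiffAt_scalDMean h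
  have hKh : ContDiffAt ℝ ∞ (fun z : ScalArg => jetKh0 z.1) z := (contDiffAt_jetKh0 h).comp z hf
  have hk : ContDiffAt ℝ ∞ scalK z := by unfold scalK; fun_prop (disch := assumption)
  have hKK : ContDiffAt ℝ ∞ scalKK0 z := by unfold scalKK0; fun_prop
  have hg0 := det_jetGh_ne h
  have d1 := contDiffAt_dot2 hgh hg0 hKh hKh
  have d2 := contDiffAt_dot1 hgh hg0 hk hk
  have d3 := contDiffAt_dot2 hgh hg0 hKK hKK
  unfold scalRest
  fun_prop (disch := assumption)

end Smooth


/-- The arguments of `scalRest` determined by a metric. -/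
def scalArg (g : Pt → Matrix (Fin 4) (Fin 4) ℝ) (Om : Pt → ℝ) (G : Pt → Matrix (Fin 4) (Fin 4) ℝ)
    (nd : Fin 3 → ℝ) (x : Pt) : ScalArg :=
  (varJet g Om nd x, fun i j => (fun A B => pd (sp i) (pd (sp j) (fun y => gam g Om y A B)) x,
    fun A => pd (sp i) (pd (sp j) (fun y => ShA g y A)) x), dots g Om x, eSrc g G x)

/-- The 1-jet of `γ_{AB}` along the surface. -/
def metJet (g : Pt → Matrix (Fin 4) (Fin 4) ℝ) (Om : Pt → ℝ) (x : Pt) : MetJet :=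
  (gamArr g Om x, fun A i j => pd (lf A) (fun y => gam g Om y i j) x)

namespace IsGauge

variable {U : Set Pt} {g : Pt → Matrix (Fin 4) (Fin 4) ℝ} {Om nu : Pt → ℝ}
  (H : IsGauge U g Om nu) {x : Pt}
include H

theorem smooth_metJet (hx : x ∈ U) : ContDiffAt ℝ ∞ (metJet g Om) x :=
  (H.smooth_gam_arr hx).prodMk <| contDiffAt_pi.2 fun _ =>
    contDiffAt_arr fun i j => contDiffAt_pd (H.smooth_gam hx i j)

theorem pd_metJet (hx : x ∈ U) (a : Fin 4) : pd a (metJet g Om) x =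
    (fun A B => pd a (fun y => gam g Om y A B) x,
      fun C A B => pd a (pd (lf C) (fun y => gam g Om y A B)) x) := by
  have h : ∀ C i j, ContDiffAt ℝ ∞ (fun y => pd (lf C) (fun y => gam g Om y i j) y) x :=
    fun C i j => contDiffAt_pd (H.smooth_gam hx i j)
  have h1 : ContDiffAt ℝ ∞ (fun y => fun C i j => pd (lf C) (fun y => gam g Om y i j) y) x :=
    contDiffAt_pi.2 fun C => contDiffAt_arr (h C)
  change pd a (fun y => (gamArr g Om y, fun C i j => pd (lf C) (fun y => gam g Om y i j) y)) x = _
  rw [pd_fst (H.smooth_gam_arr hx) h1, H.pd_gam hx]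
  exact Prod.ext rfl (funext fun C => (pd_pi h1 C).trans (pd_arr (h C)))

/-- The chain rule for the universal function `chrArr`; second derivatives of `γ` enter only in the
direction argument. -/
theorem pd_christoffel_gam (hx : x ∈ U) (a : Fin 4) (k i j : Fin 2) :
    pd a (fun y => christoffel lf (gam g Om) y k i j) x =
      fderiv ℝ chrArr (metJet g Om x) (pd a (metJet g Om) x) k i j := by
  have hd : (Matrix.of (metJet g Om x).1).det ≠ 0 := H.gam_metricOn.det_ne x hx
  have hc := (contDiffAt_chrArr_map hd).comp x (H.smooth_metJet hx)
  rw [← pd_comp (contDiffAt_chrArr_map hd) (H.smooth_metJet hx),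
    pd_pi (f := fun y => chrArr (metJet g Om y)) hc k,
    pd_pi (f := fun y => chrArr (metJet g Om y) k) (contDiffAt_pi.1 hc k) i,
    pd_pi (f := fun y => chrArr (metJet g Om y) k i) (contDiffAt_pi.1 (contDiffAt_pi.1 hc k) i) j]
  rfl

theorem scalarCurv_gam (hx : x ∈ U) (G : Pt → Matrix (Fin 4) (Fin 4) ℝ) (nd : Fin 3 → ℝ) :
    scalarCurv lf (gam g Om) x = scalArr (jetGam (scalArg g Om G nd x).1)
      (fun A B => ((scalArg g Om G nd x).2.1 A.succ B.succ).1) := by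
  have hd : (Matrix.of (metJet g Om x).1).det ≠ 0 := H.gam_metricOn.det_ne x hx
  have hc := (contDiffAt_curvArr hd).comp x (H.smooth_metJet hx)
  have h : ∀ a k, pd a (fun y => curvVec lf (gam g Om) y k) x =
      fderiv ℝ curvArr (metJet g Om x) (pd a (metJet g Om) x) k := by
    intro a k
    rw [← pd_comp (contDiffAt_curvArr hd) (H.smooth_metJet hx),
      pd_pi (f := fun y => curvArr (metJet g Om y)) hc k]
    rfl
  rw [H.gam_metricOn.scalarCurv_eq (Or.inl rfl) hx]
  simp only [h, H.pd_metJet hx]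
  rfl

theorem pd_divVec_gam (hx : x ∈ U) (G : Pt → Matrix (Fin 4) (Fin 4) ℝ) (nd : Fin 3 → ℝ)
    (i : Fin 3) : pd (sp i) (divVec lf (gam g Om) (ShA g)) x =
      scalDDiv (scalArg g Om G nd x) i := by
  have hb := H.smooth_ShA hx
  have hdb : ∀ A, ContDiffAt ℝ ∞ (pd (lf A) (fun y => ShA g y A)) x := fun A => contDiffAt_pd (hb A)
  have hX := fun k i j => H.gam_metricOn.smooth_christoffel (e := lf) hx k i j
  have hs : ∀ k l, ContDiffAt ℝ ∞ (fun y => christoffel lf (gam g Om) y k k l * ShA g y l) x :=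
    fun k l => (hX k k l).mul (hb l)
  have hs' : ∀ k, ContDiffAt ℝ ∞ (fun y => ∑ l, christoffel lf (gam g Om) y k k l * ShA g y l) x :=
    fun k => ContDiffAt.sum fun l _ => hs k l
  have e : pd (sp i) (divVec lf (gam g Om) (ShA g)) x =
      ∑ A, pd (sp i) (pd (lf A) (fun y => ShA g y A)) x + ∑ k, ∑ l,
        (pd (sp i) (fun y => christoffel lf (gam g Om) y k k l) x * ShA g x l
          + christoffel lf (gam g Om) x k k l * pd (sp i) (fun y => ShA g y l) x) := by
    unfold divVec
    rw [pd_add (ContDiffAt.sum fun A _ => hdb A) (ContDiffAt.sum fun k _ => hs' k),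
      pd_sum _ fun A _ => hdb A, pd_sum _ fun k _ => hs' k]
    congr 1
    refine Finset.sum_congr rfl fun k _ => ?_
    rw [pd_sum _ fun l _ => hs k l]
    exact Finset.sum_congr rfl fun l _ => pd_mul (hX k k l) (hb l)
  rw [e]
  simp only [H.pd_christoffel_gam hx, H.pd_metJet hx]
  rfl

theorem smooth_divVec_gam (hx : x ∈ U) : ContDiffAt ℝ ∞ (divVec lf (gam g Om) (ShA g)) x := by
  have hb := H.smooth_ShA hx
  have hX := fun k i j => H.gam_metricOn.smooth_christoffel (e := lf) hx k i j
  exact (ContDiffAt.sum fun A _ => contDiffAt_pd (hb A)).add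
    (ContDiffAt.sum fun k _ => ContDiffAt.sum fun l _ => (hX k k l).mul (hb l))

theorem smooth_mean (hx : x ∈ U) (nd : Fin 3 → ℝ) :
    ContDiffAt ℝ ∞ (fun y => jetMean (varJet g Om nd y)) x := by
  have hO := H.smooth_Om_at hx
  exact ((contDiffAt_const.div hO (H.Om_ne x hx)).mul ((contDiffAt_pd hO).sub
    (ContDiffAt.sum fun A _ => (H.smooth_ShA hx A).mul (contDiffAt_pd hO)))).sub
    (H.smooth_divVec_gam hx)

/-- `N̂ K̂^l_l` is linear in the gradient of `Ω`, contracted with `∂_ρ - N̂^A ∂_A = N̂ n̂`. One more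
normal derivative therefore produces the `n̂^i n̂^j ∂_i ∂_j Ω` part of the elliptic symbol. -/
theorem pd_mean (hx : x ∈ U) (G : Pt → Matrix (Fin 4) (Fin 4) ℝ) (nd : Fin 3 → ℝ) (i : Fin 3) :
    pd (sp i) (fun y => jetMean (varJet g Om nd y)) x =
      2 / Om x * (pd (sp i) (pd 1 Om) x - ∑ A, ShA g x A * pd (sp i) (pd (lf A) Om) x)
      + scalDMean (scalArg g Om G nd x) i := by
  have h0 := H.Om_ne x hx
  have hO := H.smooth_Om_at hx
  have hb := H.smooth_ShA hx
  have h1 : ContDiffAt ℝ ∞ (pd 1 Om) x := contDiffAt_pd hO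
  have h2 : ∀ A, ContDiffAt ℝ ∞ (pd (lf A) Om) x := fun A => contDiffAt_pd hO
  have h3 : ∀ A, ContDiffAt ℝ ∞ (fun y => ShA g y A * pd (lf A) Om y) x :=
    fun A => (hb A).mul (h2 A)
  have h4 : ContDiffAt ℝ ∞ (fun y => ∑ A, ShA g y A * pd (lf A) Om y) x :=
    ContDiffAt.sum fun A _ => h3 A
  have h5 : ContDiffAt ℝ ∞ (fun y => pd 1 Om y - ∑ A, ShA g y A * pd (lf A) Om y) x := h1.sub h4
  have h6 : ContDiffAt ℝ ∞ (fun y => 2 / Om y) x := contDiffAt_const.div hO h0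
  have h7 := H.smooth_divVec_gam hx
  have e : (fun y => jetMean (varJet g Om nd y)) = fun y =>
      2 / Om y * (pd 1 Om y - ∑ A, ShA g y A * pd (lf A) Om y)
        - divVec lf (gam g Om) (ShA g) y := rfl
  rw [e, pd_sub (h6.mul h5) h7, pd_mul h6 h5, pd_div contDiffAt_const hO h0, pd_const,
    pd_sub h1 h4, pd_sum _ fun A _ => h3 A, H.pd_divVec_gam hx G nd, scalDMean]
  simp only [pd_mul (hb _) (h2 _)]
  change _ = _ + (-(2 / Om x * ∑ A : Fin 2, pd (sp i) (fun y => ShA g y A) x * pd (lf A) Om x)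
    - 2 / Om x ^ 2 * pd (sp i) Om x * (pd 1 Om x - ∑ A : Fin 2, ShA g x A * pd (lf A) Om x) - _)
  rw [Finset.sum_add_distrib]
  ring

theorem laplacian_lnOm2 (hx : x ∈ U) (nd : Fin 3 → ℝ) :
    laplacian lf (gam g Om) (lnOm2 Om) x =
      2 / Om x * ∑ A, ∑ B, (gam g Om x)⁻¹ A B * pd (lf A) (pd (lf B) Om) x
        + scalLap (varJet g Om nd x) := by
  have h0 := H.Om_ne x hx
  have hO := H.smooth_Om_at hx
  have e : ∀ a b, pd a (fun y => pd b (lnOm2 Om) y) x =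
      2 / Om x * pd a (pd b Om) x - 2 / Om x ^ 2 * pd a Om x * pd b Om x := by
    intro a b
    have h1 : ContDiffAt ℝ ∞ (pd b Om) x := contDiffAt_pd hO
    rw [pd_congr H.isOpen hx fun y hy => H.pd_lnOm2 hy b,
      pd_div (contDiffAt_const.mul h1) hO h0, pd_mul contDiffAt_const h1, pd_const]
    field_simp
    ring
  simp only [laplacian, cov1, e, H.pd_lnOm2 hx]
  change _ = _ + ∑ A : Fin 2, ∑ B : Fin 2, (gam g Om x)⁻¹ A B
    * (-(2 / Om x ^ 2 * pd (lf A) Om x * pd (lf B) Om x)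
      - ∑ C : Fin 2, christoffel lf (gam g Om) x C A B * (2 * pd (lf C) Om x / Om x))
  simp only [Fin.sum_univ_two]
  ring

omit H in
theorem sum_surfInv (q : Var) (M : Fin 3 → Fin 3 → ℝ) : ∑ i, ∑ j, surfInv q i j * M i j =
    ∑ A : Fin 2, ∑ B : Fin 2, (q.1 ^ 2 • Matrix.of q.2.1)⁻¹ A B * M A.succ B.succ := by
  simp [surfInv, Fin.sum_univ_three, Fin.sum_univ_two]

theorem surf_gh (hx : x ∈ U) : (vars g Om x).1 ^ 2 • Matrix.of (vars g Om x).2.1 = gh g x :=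
  (H.gh_eq_smul hx).symm

/-- The master identity for both readings. Second derivatives of `Ω` come from `𝔻^k 𝔻_k ln Ω²` and
from `L_n̂ L_n̂ ln Ω²`, those of `N̂` only from its surface Laplacian. First derivatives of `N̂`
come from the Christoffel terms of that Laplacian and from `L_n̂` acting on the factor `1/N̂` of the
mean curvature. The rest does not see `N̂`-derivatives, whence the free `nd`. -/
theorem scalEq_eq (hx : x ∈ U) (G : Pt → Matrix (Fin 4) (Fin 4) ℝ) (nd : Fin 3 → ℝ) :
    scalEq g Om G x =
      ∑ i, ∑ j, ellCoeff (vars g Om x) i j * pd (sp i) (pd (sp j) Om) x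
      + ∑ i, ∑ j, parCoeff (vars g Om x) i j * pd (sp i) (pd (sp j) (Nh g)) x
      + ∑ i, scalGrad (varJet g Om nd x) i * pd (sp i) (Nh g) x
      + scalRest (scalArg g Om G nd x) := by
  have h0 := (H.Nh_pos hx).ne'
  have hO := H.Om_ne x hx
  set J := varJet g Om nd x with hJ
  set z := scalArg g Om G nd x with hz
  set P := (gh g x)⁻¹ with hP
  have hn := H.nhUp_eq_normalUp hx
  have hn0 : normalUp (vars g Om x) 0 = 1 / Nh g x := rfl
  have hnA : ∀ A : Fin 2, normalUp (vars g Om x) A.succ = -ShA g x A / Nh g x := fun A => by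
    rw [← hn, H.nhUp_succ hx]
  have ell : ∑ i, ∑ j, ellCoeff (vars g Om x) i j * pd (sp i) (pd (sp j) Om) x =
      -(2 / Om x) * (∑ A, ∑ B, P A B * pd (lf A) (pd (lf B) Om) x)
      - 4 / Om x * ∑ i, normalUp (vars g Om x) i
        * ∑ j, normalUp (vars g Om x) j * pd (sp i) (pd (sp j) Om) x := by
    have := sum_surfInv (vars g Om x) fun i j => pd (sp i) (pd (sp j) Om) x
    rw [H.surf_gh hx] at this
    rw [hP, ← this]
    simp only [ellCoeff, Matrix.of_apply, Fin.sum_univ_three, show (vars g Om x).1 = Om x from rfl]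
    ring
  have par : ∑ i, ∑ j, parCoeff (vars g Om x) i j * pd (sp i) (pd (sp j) (Nh g)) x =
      -(2 / Nh g x) * ∑ A, ∑ B, P A B * pd (lf A) (pd (lf B) (Nh g)) x := by
    have := sum_surfInv (vars g Om x) fun i j => pd (sp i) (pd (sp j) (Nh g)) x
    rw [H.surf_gh hx] at this
    rw [hP, ← this]
    simp only [parCoeff, Matrix.smul_apply, smul_eq_mul, Fin.sum_univ_three,
      show (vars g Om x).2.2.1 = Nh g x from rfl]
    ring
  have lapN : laplacian lf (gh g) (Nh g) x = ∑ A, ∑ B, P A B * pd (lf A) (pd (lf B) (Nh g)) x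
      - ∑ C : Fin 2, (∑ A, ∑ B, P A B * jetChr J C A B) * pd (lf C) (Nh g) x := by
    simp only [laplacian, cov1, H.christoffel_gh_eq_jet hx nd, Fin.sum_univ_two]
    change ((gh g x)⁻¹ 0 0 * (pd _ (pd _ _) _ - _) + (gh g x)⁻¹ 0 1 * (pd _ (pd _ _) _ - _)) +
      ((gh g x)⁻¹ 1 0 * (pd _ (pd _ _) _ - _) + (gh g x)⁻¹ 1 1 * (pd _ (pd _ _) _ - _)) = _
    rw [← hP, ← hJ]
    ring
  have grad : ∑ i, scalGrad J i * pd (sp i) (Nh g) x =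
      2 * jetMean J / Nh g x ^ 2 * ∑ i, normalUp (vars g Om x) i * pd (sp i) (Nh g) x
      + 2 / Nh g x * ∑ C : Fin 2, (∑ A, ∑ B, P A B * jetChr J C A B) * pd (lf C) (Nh g) x := by
    have hi : ∀ A B, invArr (jetGh J) A B = P A B := fun A B => by
      rw [hP, H.gh_eq_jet hx nd]; rfl
    simp only [scalGrad, hi, Fin.sum_univ_succ (n := 2), Fin.cons_zero, Fin.cons_succ]
    change (2 * jetMean J / Nh g x ^ 2 * normalUp (vars g Om x) 0 + 0) * _ + ∑ C : Fin 2,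
      (2 * jetMean J / Nh g x ^ 2 * normalUp (vars g Om x) C.succ + 2 / Nh g x * _) * _ = _
    simp only [Fin.sum_univ_two]
    ring
  have hm := H.smooth_mean hx nd
  have dn : lieFun sp (nhUp g) (fun y => lieFun sp (nhUp g) (lnOm2 Om) y
      - (Nh g y)⁻¹ * divVec lf (gam g Om) (ShA g) y) x =
      2 / Om x * (∑ i, normalUp (vars g Om x) i
        * ∑ j, normalUp (vars g Om x) j * pd (sp i) (pd (sp j) Om) x)
      - jetMean J / Nh g x ^ 2 * (∑ i, normalUp (vars g Om x) i * pd (sp i) (Nh g) x)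
      + 1 / Nh g x * ∑ i, normalUp (vars g Om x) i * scalDMean z i := by
    -- On `U` the bracket is `N̂⁻¹` times a function free of derivatives of `N̂`, so only the
    -- gradient of `N̂⁻¹` appears.
    have e : ∀ a, pd a (fun y => lieFun sp (nhUp g) (lnOm2 Om) y
        - (Nh g y)⁻¹ * divVec lf (gam g Om) (ShA g) y) x =
        -pd a (Nh g) x / Nh g x ^ 2 * jetMean J
          + (Nh g x)⁻¹ * pd a (fun y => jetMean (varJet g Om nd y)) x := by
      intro a
      rw [pd_congr H.isOpen hx fun y hy => (H.trKh_eq hy).symm.trans (H.trKh_eq_jet hy nd),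
        pd_mul (f := fun y => (Nh g y)⁻¹) ((H.smooth_Nh hx).inv h0) hm,
        pd_inv (H.smooth_Nh hx) h0]
    have e' : ∀ i, ∑ j, normalUp (vars g Om x) j * pd (sp i) (pd (sp j) Om) x =
        (Nh g x)⁻¹ * (pd (sp i) (pd 1 Om) x - ∑ A, ShA g x A * pd (sp i) (pd (lf A) Om) x) := by
      intro i
      simp only [Fin.sum_univ_succ (n := 2), hn0, hnA]
      simp only [Fin.sum_univ_two, sp, lf, Fin.succ_zero_eq_one, Fin.succ_one_eq_two,
        Fin.reduceSucc]
      ring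
    rw [lieFun, hn]
    simp only [e, H.pd_mean hx G nd, e', Fin.sum_univ_three]
    ring
  have rs : scalRest z = (Om x ^ 2)⁻¹ * (scalarCurv lf (gam g Om) x - scalLap J)
      - 2 / Nh g x * ∑ i, normalUp (vars g Om x) i * scalDMean z i
      - 3 / 2 * trKh g x ^ 2 - dot2 (gh g x) (Kh0 g x) (Kh0 g x)
      + 2 * kap g x * trKK g x + 1 / 2 * trKK g x ^ 2
      - 2 * dot1 (gh g x) (kk g x) (kk g x) - dot2 (gh g x) (KK0 g x) (KK0 g x)
      - 2 * eSrc g G x := by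
    have hKh : Kh0 g x = Matrix.of (jetKh0 J) := by
      rw [Kh0, H.trKh_eq_jet hx nd, H.Kh_eq_jet hx nd, H.gh_eq_jet hx nd, ← hJ]
      ext A B
      change _ = jetKh J A B - jetMean J / Nh g x / 2 * jetGh J A B
      simp only [Matrix.sub_apply, Matrix.smul_apply, Matrix.of_apply, smul_eq_mul]
      ring
    have hKK : KK0 g x = Matrix.of (scalKK0 z) := by
      ext A B; exact H.KK0_eq hx A B
    have hk : kk g x = scalK z := by
      funext A
      rw [H.kk_eq hx, H.gh_eq_jet hx nd]; rfl
    rw [hKh, hKK, hk, H.gh_eq_jet hx nd, H.scalarCurv_gam hx G nd, H.trKh_eq_jet hx nd,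
      H.kap_eq hx, H.trKK_eq hx, ← hz, ← hJ, scalRest]
    change _ - _ - 3 / 2 * (jetMean J / Nh g x) ^ 2 - _ + 2 * (LnNh g x / Nh g x) * LnOm g Om x
      + _ - _ - _ - _ = _
    rw [div_eq_inv_mul (jetMean J)]
    rfl
  have hPg : ∀ A B, P A B = (Om x ^ 2)⁻¹ * (gam g Om x)⁻¹ A B := fun A B => by
    rw [hP, H.inv_gh hx]; rfl
  rw [scalEq, rs, ell, par, grad, dn, lapN, H.laplacian_lnOm2 hx nd, ← hJ]
  have hlap : ∑ A, ∑ B, P A B * pd (lf A) (pd (lf B) Om) x = (Om x ^ 2)⁻¹ *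
      ∑ A, ∑ B, (gam g Om x)⁻¹ A B * pd (lf A) (pd (lf B) Om) x := by
    simp only [hPg, Fin.sum_univ_two]
    ring
  rw [hlap]
  ring

end IsGauge


/-! ### The elliptic and the parabolic reading. -/

/-- The arguments of `scalRest` among those of the elliptic equation. -/
def ellToScal (j : EllArg) : ScalArg :=
  (((j.1.1, j.2.1.1), fun i => (j.1.2 i, j.2.1.2.1 i)),
    fun i k => ((j.2.1.2.2 i k).1, (j.2.1.2.2 i k).2.2), j.2.2.1, j.2.2.2)

/-- The lower order part of the elliptic equation. -/
def ellRest (j : EllArg) : ℝ :=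
  ∑ i, ∑ k, parCoeff (ellToScal j).1.1 i k * (j.2.1.2.2 i k).2.1
    + ∑ i, scalGrad (ellToScal j).1 i * (j.2.1.2.1 i).2.1 + scalRest (ellToScal j)

/-- The arguments of `scalRest` among those of the parabolic equation. -/
def parToScal (j : ParArg) : ScalArg :=
  (((j.2.1.1.1, j.2.1.1.2.1, j.1, j.2.1.1.2.2),
    fun i => ((j.2.1.2.1 i).1, (j.2.1.2.1 i).2.1, 0, (j.2.1.2.1 i).2.2)),
    fun i k => (j.2.1.2.2 i k).2, j.2.2.1, j.2.2.2)

/-- The coefficients of the first order derivatives in the parabolic equation. -/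
def parGrad (j : ParArg) : Fin 3 → ℝ := scalGrad (parToScal j).1

/-- The lower order part of the parabolic equation. -/
def parRest (j : ParArg) : ℝ :=
  ∑ i, ∑ k, ellCoeff (parToScal j).1.1 i k * (j.2.1.2.2 i k).1 + scalRest (parToScal j)

theorem surf_det_ne {q : Var} (h : q ∈ varDom) : (q.1 ^ 2 • Matrix.of q.2.1).det ≠ 0 := by
  rw [Matrix.det_smul]
  exact mul_ne_zero (pow_ne_zero _ (pow_ne_zero 2 h.1)) h.2.1

theorem contDiffAt_surfInv {q : Var} (h : q ∈ varDom) (i j : Fin 3) :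
    ContDiffAt ℝ ∞ (fun q => surfInv q i j) q := by
  have hs : ∀ A B : Fin 2, ContDiffAt ℝ ∞ (fun q : Var => (q.1 ^ 2 • Matrix.of q.2.1)⁻¹ A B) q := by
    refine contDiffAt_matrix_inv (fun A B => ?_) (surf_det_ne h)
    change ContDiffAt ℝ ∞ (fun q : Var => q.1 ^ 2 * q.2.1 A B) q
    fun_prop
  fin_cases i <;> fin_cases j
  · exact contDiffAt_const
  · exact contDiffAt_const
  · exact contDiffAt_const
  · exact contDiffAt_const
  · exact hs 0 0
  · exact hs 0 1
  · exact contDiffAt_const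
  · exact hs 1 0
  · exact hs 1 1

theorem contDiffAt_ellCoeff {q : Var} (h : q ∈ varDom) (i j : Fin 3) :
    ContDiffAt ℝ ∞ (fun q => ellCoeff q i j) q := by
  have h0 : q.1 ≠ 0 := h.1
  have hs := contDiffAt_surfInv h
  have hn := contDiffAt_normalUp h
  change ContDiffAt ℝ ∞
    (fun q : Var => -(2 / q.1) * (surfInv q i j + 2 * normalUp q i * normalUp q j)) q
  fun_prop (disch := assumption)

theorem contDiffAt_parCoeff {q : Var} (h : q ∈ varDom) (i j : Fin 3) :
    ContDiffAt ℝ ∞ (fun q => parCoeff q i j) q := by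
  have h0 : q.2.2.1 ≠ 0 := h.2.2
  have hs := contDiffAt_surfInv h
  change ContDiffAt ℝ ∞ (fun q : Var => -(2 / q.2.2.1) * surfInv q i j) q
  fun_prop (disch := assumption)

theorem contDiffAt_ellRest {j : EllArg} (h : j ∈ ellDom) : ContDiffAt ℝ ∞ ellRest j := by
  have h' : (ellToScal j).1.1 ∈ varDom := h
  have hz : ContDiffAt ℝ ∞ ellToScal j := by unfold ellToScal; fun_prop
  have h1 : ∀ i k, ContDiffAt ℝ ∞ (fun j => parCoeff (ellToScal j).1.1 i k) j := fun i k =>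
    (contDiffAt_parCoeff h' i k).comp (f := fun j => (ellToScal j).1.1) j hz.fst.fst
  have h2 : ContDiffAt ℝ ∞ (fun j => scalGrad (ellToScal j).1) j :=
    (contDiffAt_scalGrad h').comp (f := fun j => (ellToScal j).1) j hz.fst
  have h3 : ContDiffAt ℝ ∞ (fun j => scalRest (ellToScal j)) j := (contDiffAt_scalRest h').comp j hz
  unfold ellRest
  fun_prop

theorem contDiffAt_parToScal {j : ParArg} : ContDiffAt ℝ ∞ parToScal j := by
  unfold parToScal; fun_prop

theorem contDiffAt_parGrad {j : ParArg} (h : j ∈ parDom) : ContDiffAt ℝ ∞ parGrad j :=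
  (contDiffAt_scalGrad (J := (parToScal j).1) h).comp (f := fun j => (parToScal j).1) j
    contDiffAt_parToScal.fst

theorem contDiffAt_parRest {j : ParArg} (h : j ∈ parDom) : ContDiffAt ℝ ∞ parRest j := by
  have h' : (parToScal j).1.1 ∈ varDom := h
  have hz := contDiffAt_parToScal (j := j)
  have h1 : ∀ i k, ContDiffAt ℝ ∞ (fun j => ellCoeff (parToScal j).1.1 i k) j := fun i k =>
    (contDiffAt_ellCoeff h' i k).comp (f := fun j => (parToScal j).1.1) j hz.fst.fst
  have h3 : ContDiffAt ℝ ∞ (fun j => scalRest (parToScal j)) j := (contDiffAt_scalRest h').comp j hz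
  unfold parRest
  fun_prop

namespace IsGauge

variable {U : Set Pt} {g : Pt → Matrix (Fin 4) (Fin 4) ℝ} {Om nu : Pt → ℝ}
  (H : IsGauge U g Om nu) {x : Pt}
include H

theorem ellArg_mem (hx : x ∈ U) (G : Pt → Matrix (Fin 4) (Fin 4) ℝ) :
    ellArg g Om G x ∈ ellDom := H.vars_mem hx

theorem parArg_mem (hx : x ∈ U) (G : Pt → Matrix (Fin 4) (Fin 4) ℝ) :
    parArg g Om G x ∈ parDom := H.vars_mem hx

theorem pd_gam_Nh_ShA (hx : x ∈ U) (a : Fin 4) :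
    pd a (fun y => (gamArr g Om y, Nh g y, ShA g y)) x =
      (pd a (gamArr g Om) x, pd a (Nh g) x, pd a (ShA g) x) := by
  have h1 := H.smooth_Nh hx
  have h2 := H.smooth_ShA_vec hx
  rw [pd_fst (H.smooth_gam_arr hx) (h1.prodMk h2), pd_fst h1 h2]

theorem pd_pd_gam_Nh_ShA (hx : x ∈ U) (a b : Fin 4) :
    pd a (pd b (fun y => (gamArr g Om y, Nh g y, ShA g y))) x =
      (pd a (pd b (gamArr g Om)) x, pd a (pd b (Nh g)) x, pd a (pd b (ShA g)) x) := by
  have h0 : ContDiffAt ℝ ∞ (pd b (gamArr g Om)) x := contDiffAt_pd (H.smooth_gam_arr hx)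
  have h1 : ContDiffAt ℝ ∞ (pd b (Nh g)) x := contDiffAt_pd (H.smooth_Nh hx)
  have h2 : ContDiffAt ℝ ∞ (pd b (ShA g)) x := contDiffAt_pd (H.smooth_ShA_vec hx)
  rw [pd_congr H.isOpen hx fun y hy => H.pd_gam_Nh_ShA hy b, pd_fst h0 (h1.prodMk h2),
    pd_fst h1 h2]

theorem pd_Om_gam_ShA (hx : x ∈ U) (a : Fin 4) :
    pd a (fun y => (Om y, gamArr g Om y, ShA g y)) x =
      (pd a Om x, pd a (gamArr g Om) x, pd a (ShA g) x) := by
  have h1 := H.smooth_gam_arr hx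
  have h2 := H.smooth_ShA_vec hx
  rw [pd_fst (H.smooth_Om_at hx) (h1.prodMk h2), pd_fst h1 h2]

theorem pd_pd_Om_gam_ShA (hx : x ∈ U) (a b : Fin 4) :
    pd a (pd b (fun y => (Om y, gamArr g Om y, ShA g y))) x =
      (pd a (pd b Om) x, pd a (pd b (gamArr g Om)) x, pd a (pd b (ShA g)) x) := by
  have h0 : ContDiffAt ℝ ∞ (pd b Om) x := contDiffAt_pd (H.smooth_Om_at hx)
  have h1 : ContDiffAt ℝ ∞ (pd b (gamArr g Om)) x := contDiffAt_pd (H.smooth_gam_arr hx)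
  have h2 : ContDiffAt ℝ ∞ (pd b (ShA g)) x := contDiffAt_pd (H.smooth_ShA_vec hx)
  rw [pd_congr H.isOpen hx fun y hy => H.pd_Om_gam_ShA hy b, pd_fst h0 (h1.prodMk h2),
    pd_fst h1 h2]

theorem ellArg_eq (hx : x ∈ U) (G : Pt → Matrix (Fin 4) (Fin 4) ℝ) : ellArg g Om G x =
    ((Om x, fun i => pd (sp i) Om x), ((gamArr g Om x, Nh g x, ShA g x),
      (fun i => (pd (sp i) (gamArr g Om) x, pd (sp i) (Nh g) x, pd (sp i) (ShA g) x)),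
      fun i k => (pd (sp i) (pd (sp k) (gamArr g Om)) x, pd (sp i) (pd (sp k) (Nh g)) x,
        pd (sp i) (pd (sp k) (ShA g)) x)), dots g Om x, eSrc g G x) := by
  simp only [← H.pd_gam_Nh_ShA hx, ← H.pd_pd_gam_Nh_ShA hx]
  rfl

theorem parArg_eq (hx : x ∈ U) (G : Pt → Matrix (Fin 4) (Fin 4) ℝ) : parArg g Om G x =
    (Nh g x, ((Om x, gamArr g Om x, ShA g x),
      (fun i => (pd (sp i) Om x, pd (sp i) (gamArr g Om) x, pd (sp i) (ShA g) x)),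
      fun i k => (pd (sp i) (pd (sp k) Om) x, pd (sp i) (pd (sp k) (gamArr g Om)) x,
        pd (sp i) (pd (sp k) (ShA g)) x)), dots g Om x, eSrc g G x) := by
  simp only [← H.pd_Om_gam_ShA hx, ← H.pd_pd_Om_gam_ShA hx]
  rfl

theorem ellToScal_ellArg (hx : x ∈ U) (G : Pt → Matrix (Fin 4) (Fin 4) ℝ) :
    ellToScal (ellArg g Om G x) = scalArg g Om G (fun i => pd (sp i) (Nh g) x) x := by
  rw [H.ellArg_eq hx]
  simp only [H.pd_gam hx, H.pd_ShA hx, H.pd_pd_gam hx, H.pd_pd_ShA hx]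
  rfl

/-- The arguments of the parabolic coefficients contain no derivative of `N̂`; its slot is filled
with zeros, the choice `nd = 0` in the master identity. -/
theorem parToScal_parArg (hx : x ∈ U) (G : Pt → Matrix (Fin 4) (Fin 4) ℝ) :
    parToScal (parArg g Om G x) = scalArg g Om G (fun _ => 0) x := by
  rw [H.parArg_eq hx]
  simp only [H.pd_gam hx, H.pd_ShA hx, H.pd_pd_gam hx, H.pd_pd_ShA hx]
  rfl

/-- Here `nd` is the true gradient of `N̂`, and all derivatives of `N̂` in the master identity go
into the lower order part. -/
theorem elliptic_equation (hx : x ∈ U) (G : Pt → Matrix (Fin 4) (Fin 4) ℝ) :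
    scalEq g Om G x = ∑ i, ∑ j, ellCoeff (vars g Om x) i j * pd (sp i) (pd (sp j) Om) x
      + ellRest (ellArg g Om G x) := by
  rw [H.scalEq_eq hx G fun i => pd (sp i) (Nh g) x, ellRest, H.ellToScal_ellArg hx,
    H.ellArg_eq hx, add_assoc, add_assoc]
  simp only [add_assoc]
  rfl

theorem parabolic_equation (hx : x ∈ U) (G : Pt → Matrix (Fin 4) (Fin 4) ℝ) :
    scalEq g Om G x =
      ∑ i, ∑ j, parCoeff (vars g Om x) i j * pd (sp i) (pd (sp j) (Nh g)) x
        + ∑ i, parGrad (parArg g Om G x) i * pd (sp i) (Nh g) x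
        + parRest (parArg g Om G x) := by
  have e : parRest (parArg g Om G x) =
      ∑ i, ∑ j, ellCoeff (vars g Om x) i j * pd (sp i) (pd (sp j) Om) x
        + scalRest (scalArg g Om G (fun _ => 0) x) := by
    rw [parRest, H.parToScal_parArg hx, H.parArg_eq hx]
    rfl
  rw [H.scalEq_eq hx G fun _ => 0, e, parGrad, H.parToScal_parArg hx,
    show (scalArg g Om G (fun _ => 0) x).1 = varJet g Om (fun _ => 0) x from rfl]
  ring

/-- Only the mean curvature part of `scalGrad` has a `ρ` component, the Christoffel part being
tangential; `n̂^ρ = 1/N̂` and `jetMean = N̂ K̂^l_l` give the value. -/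
theorem parGrad_rho (hx : x ∈ U) (G : Pt → Matrix (Fin 4) (Fin 4) ℝ) :
    parGrad (parArg g Om G x) 0 = 2 * trKh g x / Nh g x ^ 2 := by
  rw [parGrad, H.parToScal_parArg hx, H.trKh_eq_jet hx fun _ => 0]
  change 2 * jetMean (varJet g Om (fun _ => 0) x) / Nh g x ^ 2 * (1 / Nh g x) + 0 = _
  ring

theorem surf_form_pos (hx : x ∈ U) {v : Fin 2 → ℝ} (hv : v ≠ 0) :
    0 < ∑ A, ∑ B, (gh g x)⁻¹ A B * (v A * v B) := by
  have h := (H.gh_posDef hx).inv.dotProduct_mulVec_pos hv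
  simp only [dotProduct, Matrix.mulVec, Fin.sum_univ_two, star_trivial] at h ⊢
  linarith

theorem surf_form_nonneg (hx : x ∈ U) (v : Fin 2 → ℝ) :
    0 ≤ ∑ A, ∑ B, (gh g x)⁻¹ A B * (v A * v B) := by
  by_cases hv : v = 0
  · simp [hv]
  · exact (H.surf_form_pos hx hv).le

/-- The symbol is `-2/Ω`, of either sign but nonzero, times `γ̂^{AB} ξ_A ξ_B + 2 (n̂^i ξ_i)²`. The
first term vanishes only if the surface components do, and then the second is `2 (ξ_ρ / N̂)²`. -/
theorem isElliptic (hx : x ∈ U) : IsElliptic (ellCoeff (vars g Om x)) := by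
  intro w hw
  have h0 := (H.Nh_pos hx).ne'
  have hO : Om x ≠ 0 := H.Om_ne x hx
  have e : ∑ i, ∑ j, ellCoeff (vars g Om x) i j * w i * w j = -(2 / Om x)
      * (∑ A : Fin 2, ∑ B : Fin 2, (gh g x)⁻¹ A B * (w A.succ * w B.succ)
        + 2 * (∑ i, normalUp (vars g Om x) i * w i) ^ 2) := by
    have := sum_surfInv (vars g Om x) fun i j => w i * w j
    rw [H.surf_gh hx] at this
    rw [← this]
    simp only [ellCoeff, Matrix.of_apply, Fin.sum_univ_three, show (vars g Om x).1 = Om x from rfl]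
    ring
  rw [e]
  refine mul_ne_zero (neg_ne_zero.2 (div_ne_zero two_ne_zero hO)) (ne_of_gt ?_)
  by_cases hv : (fun A : Fin 2 => w A.succ) = 0
  · have h1 : ∀ A : Fin 2, w A.succ = 0 := congrFun hv
    have h2 : w 0 ≠ 0 := fun h => hw (funext fun i => Fin.cases h h1 i)
    have h3 : normalUp (vars g Om x) 0 = 1 / Nh g x := rfl
    simp only [Fin.sum_univ_succ (n := 2), h1, h3, mul_zero, Finset.sum_const_zero,
      zero_add, add_zero]
    positivity
  · have := H.surf_form_pos hx hv
    positivity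

theorem isParabolic (hx : x ∈ U) (G : Pt → Matrix (Fin 4) (Fin 4) ℝ) (hK : trKh g x ≠ 0) :
    IsParabolic (parCoeff (vars g Om x)) (parGrad (parArg g Om G x)) := by
  have h0 := H.Nh_pos hx
  have hP : ∀ A B, (gh g x)⁻¹ A B = (gh g x)⁻¹ B A := H.splitOn.inv_symm hx
  have hs : surfInv (vars g Om x) = !![0, 0, 0; 0, (gh g x)⁻¹ 0 0, (gh g x)⁻¹ 0 1;
      0, (gh g x)⁻¹ 1 0, (gh g x)⁻¹ 1 1] := by
    rw [← H.surf_gh hx]; rfl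
  have hN : (vars g Om x).2.2.1 = Nh g x := rfl
  have form : ∀ w : Fin 3 → ℝ, w ⬝ᵥ (parCoeff (vars g Om x)).mulVec w =
      -(2 / Nh g x) * ∑ A : Fin 2, ∑ B : Fin 2, (gh g x)⁻¹ A B * (w A.succ * w B.succ) := by
    intro w
    have := sum_surfInv (vars g Om x) fun i j => w i * w j
    rw [H.surf_gh hx] at this
    rw [← this]
    simp only [parCoeff, hN, dotProduct, Matrix.mulVec, Matrix.smul_apply, smul_eq_mul,
      Fin.sum_univ_three]
    ring
  refine ⟨Or.inr (Matrix.PosSemidef.of_dotProduct_mulVec_nonneg ?_ fun w => ?_), fun w => ⟨fun h => ?_,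
    fun h => ?_⟩, ?_⟩
  · refine Matrix.IsHermitian.ext fun i j => ?_
    rw [parCoeff, hs]
    fin_cases i <;> fin_cases j <;> simp [hP 1 0]
  · have := H.surf_form_nonneg hx fun A => w A.succ
    rw [star_trivial, Matrix.neg_mulVec, dotProduct_neg, form, neg_mul, neg_neg]
    positivity
  -- A null covector has zero quadratic form, which positivity of `γ̂^{AB}` forbids unless its
  -- surface components vanish.
  · by_contra hne
    have hv : (fun A : Fin 2 => w A.succ) ≠ 0 := fun h => hne (congrFun h)
    have h1 := H.surf_form_pos hx hv
    have h2 := form w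
    rw [h, dotProduct_zero] at h2
    have : 0 < 2 / Nh g x * ∑ A : Fin 2, ∑ B : Fin 2, (gh g x)⁻¹ A B * (w A.succ * w B.succ) := by
      positivity
    linarith
  · have h1 : w 1 = 0 := h 0
    have h2 : w 2 = 0 := h 1
    rw [parCoeff, hs]
    funext i
    fin_cases i <;> simp [Matrix.mulVec, dotProduct, Fin.sum_univ_three, h1, h2]
  · rw [H.parGrad_rho hx]
    positivity

end IsGauge

end TwoSurf

end

theorem theorem5p1 :
    -- the constraints are equivalent to the recast system
    (∀ (U : Set Pt) (g : Pt → Matrix (Fin 4) (Fin 4) ℝ) (Om nu : Pt → ℝ)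
        (G : Pt → Matrix (Fin 4) (Fin 4) ℝ), IsGauge U g Om nu → ∀ x ∈ U,
      (hamiltonian g G x = 0 ↔ scalEq g Om G x = 0) ∧
      ((∀ j, momentum g G x j = 0) ↔ (∀ A, parEq g Om G x A = 0) ∧ ortEq g Om G x = 0)) ∧
    -- the parallel and orthogonal equations: symmetric hyperbolic for `u`
    (∃ B : HypArg → Idx → ℝ,
      ContDiffOn ℝ ∞ B hypDom ∧
      (∀ r s, ContDiffOn ℝ ∞ (fun q => hypRho q r s) varDom) ∧
      (∀ K r s, ContDiffOn ℝ ∞ (fun q => hypSurf q K r s) varDom) ∧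
      ∀ (U : Set Pt) (g : Pt → Matrix (Fin 4) (Fin 4) ℝ) (Om nu : Pt → ℝ)
        (G : Pt → Matrix (Fin 4) (Fin 4) ℝ), IsGauge U g Om nu → ∀ x ∈ U,
        hypArg g Om G x ∈ hypDom ∧
        IsSymmHyperbolic (hypRho (vars g Om x)) (hypSurf (vars g Om x)) ∧
        (Sum.elim (fun A => 2 * parEq g Om G x A) (fun _ => -2 * Nh g x * ortEq g Om G x) =
          (hypRho (vars g Om x)).mulVec (pd 1 (uVec g Om) x)
            + ∑ K, (hypSurf (vars g Om x) K).mulVec (pd (lf K) (uVec g Om) x)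
            + B (hypArg g Om G x))) ∧
    -- the scalar equation read as an equation for `Ω`: elliptic
    (∃ F : EllArg → ℝ,
      ContDiffOn ℝ ∞ F ellDom ∧
      (∀ i j, ContDiffOn ℝ ∞ (fun q => ellCoeff q i j) varDom) ∧
      ∀ (U : Set Pt) (g : Pt → Matrix (Fin 4) (Fin 4) ℝ) (Om nu : Pt → ℝ)
        (G : Pt → Matrix (Fin 4) (Fin 4) ℝ), IsGauge U g Om nu → ∀ x ∈ U,
        ellArg g Om G x ∈ ellDom ∧
        IsElliptic (ellCoeff (vars g Om x)) ∧
        scalEq g Om G x =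
          ∑ i, ∑ j, ellCoeff (vars g Om x) i j * pd (sp i) (pd (sp j) Om) x
            + F (ellArg g Om G x)) ∧
    -- the scalar equation read as an equation for `N̂`: parabolic where `K̂^l_l` does not vanish
    (∃ (b : ParArg → Fin 3 → ℝ) (F : ParArg → ℝ),
      ContDiffOn ℝ ∞ b parDom ∧ ContDiffOn ℝ ∞ F parDom ∧
      (∀ i j, ContDiffOn ℝ ∞ (fun q => parCoeff q i j) varDom) ∧
      ∀ (U : Set Pt) (g : Pt → Matrix (Fin 4) (Fin 4) ℝ) (Om nu : Pt → ℝ)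
        (G : Pt → Matrix (Fin 4) (Fin 4) ℝ), IsGauge U g Om nu → ∀ x ∈ U,
        parArg g Om G x ∈ parDom ∧
        b (parArg g Om G x) 0 = 2 * trKh g x / Nh g x ^ 2 ∧
        (trKh g x ≠ 0 → IsParabolic (parCoeff (vars g Om x)) (b (parArg g Om G x))) ∧
        scalEq g Om G x =
          ∑ i, ∑ j, parCoeff (vars g Om x) i j * pd (sp i) (pd (sp j) (Nh g)) x
            + ∑ i, b (parArg g Om G x) i * pd (sp i) (Nh g) x
            + F (parArg g Om G x)) := by
  refine ⟨fun U g Om nu G H x hx => H.constraints_iff hx G,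
    ⟨hypSource, fun j hj => (contDiffAt_hypSource hj).contDiffWithinAt,
      fun r s q hq => (contDiffAt_hypRho hq r s).contDiffWithinAt,
      fun K r s q hq => (contDiffAt_hypSurf hq K r s).contDiffWithinAt,
      fun U g Om nu G H x hx => ⟨H.hypArg_mem hx G, H.isSymmHyperbolic hx,
        H.first_order_system hx G⟩⟩,
    ⟨ellRest, fun j hj => (contDiffAt_ellRest hj).contDiffWithinAt,
      fun i k q hq => (contDiffAt_ellCoeff hq i k).contDiffWithinAt,
      fun U g Om nu G H x hx => ⟨H.ellArg_mem hx G, H.isElliptic hx, H.elliptic_equation hx G⟩⟩,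
    ⟨parGrad, parRest, fun j hj => (contDiffAt_parGrad hj).contDiffWithinAt,
      fun j hj => (contDiffAt_parRest hj).contDiffWithinAt,
      fun i k q hq => (contDiffAt_parCoeff hq i k).contDiffWithinAt,
      fun U g Om nu G H x hx => ⟨H.parArg_mem hx G, H.parGrad_rho hx G, H.isParabolic hx G,
        H.parabolic_equation hx G⟩⟩⟩
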